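/- Let $\Bbbk$ be a field, let $H$ be a finite dimensional Hopf algebra over $\Bbbk$ with comultiplication $\Delta(h)=\sum h_{(1)}\otimes h_{(2)}$, counit $\epsilon$ and antipode $S$ (which is bijective), and let $A$ be a left $H$-module algebra. Let $B=A\# H$ be the smash product, i.e. the vector space $A\otimes H$ with multiplication $(a\otimes h)(b\otimes l)=\sum a(h_{(1)}\cdot b)\otimes h_{(2)}l$. Left $B$-modules are called hopfological modules; they restrict to $A$-modules and to $H$-modules along the inclusions $A,H\subset B$. We use the following notions. * For $B$-modules $M,N$, the space $\mathrm{Hom}_A(M,N)$ is an $H$-module via $(h\cdot f)(m)=\sum h_{(2)}f(S^{-1}(h_{(1)})m)$. For an $H$-module $V$ put $\mathcal Z(V)=\{v\in V: hv=\epsilon(h)v \text{ for all } h\in H\}$. * The stable category of $H$-modules has $H$-modules as objects and, as morphisms, $H$-linear maps modulo those that factor through an injective $H$-module. A map of $B$-modules is a quasi-isomorphism if its restriction to $H$ becomes an isomorphism in this stable category, and a $B$-module $K$ is acyclic if $0\to K$ is a quasi-isomorphism. * A $B$-module $P$ is cofibrant if for every surjective quasi-isomorphism $M\twoheadrightarrow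 N$ of $B$-modules the induced map $\mathcal Z(\mathrm{Hom}_A(P,M))\to\mathcal Z(\mathrm{Hom}_A(P,N))$ is surjective. * For an $H$-module $V$, the $B$-module $A\otimes V$ has the action $(a\otimes h)(b\otimes v)=\sum a(h_{(1)}\cdot b)\otimes h_{(2)}v$. A $B$-module has property (P) if it is isomorphic, as a $B$-module, to a $B$-module $P$ with a filtration $0\subset F_0\subset F_1\subset F_2\subset\cdots\subset P$ by $B$-submodules such that $P=\bigcup_{r\ge 0}F_r$, each inclusion $F_r\subset F_{r+1}$ splits as a map of left $A$-modules, and $F_0$ and all the quotients $F_{r+1}/F_r$ are isomorphic, as $B$-modules, to direct sums of $B$-modules of the form $A\otimes V$ with $V$ an indecomposable $H$-module. Then, for every hopfological module $M$: 1. $M$ is cofibrant if and only if $M$ is projective as an $A$-module and, for every acyclic $B$-module $K$, the $H$-module $\mathrm{Hom}_A(M,K)$ is projective and injective. 2. $M$ is cofibrant if and only if $M$ is a direct summand, in the category of $B$-modules, of a $B$-module with property (P). -/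

import Mathlib

open CategoryTheory TensorProduct Coalgebra

universe u

noncomputable section

namespace Hopfological

/-! ### Convolution of linear maps and bijectivity of the antipode -/

section Antipode

variable {k : Type*} [Field k] {H : Type*} [Ring H] [HopfAlgebra k H]

/-- The convolution product `(f ⋆ g)(h) = f(h₁) g(h₂)` of linear maps from a coalgebra to an
algebra. -/
def cv {R : Type*} [Ring R] [Algebra k R] (f g : H →ₗ[k] R) : H →ₗ[k] R :=
  LinearMap.mul' k R ∘ₗ TensorProduct.map f g ∘ₗ comul

/-- The unit `h ↦ ε(h) 1` of the convolution product. -/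
def cu (R : Type*) [Ring R] [Algebra k R] : H →ₗ[k] R :=
  Algebra.linearMap k R ∘ₗ counit

section
variable {R : Type*} [Ring R] [Algebra k R]

theorem cv_eq (f g : H →ₗ[k] R) :
    cv f g = (WithConv.toConv f * WithConv.toConv g).ofConv := rfl

theorem cv_apply (f g : H →ₗ[k] R) (h : H) :
    cv f g h = ∑ i ∈ (ℛ k h).index, f ((ℛ k h).left i) * g ((ℛ k h).right i) :=
  (ℛ k h).convMul_apply (WithConv.toConv f) (WithConv.toConv g)

theorem cv_assoc (f g l : H →ₗ[k] R) : cv (cv f g) l = cv f (cv g l) :=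
  congrArg WithConv.ofConv (mul_assoc (WithConv.toConv f) (WithConv.toConv g) (WithConv.toConv l))

theorem cu_cv (f : H →ₗ[k] R) : cv (cu R) f = f :=
  congrArg WithConv.ofConv (one_mul (WithConv.toConv f))

theorem cv_cu (f : H →ₗ[k] R) : cv f (cu R) = f :=
  congrArg WithConv.ofConv (mul_one (WithConv.toConv f))

theorem comp_cv {R' : Type*} [Ring R'] [Algebra k R'] (φ : R →ₐ[k] R') (f g : H →ₗ[k] R) :
    φ.toLinearMap ∘ₗ cv f g = cv (φ.toLinearMap ∘ₗ f) (φ.toLinearMap ∘ₗ g) :=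
  LinearMap.algHom_comp_convMul_distrib φ (WithConv.toConv f) (WithConv.toConv g)

theorem comp_cu {R' : Type*} [Ring R'] [Algebra k R'] (φ : R →ₐ[k] R') :
    φ.toLinearMap ∘ₗ (cu R : H →ₗ[k] R) = cu R' := by
  ext h; simp [cu]

end

variable (k H) in
theorem antipode_cv_id : cv (HopfAlgebra.antipode k (A := H)) LinearMap.id = cu H :=
  congrArg WithConv.ofConv (LinearMap.antipode_mul_id (R := k) (C := H))

variable (k H) in
theorem id_cv_antipode : cv LinearMap.id (HopfAlgebra.antipode k (A := H)) = cu H :=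
  congrArg WithConv.ofConv (LinearMap.id_mul_antipode (R := k) (C := H))


variable (k H) in
/-- `h ↦ h ⊗ 1`. -/
abbrev incL : H →ₐ[k] H ⊗[k] H := Algebra.TensorProduct.includeLeft

variable (k H) in
/-- `h ↦ 1 ⊗ h`. -/
abbrev incR : H →ₐ[k] H ⊗[k] H := Algebra.TensorProduct.includeRight

/-- The antipode reverses the comultiplication: `Δ((HopfAlgebra.antipode k (A := H))(h)) = (HopfAlgebra.antipode k (A := H))(h₂) ⊗ (HopfAlgebra.antipode k (A := H))(h₁)`. -/
theorem comul_comp_antipode :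
    (comul : H →ₗ[k] H ⊗[k] H) ∘ₗ (HopfAlgebra.antipode k (A := H)) =
      cv ((incR k H).toLinearMap ∘ₗ (HopfAlgebra.antipode k (A := H))) ((incL k H).toLinearMap ∘ₗ (HopfAlgebra.antipode k (A := H))) := by
  have h0 : (comul : H →ₗ[k] H ⊗[k] H) = cv (incL k H).toLinearMap (incR k H).toLinearMap := by
    ext h
    rw [cv_apply, ← (ℛ k h).eq]
    simp
  have h1 : cv (comul : H →ₗ[k] H ⊗[k] H) (comul ∘ₗ (HopfAlgebra.antipode k (A := H))) = cu _ := by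
    have := comp_cv (H := H) (Bialgebra.comulAlgHom k H) LinearMap.id (HopfAlgebra.antipode k (A := H))
    rw [id_cv_antipode, comp_cu] at this
    exact this.symm
  have h2 : cv (cv ((incR k H).toLinearMap ∘ₗ (HopfAlgebra.antipode k (A := H))) ((incL k H).toLinearMap ∘ₗ (HopfAlgebra.antipode k (A := H)))) comul = cu _ := by
    have e1 : cv ((incL k H).toLinearMap ∘ₗ (HopfAlgebra.antipode k (A := H))) (incL k H).toLinearMap = cu _ := by
      have := comp_cv (H := H) (incL k H) (HopfAlgebra.antipode k (A := H)) LinearMap.id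
      rw [antipode_cv_id, comp_cu] at this
      exact this.symm
    have e2 : cv ((incR k H).toLinearMap ∘ₗ (HopfAlgebra.antipode k (A := H))) (incR k H).toLinearMap = cu _ := by
      have := comp_cv (H := H) (incR k H) (HopfAlgebra.antipode k (A := H)) LinearMap.id
      rw [antipode_cv_id, comp_cu] at this
      exact this.symm
    rw [h0, cv_assoc, ← cv_assoc ((incL k H).toLinearMap ∘ₗ (HopfAlgebra.antipode k (A := H))), e1, cu_cv, e2]
  rw [← cu_cv (comul ∘ₗ (HopfAlgebra.antipode k (A := H))), ← h2, cv_assoc, h1, cv_cu]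

theorem comul_antipode (h : H) :
    comul (R := k) ((HopfAlgebra.antipode k (A := H)) h) =
      TensorProduct.map (HopfAlgebra.antipode k (A := H)) (HopfAlgebra.antipode k (A := H)) (TensorProduct.comm k H H (comul (R := k) h)) := by
  have := LinearMap.congr_fun (comul_comp_antipode (k := k) (H := H)) h
  rw [cv_apply] at this
  rw [← (ℛ k h).eq]
  simpa using this

/-- A linear form viewed as a linear map to `H`. -/
def hat (φ : H →ₗ[k] k) : H →ₗ[k] H := Algebra.linearMap k H ∘ₗ φ

theorem hat_cv (φ ψ : H →ₗ[k] k) : hat (cv φ ψ) = cv (hat φ) (hat ψ) :=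
  comp_cv (Algebra.ofId k H) φ ψ

theorem hat_cv_apply (φ : H →ₗ[k] k) (f : H →ₗ[k] H) (h : H) :
    cv (hat φ) f h = ∑ i ∈ (ℛ k h).index, φ ((ℛ k h).left i) • f ((ℛ k h).right i) := by
  simp [cv_apply, hat, Algebra.smul_def]

theorem cv_hat_apply (φ : H →ₗ[k] k) (f : H →ₗ[k] H) (h : H) :
    cv f (hat φ) h = ∑ i ∈ (ℛ k h).index, φ ((ℛ k h).right i) • f ((ℛ k h).left i) := by
  simp [cv_apply, hat, Algebra.smul_def, Algebra.commutes]

theorem comp_hat_cv (L : H →ₗ[k] H) (φ : H →ₗ[k] k) (f : H →ₗ[k] H) :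
    L ∘ₗ cv (hat φ) f = cv (hat φ) (L ∘ₗ f) := by
  ext h; simp [hat_cv_apply]

theorem comp_cv_hat (L : H →ₗ[k] H) (φ : H →ₗ[k] k) (f : H →ₗ[k] H) :
    L ∘ₗ cv f (hat φ) = cv (L ∘ₗ f) (hat φ) := by
  ext h; simp [cv_hat_apply]

/-- `hitL φ h = φ(h₁) h₂`. -/
def hitL (φ : H →ₗ[k] k) : H →ₗ[k] H := cv (hat φ) LinearMap.id

/-- `hitR φ h = h₁ φ(h₂)`. -/
def hitR (φ : H →ₗ[k] k) : H →ₗ[k] H := cv LinearMap.id (hat φ)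

theorem hitL_comp_hitL (φ ψ : H →ₗ[k] k) : hitL ψ ∘ₗ hitL φ = hitL (cv φ ψ) := by
  rw [hitL, hitL, hitL, comp_hat_cv, hat_cv, cv_assoc]; rfl

theorem hitL_comp_hitR (φ ψ : H →ₗ[k] k) : hitL ψ ∘ₗ hitR φ = hitR φ ∘ₗ hitL ψ := by
  rw [hitL, hitR, comp_hat_cv, comp_cv_hat, LinearMap.comp_id, LinearMap.comp_id, cv_assoc]

theorem hitL_apply_comul (φ : H →ₗ[k] k) (h : H) :
    hitL φ h = TensorProduct.lid k H (φ.rTensor H (comul h)) := by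
  rw [hitL, hat_cv_apply, ← (ℛ k h).eq]; simp

theorem hitR_apply_comul (φ : H →ₗ[k] k) (h : H) :
    hitR φ h = TensorProduct.rid k H (φ.lTensor H (comul h)) := by
  rw [hitR, cv_hat_apply, ← (ℛ k h).eq]; simp

/-- `m x y = x (HopfAlgebra.antipode k (A := H))((HopfAlgebra.antipode k (A := H))(y))`. -/
def m (x : H) : H →ₗ[k] H := LinearMap.mulLeft k x ∘ₗ (HopfAlgebra.antipode k (A := H)) ∘ₗ (HopfAlgebra.antipode k (A := H))

/-- the linear form `φ(· (HopfAlgebra.antipode k (A := H))(v))` -/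
def shiftForm (φ : H →ₗ[k] k) (v : H) : H →ₗ[k] k := φ ∘ₗ LinearMap.mulRight k ((HopfAlgebra.antipode k (A := H)) v)

theorem comp_sum' {κ : Type*} (s : Finset κ) (g : H →ₗ[k] H) (f : κ → (H →ₗ[k] H)) :
    g ∘ₗ ∑ i ∈ s, f i = ∑ i ∈ s, g ∘ₗ f i := by
  ext; simp

theorem sum_comp' {κ : Type*} (s : Finset κ) (g : H →ₗ[k] H) (f : κ → (H →ₗ[k] H)) :
    (∑ i ∈ s, f i) ∘ₗ g = ∑ i ∈ s, f i ∘ₗ g := by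
  ext; simp

variable {ι : Type*} [Fintype ι] (b : Module.Basis ι k H)

theorem sum_coord_smul' {M : Type*} [AddCommGroup M] [Module k M] (f : H →ₗ[k] M) (y : H) :
    ∑ i, b.coord i y • f (b i) = f y := by
  conv_rhs => rw [← b.sum_repr y, map_sum]
  simp

/-- In the opposite convolution order, `Δ((HopfAlgebra.antipode k (A := H))²(y₂)) ((HopfAlgebra.antipode k (A := H))(y₁) ⊗ 1) = 1 ⊗ (HopfAlgebra.antipode k (A := H))²(y)`. -/
theorem comul_antipode_sq (y : H) :
    ∑ i ∈ (ℛ k y).index, comul (R := k) ((HopfAlgebra.antipode k (A := H)) ((HopfAlgebra.antipode k (A := H)) ((ℛ k y).right i))) *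
      ((HopfAlgebra.antipode k (A := H)) ((ℛ k y).left i) ⊗ₜ[k] (1 : H)) = (1 : H) ⊗ₜ[k] (HopfAlgebra.antipode k (A := H)) ((HopfAlgebra.antipode k (A := H)) y) := by
  have key : cv (HopfAlgebra.antipodeAlgHomOp k H).toLinearMap
      ((HopfAlgebra.antipodeAlgHomOp k H).toLinearMap ∘ₗ (HopfAlgebra.antipode k (A := H))) = cu _ := by
    have := comp_cv (H := H) (HopfAlgebra.antipodeAlgHomOp k H) LinearMap.id (HopfAlgebra.antipode k (A := H))
    rw [id_cv_antipode, comp_cu] at this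
    exact this.symm
  let o : (H ⊗[k] H) →ₗ[k] (H ⊗[k] H)ᵐᵒᵖ := (MulOpposite.opLinearEquiv k).toLinearMap
  let j₁ : Hᵐᵒᵖ →ₐ[k] (H ⊗[k] H)ᵐᵒᵖ := AlgHom.op (incL k H)
  have k1 : cv (o ∘ₗ (incL k H).toLinearMap ∘ₗ (HopfAlgebra.antipode k (A := H))) (o ∘ₗ (incL k H).toLinearMap ∘ₗ (HopfAlgebra.antipode k (A := H)) ∘ₗ (HopfAlgebra.antipode k (A := H))) = cu _ := by
    have := comp_cv (H := H) j₁ (HopfAlgebra.antipodeAlgHomOp k H).toLinearMap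
      ((HopfAlgebra.antipodeAlgHomOp k H).toLinearMap ∘ₗ (HopfAlgebra.antipode k (A := H)))
    rw [key, comp_cu] at this
    exact this.symm
  have k2 : o ∘ₗ comul ∘ₗ (HopfAlgebra.antipode k (A := H)) ∘ₗ (HopfAlgebra.antipode k (A := H)) =
      cv (o ∘ₗ (incL k H).toLinearMap ∘ₗ (HopfAlgebra.antipode k (A := H)) ∘ₗ (HopfAlgebra.antipode k (A := H))) (o ∘ₗ (incR k H).toLinearMap ∘ₗ (HopfAlgebra.antipode k (A := H)) ∘ₗ (HopfAlgebra.antipode k (A := H))) := by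
    ext z
    simp only [LinearMap.comp_apply, cv_apply, comul_antipode]
    rw [← (ℛ k z).eq]
    simp [o, ← MulOpposite.op_mul]
  have k3 : cv (o ∘ₗ (incL k H).toLinearMap ∘ₗ (HopfAlgebra.antipode k (A := H))) (o ∘ₗ comul ∘ₗ (HopfAlgebra.antipode k (A := H)) ∘ₗ (HopfAlgebra.antipode k (A := H))) =
      o ∘ₗ (incR k H).toLinearMap ∘ₗ (HopfAlgebra.antipode k (A := H)) ∘ₗ (HopfAlgebra.antipode k (A := H)) := by
    rw [k2, ← cv_assoc, k1, cu_cv]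
  have := LinearMap.congr_fun k3 y
  rw [cv_apply] at this
  have := congrArg MulOpposite.unop this
  simpa [o] using this

theorem sum_hitL_m_hitL (φ : H →ₗ[k] k) (x : H) :
    ∑ i, hitL (shiftForm φ (b i)) ∘ₗ m x ∘ₗ hitL (b.coord i) = m (hitL φ x) := by
  ext y
  have e1 : ∀ (v z : H), hitL (shiftForm φ v) z =
      TensorProduct.lid k H (φ.rTensor H (comul (R := k) z * ((HopfAlgebra.antipode k (A := H)) v ⊗ₜ[k] (1 : H)))) := by
    intro v z
    rw [hitL_apply_comul, ← (ℛ k z).eq]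
    simp [shiftForm, Finset.sum_mul]
  have e2 : ∀ (t : H ⊗[k] H) (v : H),
      TensorProduct.lid k H (φ.rTensor H (t * ((1 : H) ⊗ₜ[k] v))) =
        TensorProduct.lid k H (φ.rTensor H t) * v := by
    intro t v
    induction t with
    | zero => simp
    | tmul a c => simp
    | add a c ha hc => simp [add_mul, ha, hc]
  have e3 : ∀ i, (hitL (shiftForm φ (b i)) ∘ₗ m x ∘ₗ hitL (b.coord i)) y =
      ∑ j ∈ (ℛ k y).index, b.coord i ((ℛ k y).left j) •
        ((TensorProduct.lid k H).toLinearMap ∘ₗ φ.rTensor H ∘ₗ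
          LinearMap.mulLeft k (comul (R := k) (m (k := k) x ((ℛ k y).right j))) ∘ₗ
          (incL k H).toLinearMap ∘ₗ (HopfAlgebra.antipode k (A := H))) (b i) := by
    intro i
    rw [LinearMap.comp_apply, e1, LinearMap.comp_apply, hitL, hat_cv_apply]
    simp [Finset.sum_mul]
  rw [LinearMap.sum_apply, Finset.sum_congr rfl fun i _ => e3 i, Finset.sum_comm,
    Finset.sum_congr rfl fun j _ => sum_coord_smul' b _ _]
  have e4 : m (k := k) (hitL φ x) y = TensorProduct.lid k H (φ.rTensor H
      (comul (R := k) x * ((1 : H) ⊗ₜ[k] (HopfAlgebra.antipode k (A := H)) ((HopfAlgebra.antipode k (A := H)) y)))) := by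
    rw [e2, ← hitL_apply_comul]; rfl
  rw [e4, ← comul_antipode_sq, Finset.mul_sum, map_sum, map_sum]
  simp [m]

theorem sum_hitL {κ : Type*} (s : Finset κ) (φ : κ → (H →ₗ[k] k)) : ∑ i ∈ s, hitL (φ i) = hitL (∑ i ∈ s, φ i) := by
  ext z
  simp [hitL, hat_cv_apply, LinearMap.sum_apply, Finset.sum_smul]
  exact Finset.sum_comm

theorem hitL_smul_counit (c : k) : hitL (c • (counit : H →ₗ[k] k)) = c • LinearMap.id := by
  have h5 : hitL (counit : H →ₗ[k] k) = LinearMap.id := cu_cv _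
  rw [← h5]; ext z; simp [hitL_apply_comul]

theorem sum_hitL_hitR_hitL (φ g : H →ₗ[k] k) :
    ∑ i, hitL (b.coord i) ∘ₗ hitR g ∘ₗ hitL (shiftForm φ (b i)) = φ 1 • hitR g := by
  have h1 : ∀ i, hitL (b.coord i) ∘ₗ hitR g ∘ₗ hitL (shiftForm φ (b i)) =
      hitR g ∘ₗ hitL (cv (shiftForm φ (b i)) (b.coord i)) := by
    intro i
    rw [← LinearMap.comp_assoc, hitL_comp_hitR, LinearMap.comp_assoc, hitL_comp_hitL]
  have h2 : ∑ i, cv (shiftForm φ (b i)) (b.coord i) = φ 1 • (counit : H →ₗ[k] k) := by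
    ext z
    rw [LinearMap.sum_apply]
    have : ∀ i, cv (shiftForm φ (b i)) (b.coord i) z =
        ∑ j ∈ (ℛ k z).index, b.coord i ((ℛ k z).right j) •
          (φ ∘ₗ LinearMap.mulLeft k ((ℛ k z).left j) ∘ₗ (HopfAlgebra.antipode k (A := H))) (b i) := by
      intro i
      rw [cv_apply]
      simp [shiftForm, mul_comm]
    rw [Finset.sum_congr rfl fun i _ => this i, Finset.sum_comm,
      Finset.sum_congr rfl fun j _ => sum_coord_smul' b _ _]
    have h3 := congrArg φ (LinearMap.congr_fun (id_cv_antipode k H) z)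
    rw [cv_apply, map_sum] at h3
    simpa [cu, Algebra.algebraMap_eq_smul_one, mul_comm] using h3
  rw [Finset.sum_congr rfl fun i _ => h1 i, ← comp_sum', sum_hitL, h2, hitL_smul_counit]
  ext z
  simp

theorem exists_form_ne_zero [FiniteDimensional k H] [Nontrivial H] :
    ∃ l : H →ₗ[k] k, l ≠ 0 ∧ ∀ φ x, l (hitL φ x) = φ 1 * l x := by
  let b := Module.finBasis k H
  let P : (H →ₗ[k] k) → H →ₗ[k] k := fun g =>
    { toFun := fun x => LinearMap.trace k H (hitR g ∘ₗ m x)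
      map_add' := fun x y => by
        rw [← map_add, ← LinearMap.comp_add]; congr 2; ext; simp [m, add_mul]
      map_smul' := fun c x => by
        rw [RingHom.id_apply, ← map_smul, ← LinearMap.comp_smul]; congr 2; ext; simp [m] }
  have hP : ∀ g φ x, P g (hitL φ x) = φ 1 * P g x := by
    intro g φ x
    change LinearMap.trace k H (hitR g ∘ₗ m (hitL φ x)) = φ 1 * LinearMap.trace k H (hitR g ∘ₗ m x)
    rw [← sum_hitL_m_hitL b, ← smul_eq_mul, ← map_smul, ← LinearMap.smul_comp, ← sum_hitL_hitR_hitL b,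
      comp_sum', sum_comp', map_sum, map_sum]
    refine Finset.sum_congr rfl fun i _ => ?_
    rw [← LinearMap.comp_assoc, ← LinearMap.comp_assoc, LinearMap.trace_comp_comm']
    simp only [LinearMap.comp_assoc]
  by_contra! hc
  have h0 : ∀ g x, LinearMap.trace k H (hitR g ∘ₗ m x) = 0 := by
    intro g x
    by_contra hne
    obtain ⟨φ, y, h⟩ := hc (P g) (fun h => hne (by
      have := LinearMap.congr_fun h x
      exact this))
    exact h (hP g φ y)
  have h1 : ∑ i, m (k := k) ((HopfAlgebra.antipode k (A := H)) (b i)) ∘ₗ hitR (b.coord i) =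
      (counit : H →ₗ[k] k).smulRight (1 : H) := by
    ext w
    have : ∀ i, (m (k := k) ((HopfAlgebra.antipode k (A := H)) (b i)) ∘ₗ hitR (b.coord i)) w =
        ∑ j ∈ (ℛ k w).index, b.coord i ((ℛ k w).right j) •
          (LinearMap.mulRight k ((HopfAlgebra.antipode k (A := H)) ((HopfAlgebra.antipode k (A := H)) ((ℛ k w).left j))) ∘ₗ (HopfAlgebra.antipode k (A := H))) (b i) := by
      intro i
      rw [LinearMap.comp_apply, hitR, cv_hat_apply]
      simp [m]
    rw [LinearMap.sum_apply, Finset.sum_congr rfl fun i _ => this i, Finset.sum_comm,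
      Finset.sum_congr rfl fun j _ => sum_coord_smul' b _ _]
    have h3 := congrArg (HopfAlgebra.antipode k (A := H)) (LinearMap.congr_fun (antipode_cv_id k H) w)
    rw [cv_apply, map_sum] at h3
    simpa [cu, Algebra.algebraMap_eq_smul_one, HopfAlgebra.antipode_mul_antidistrib] using h3
  have h2 : LinearMap.trace k H (∑ i, m (k := k) ((HopfAlgebra.antipode k (A := H)) (b i)) ∘ₗ hitR (b.coord i)) = 0 := by
    rw [map_sum]
    exact Finset.sum_eq_zero fun i _ => by rw [LinearMap.trace_comp_comm']; exact h0 _ _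
  rw [h1, LinearMap.trace_smulRight, Bialgebra.counit_one] at h2
  exact one_ne_zero h2

variable (k H) in
theorem antipode_injective [FiniteDimensional k H] : Function.Injective (HopfAlgebra.antipode k (A := H)) := by
  rw [injective_iff_map_eq_zero]
  intro h hh
  nontriviality H
  obtain ⟨l, hl0, hl⟩ := exists_form_ne_zero (k := k) (H := H)
  let b := Module.finBasis k H
  have hhitR : ∀ x, hitR l x = l x • (1 : H) := by
    intro x
    refine (Module.forall_dual_apply_eq_zero_iff k _).1 ?_ |> sub_eq_zero.1
    intro φ
    have h1 : l (hitL φ x) = φ (hitR l x) := by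
      rw [hitL, hitR, hat_cv_apply, cv_hat_apply]; simp [mul_comm]
    rw [map_sub, ← h1, hl, map_smul, smul_eq_mul, mul_comm, sub_self]
  let A : H → H →ₗ[k] k := fun x => l ∘ₗ LinearMap.mulLeft k x ∘ₗ (HopfAlgebra.antipode k (A := H))
  have hA : ∀ x, hitL (A x) h = 0 := by
    intro x
    let q : H ⊗[k] H →ₗ[k] H := (TensorProduct.rid k H).toLinearMap ∘ₗ l.lTensor H
    have q1 : ∀ (t : H ⊗[k] H) (v : H), q (t * (v ⊗ₜ[k] (1 : H))) = q t * v := by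
      intro t v
      induction t with
      | zero => simp
      | tmul a c => simp [q]
      | add a c ha hc => rw [add_mul, map_add, ha, hc, map_add, add_mul]
    have q2 : ∀ z, q (comul (R := k) z) = l z • (1 : H) := by
      intro z; rw [← hhitR, hitR_apply_comul]; rfl
    have q3 : cv ((comul : H →ₗ[k] H ⊗[k] H) ∘ₗ (HopfAlgebra.antipode k (A := H))) (incL k H).toLinearMap =
        (incR k H).toLinearMap ∘ₗ (HopfAlgebra.antipode k (A := H)) := by
      have := comp_cv (H := H) (incL k H) (HopfAlgebra.antipode k (A := H)) LinearMap.id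
      rw [antipode_cv_id, comp_cu] at this
      rw [comul_comp_antipode, cv_assoc]
      erw [← this]
      rw [cv_cu]
    have q4 := LinearMap.congr_fun q3 h
    rw [cv_apply] at q4
    have q5 : hitL (A x) h = q (comul (R := k) x * (∑ i ∈ (ℛ k h).index,
        comul (R := k) ((HopfAlgebra.antipode k (A := H)) ((ℛ k h).left i)) * ((ℛ k h).right i ⊗ₜ[k] (1 : H)))) := by
      rw [Finset.mul_sum, map_sum, hitL, hat_cv_apply]
      refine Finset.sum_congr rfl fun i _ => ?_
      rw [← mul_assoc, q1, ← Bialgebra.comul_mul, q2]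
      simp [A]
    rw [q5]
    refine (congrArg (fun t => q (comul (R := k) x * t)) q4).trans ?_
    simp [hh]
  obtain ⟨x, hx⟩ : ∃ x, l x ≠ 0 := by
    by_contra! hc
    exact hl0 (LinearMap.ext hc)
  have h7 : ∑ i, cv (A (x * (HopfAlgebra.antipode k (A := H)) ((HopfAlgebra.antipode k (A := H)) (b i)))) (b.coord i) = l x • (counit : H →ₗ[k] k) := by
    ext z
    have : ∀ i, cv (A (x * (HopfAlgebra.antipode k (A := H)) ((HopfAlgebra.antipode k (A := H)) (b i)))) (b.coord i) z =
        ∑ j ∈ (ℛ k z).index, b.coord i ((ℛ k z).right j) •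
          (l ∘ₗ LinearMap.mulLeft k x ∘ₗ
            LinearMap.mulRight k ((HopfAlgebra.antipode k (A := H)) ((ℛ k z).left j)) ∘ₗ (HopfAlgebra.antipode k (A := H)) ∘ₗ (HopfAlgebra.antipode k (A := H))) (b i) := by
      intro i
      rw [cv_apply]
      simp [A, mul_comm]
    rw [LinearMap.sum_apply, Finset.sum_congr rfl fun i _ => this i, Finset.sum_comm,
      Finset.sum_congr rfl fun j _ => sum_coord_smul' b _ _]
    have h3 := congrArg (fun t => l (x * (HopfAlgebra.antipode k (A := H)) t)) (LinearMap.congr_fun (id_cv_antipode k H) z)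
    rw [cv_apply] at h3
    simpa [cu, Algebra.algebraMap_eq_smul_one, HopfAlgebra.antipode_mul_antidistrib,
      Finset.mul_sum, mul_comm] using h3
  have h8 : ∑ i, hitL (cv (A (x * (HopfAlgebra.antipode k (A := H)) ((HopfAlgebra.antipode k (A := H)) (b i)))) (b.coord i)) h = 0 := by
    refine Finset.sum_eq_zero fun i _ => ?_
    rw [← hitL_comp_hitL, LinearMap.comp_apply, hA, map_zero]
  have h9 : l x • h = 0 := by
    rw [← h8, ← LinearMap.sum_apply, sum_hitL, h7, hitL_smul_counit]; rfl
  exact (smul_eq_zero.1 h9).resolve_left hx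

variable (k H) in
theorem antipode_bijective [FiniteDimensional k H] : Function.Bijective (HopfAlgebra.antipode k (A := H)) :=
  ⟨antipode_injective k H, LinearMap.surjective_of_injective (antipode_injective k H)⟩

variable (k H) in
/-- The inverse `S⁻¹` of the antipode of a finite dimensional Hopf algebra. -/
def antipodeInv [FiniteDimensional k H] : H →ₗ[k] H :=
  (LinearEquiv.ofBijective (HopfAlgebra.antipode k (A := H)) (antipode_bijective k H)).symm.toLinearMap

section Inverse

variable [FiniteDimensional k H]

@[simp]
theorem antipode_antipodeInv (h : H) : (HopfAlgebra.antipode k (A := H)) (antipodeInv k H h) = h :=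
  (LinearEquiv.ofBijective (HopfAlgebra.antipode k (A := H)) (antipode_bijective k H)).apply_symm_apply h

@[simp]
theorem antipodeInv_antipode (h : H) : antipodeInv k H ((HopfAlgebra.antipode k (A := H)) h) = h :=
  (LinearEquiv.ofBijective (HopfAlgebra.antipode k (A := H)) (antipode_bijective k H)).symm_apply_apply h

variable (k H) in
/-- `S⁻¹` as an algebra homomorphism to the opposite algebra. -/
def antipodeInvOp : H →ₐ[k] Hᵐᵒᵖ :=
  AlgHom.ofLinearMap ((MulOpposite.opLinearEquiv k).toLinearMap ∘ₗ antipodeInv k H)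
    (by
      apply MulOpposite.unop_injective
      apply (antipode_bijective k H).1
      simp)
    (fun x y => by
      apply MulOpposite.unop_injective
      apply (antipode_bijective k H).1
      simp [HopfAlgebra.antipode_mul_antidistrib])

@[simp]
theorem antipodeInvOp_apply (h : H) :
    antipodeInvOp k H h = MulOpposite.op (antipodeInv k H h) := rfl

/-- `h₂ S⁻¹(h₁) = ε(h)`. -/
theorem sum_mul_antipodeInv (h : H) :
    ∑ i ∈ (ℛ k h).index, (ℛ k h).right i * antipodeInv k H ((ℛ k h).left i) =
      algebraMap k H (counit h) := by
  apply (antipode_bijective k H).1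
  have := LinearMap.congr_fun (id_cv_antipode k H) h
  rw [cv_apply] at this
  simpa [cu, HopfAlgebra.antipode_mul_antidistrib, Algebra.algebraMap_eq_smul_one] using this

/-- `S⁻¹(h₂) h₁ = ε(h)`. -/
theorem sum_antipodeInv_mul (h : H) :
    ∑ i ∈ (ℛ k h).index, antipodeInv k H ((ℛ k h).right i) * (ℛ k h).left i =
      algebraMap k H (counit h) := by
  apply (antipode_bijective k H).1
  have := LinearMap.congr_fun (antipode_cv_id k H) h
  rw [cv_apply] at this
  simpa [cu, HopfAlgebra.antipode_mul_antidistrib, Algebra.algebraMap_eq_smul_one] using this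

end Inverse

end Antipode

/-! ### Module algebras and smash products -/

/-- `A` is a left `H`-module algebra: `A` is an `H`-module (compatibly with the scalars) and
`h(ab) = (h₁a)(h₂b)`, `h1 = ε(h)1`. -/
class IsModuleAlgebra (k H A : Type*) [Field k] [Ring H] [HopfAlgebra k H] [Ring A] [Algebra k A]
    [Module H A] : Prop extends IsScalarTower k H A where
  smul_mul : ∀ (h : H) (a b : A), h • (a * b) =
    ∑ i ∈ (ℛ k h).index, ((ℛ k h).left i • a) * ((ℛ k h).right i • b)
  smul_one : ∀ h : H, h • (1 : A) = algebraMap k A (counit h)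

section DiagonalAction

variable (k H : Type*) [Field k] [Ring H] [HopfAlgebra k H]
variable (V W : Type*) [AddCommGroup V] [Module k V] [Module H V] [IsScalarTower k H V]
  [AddCommGroup W] [Module k W] [Module H W] [IsScalarTower k H W]

/-- The diagonal action of `H` on `V ⊗ W`, `h(v ⊗ w) = h₁v ⊗ h₂w`. -/
def diagAct : H →ₐ[k] Module.End k (V ⊗[k] W) :=
  (Module.endTensorEndAlgHom (R := k) (S := k) (A := k) (M := V) (N := W)).comp
    ((Algebra.TensorProduct.map (Algebra.lsmul k k V) (Algebra.lsmul k k W)).comp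
      (Bialgebra.comulAlgHom k H))

theorem diagAct_tmul (h : H) (v : V) (w : W) :
    diagAct k H V W h (v ⊗ₜ[k] w) =
      ∑ i ∈ (ℛ k h).index, ((ℛ k h).left i • v) ⊗ₜ[k] ((ℛ k h).right i • w) := by
  simp only [diagAct, AlgHom.comp_apply, Bialgebra.comulAlgHom_apply]
  rw [← (ℛ k h).eq]
  simp [Module.endTensorEndAlgHom_apply]

end DiagonalAction

section Actions

variable {k A H W : Type*} [Field k] [Ring H] [HopfAlgebra k H] [Ring A] [Algebra k A]
  [AddCommGroup W] [Module k W]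

theorem cv_mul_of_comm {R : Type*} [Ring R] [Algebra k R] {X Y Z : H →ₗ[k] R} {r : R}
    (h₁ : ∀ h, Y h * r = cv X Y h) (h₂ : ∀ h, Z h * r = r * Z h) (h : H) :
    cv Y Z h * r = cv X (cv Y Z) h := by
  have h3 : LinearMap.mulRight k r ∘ₗ Y = cv X Y := LinearMap.ext h₁
  rw [← cv_assoc, ← h3]
  simp [cv_apply, mul_assoc, Finset.sum_mul, h₂]

/-- A pair of actions `al` of `A` and `be` of `H` on a vector space, as the linear map
`a ⊗ h ↦ al(a) ∘ be(h)`. -/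
def pairAct (al : A →ₐ[k] Module.End k W) (be : H →ₐ[k] Module.End k W) :
    A ⊗[k] H →ₗ[k] Module.End k W :=
  TensorProduct.lift ((LinearMap.mul k (Module.End k W)).compl₁₂ al.toLinearMap be.toLinearMap)

@[simp]
theorem pairAct_tmul (al : A →ₐ[k] Module.End k W) (be : H →ₐ[k] Module.End k W) (a : A) (h : H) :
    pairAct al be (a ⊗ₜ[k] h) = al a * be h := by
  simp [pairAct]

/-- The compatibility `h(aw) = (h₁a)(h₂w)` of an action of `A` and an action of `H`. -/
def ActsCompatibly [Module H A] (al : A →ₐ[k] Module.End k W) (be : H →ₐ[k] Module.End k W) : Prop :=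
  ∀ (h : H) (a : A), be h * al a =
    ∑ i ∈ (ℛ k h).index, al ((ℛ k h).left i • a) * be ((ℛ k h).right i)

variable (k A W) in
/-- Left multiplication of `A` on `A ⊗ W`, `a(b ⊗ w) = ab ⊗ w`. -/
def leftAct : A →ₐ[k] Module.End k (A ⊗[k] W) :=
  Algebra.lsmul k k (A ⊗[k] W)

theorem leftAct_tmul (a b : A) (w : W) : leftAct k A W a (b ⊗ₜ[k] w) = (a * b) ⊗ₜ[k] w := rfl

variable (k A H W) in
theorem actsCompatibly_tensor [Module H A] [IsModuleAlgebra k H A] [Module H W]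
    [IsScalarTower k H W] : ActsCompatibly (leftAct k A W) (diagAct k H A W) := by
  intro h a
  let X : H →ₗ[k] Module.End k (A ⊗[k] W) :=
    (leftAct k A W).toLinearMap ∘ₗ (LinearMap.toSpanSingleton H A a).restrictScalars k
  let Y : H →ₗ[k] Module.End k (A ⊗[k] W) :=
    (TensorProduct.mapBilinear (RingHom.id k) A W A W).flip LinearMap.id ∘ₗ
      (Algebra.lsmul k k A).toLinearMap
  let Z : H →ₗ[k] Module.End k (A ⊗[k] W) :=
    (TensorProduct.mapBilinear (RingHom.id k) A W A W) LinearMap.id ∘ₗ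
      (Algebra.lsmul k k W).toLinearMap
  have hYZ : ∀ h, cv Y Z h = diagAct k H A W h := by
    intro h
    ext b w
    simp [cv_apply, diagAct_tmul, Y, Z]
  have hXY : ∀ h, Y h * leftAct k A W a = cv X Y h := by
    intro h
    ext b w
    simp [cv_apply, Y, X, leftAct_tmul, IsModuleAlgebra.smul_mul (k := k), TensorProduct.sum_tmul]
  have hZ : ∀ h, Z h * leftAct k A W a = leftAct k A W a * Z h := by
    intro h
    ext b w
    simp [Z, leftAct_tmul]
  have key := cv_mul_of_comm (R := Module.End k (A ⊗[k] W)) (X := X) (Y := Y) (Z := Z)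
    (r := leftAct k A W a) hXY hZ h
  rw [hYZ, cv_apply] at key
  simp only [hYZ] at key
  exact key

end Actions

section Smash

variable (k A H : Type*) [Field k] [Ring H] [HopfAlgebra k H] [Ring A] [Algebra k A]

/-- The smash product `A # H`: the vector space `A ⊗ H` with the multiplication
`(a ⊗ h)(b ⊗ l) = a(h₁b) ⊗ h₂l`. -/
def Smash : Type _ := A ⊗[k] H

namespace Smash

instance : AddCommGroup (Smash k A H) := inferInstanceAs (AddCommGroup (A ⊗[k] H))
instance : Module k (Smash k A H) := inferInstanceAs (Module k (A ⊗[k] H))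

/-- The identity map, from `A # H` to the underlying vector space `A ⊗ H`. -/
def equiv : Smash k A H ≃ₗ[k] A ⊗[k] H := LinearEquiv.refl k (A ⊗[k] H)

variable {A H} in
/-- The element `a ⊗ h` of `A # H`. -/
def tmul (a : A) (h : H) : Smash k A H := (equiv k A H).symm (a ⊗ₜ[k] h)

@[simp]
theorem equiv_tmul (a : A) (h : H) : equiv k A H (tmul k a h) = a ⊗ₜ[k] h := rfl

variable {k A H}

@[elab_as_elim]
theorem induction_on {p : Smash k A H → Prop} (x : Smash k A H) (zero : p 0)
    (tmul : ∀ a h, p (tmul k a h)) (add : ∀ x y, p x → p y → p (x + y)) : p x :=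
  TensorProduct.induction_on (motive := p) x zero tmul add

variable [Module H A] [IsModuleAlgebra k H A]

instance : Mul (Smash k A H) :=
  ⟨fun x y => (equiv k A H).symm
    (pairAct (leftAct k A H) (diagAct k H A H) (equiv k A H x) (equiv k A H y))⟩

instance : One (Smash k A H) := ⟨tmul k 1 1⟩

theorem equiv_mul (x y : Smash k A H) : equiv k A H (x * y) =
    pairAct (leftAct k A H) (diagAct k H A H) (equiv k A H x) (equiv k A H y) := rfl

theorem one_def : (1 : Smash k A H) = tmul k 1 1 := rfl

theorem tmul_mul_tmul (a b : A) (h l : H) :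
    tmul k a h * tmul k b l =
      ∑ i ∈ (ℛ k h).index, tmul k (a * ((ℛ k h).left i • b)) ((ℛ k h).right i * l) := by
  apply (equiv k A H).injective
  rw [equiv_mul, equiv_tmul, equiv_tmul, pairAct_tmul, Module.End.mul_apply, diagAct_tmul,
    map_sum, map_sum]
  rfl

protected theorem add_mul' (x y z : Smash k A H) : (x + y) * z = x * z + y * z := by
  apply (equiv k A H).injective
  simp only [equiv_mul, map_add, LinearMap.add_apply]

protected theorem mul_add' (x y z : Smash k A H) : x * (y + z) = x * y + x * z := by
  apply (equiv k A H).injective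
  simp only [equiv_mul, map_add]

protected theorem zero_mul' (x : Smash k A H) : 0 * x = 0 := by
  apply (equiv k A H).injective
  simp only [equiv_mul, map_zero, LinearMap.zero_apply]

protected theorem mul_zero' (x : Smash k A H) : x * 0 = 0 := by
  apply (equiv k A H).injective
  simp only [equiv_mul, map_zero]

theorem pairAct_mul {W : Type*} [AddCommGroup W] [Module k W] {al : A →ₐ[k] Module.End k W}
    {be : H →ₐ[k] Module.End k W} (hc : ActsCompatibly al be) (x y : Smash k A H) :
    pairAct al be (equiv k A H (x * y)) =
      pairAct al be (equiv k A H x) * pairAct al be (equiv k A H y) := by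
  induction x using induction_on with
  | zero => simp only [Smash.zero_mul', map_zero, zero_mul]
  | add x₁ x₂ h₁ h₂ => simp only [Smash.add_mul', map_add, add_mul, h₁, h₂]
  | tmul a h =>
    induction y using induction_on with
    | zero => simp only [Smash.mul_zero', map_zero, mul_zero]
    | add x₁ x₂ h₁ h₂ => simp only [Smash.mul_add', map_add, mul_add, h₁, h₂]
    | tmul b l =>
      have := congrArg (fun t => al a * t * be l) (hc h b)
      simp only [Finset.mul_sum, Finset.sum_mul] at this
      simp only [tmul_mul_tmul, map_sum, equiv_tmul, pairAct_tmul, map_mul]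
      simpa [mul_assoc] using this.symm

protected theorem one_mul' (x : Smash k A H) : 1 * x = x := by
  apply (equiv k A H).injective
  rw [equiv_mul, one_def, equiv_tmul, pairAct_tmul, map_one, map_one]
  rfl

protected theorem mul_one' (x : Smash k A H) : x * 1 = x := by
  induction x using induction_on with
  | zero => exact Smash.zero_mul' _
  | add x₁ x₂ h₁ h₂ => rw [Smash.add_mul', h₁, h₂]
  | tmul a h =>
    apply (equiv k A H).injective
    rw [one_def, tmul_mul_tmul, map_sum, equiv_tmul]
    have h1 : ∀ i, equiv k A H (tmul k (a * ((ℛ k h).left i • (1 : A))) ((ℛ k h).right i * 1)) =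
        a ⊗ₜ[k] (counit (R := k) ((ℛ k h).left i) • (ℛ k h).right i) := by
      intro i
      rw [equiv_tmul, IsModuleAlgebra.smul_one (k := k), mul_one, Algebra.algebraMap_eq_smul_one,
        mul_smul_comm, mul_one, TensorProduct.smul_tmul]
    rw [Finset.sum_congr rfl fun i _ => h1 i, ← TensorProduct.tmul_sum,
      Coalgebra.sum_counit_smul]

instance : Ring (Smash k A H) :=
  { (inferInstance : AddCommGroup (Smash k A H)), (inferInstance : Mul (Smash k A H)),
    (inferInstance : One (Smash k A H)) with
    left_distrib := Smash.mul_add'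
    right_distrib := Smash.add_mul'
    zero_mul := Smash.zero_mul'
    mul_zero := Smash.mul_zero'
    one_mul := Smash.one_mul'
    mul_one := Smash.mul_one'
    mul_assoc := fun x y z => by
      apply (equiv k A H).injective
      rw [equiv_mul, pairAct_mul (actsCompatibly_tensor k A H H), Module.End.mul_apply,
        ← equiv_mul, ← equiv_mul] }

instance : Algebra k (Smash k A H) :=
  Algebra.ofModule
    (fun c x y => by
      apply (equiv k A H).injective
      simp only [equiv_mul, map_smul, LinearMap.smul_apply])
    (fun c x y => by
      apply (equiv k A H).injective
      simp only [equiv_mul, map_smul])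

variable (k A H) in
/-- The inclusion `a ↦ a ⊗ 1` of `A` into `A # H`. -/
def inclA : A →ₐ[k] Smash k A H :=
  AlgHom.ofLinearMap ((equiv k A H).symm.toLinearMap ∘ₗ (TensorProduct.mk k A H).flip 1) rfl
    (fun a b => by
      apply (equiv k A H).injective
      rw [equiv_mul]
      simp [leftAct_tmul])

variable (k A H) in
/-- The inclusion `h ↦ 1 ⊗ h` of `H` into `A # H`. -/
def inclH : H →ₐ[k] Smash k A H :=
  AlgHom.ofLinearMap ((equiv k A H).symm.toLinearMap ∘ₗ TensorProduct.mk k A H 1) rfl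
    (fun h l => by
      apply (equiv k A H).injective
      rw [equiv_mul]
      simp [diagAct_tmul, IsModuleAlgebra.smul_one (k := k), Algebra.algebraMap_eq_smul_one,
        TensorProduct.smul_tmul]
      conv_lhs => rw [← Coalgebra.sum_counit_smul (ℛ k h)]
      simp [Finset.sum_mul, TensorProduct.tmul_sum])

theorem inclA_apply (a : A) : inclA k A H a = tmul k a 1 := rfl

theorem inclH_apply (h : H) : inclH k A H h = tmul k 1 h := rfl

/-- The relation `h a = (h₁a) h₂` in `A # H`. -/
theorem inclH_mul_inclA (h : H) (a : A) : inclH k A H h * inclA k A H a =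
    ∑ i ∈ (ℛ k h).index, inclA k A H ((ℛ k h).left i • a) * inclH k A H ((ℛ k h).right i) := by
  have : ∀ (a : A) (h : H), inclA k A H a * inclH k A H h = tmul k a h := by
    intro a h
    apply (equiv k A H).injective
    rw [equiv_mul, inclA_apply, inclH_apply]
    simp [leftAct_tmul]
  simp only [this]
  rw [inclA_apply, inclH_apply, tmul_mul_tmul]
  simp

/-- Compatible actions of `A` and `H` on a vector space define an action of `A # H`. -/
def lift {W : Type*} [AddCommGroup W] [Module k W] (al : A →ₐ[k] Module.End k W)
    (be : H →ₐ[k] Module.End k W) (hc : ActsCompatibly al be) :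
    Smash k A H →ₐ[k] Module.End k W :=
  AlgHom.ofLinearMap (pairAct al be ∘ₗ (equiv k A H).toLinearMap)
    (by
      rw [one_def]
      simp)
    (pairAct_mul hc)

end Smash

end Smash

/-! ### Hopfological modules -/

section Modules

variable {k A H : Type u} [Field k] [Ring H] [HopfAlgebra k H] [Ring A] [Algebra k A]
  [Module H A] [IsModuleAlgebra k H A]

attribute [local instance] ModuleCat.moduleOfAlgebraModule
  ModuleCat.isScalarTower_of_algebra_moduleCat

variable (k A H) in
/-- Restriction of modules from `A # H` to `A`. -/
abbrev resA : ModuleCat.{u} (Smash k A H) ⥤ ModuleCat.{u} A :=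
  ModuleCat.restrictScalars (Smash.inclA k A H).toRingHom

variable (k A H) in
/-- Restriction of modules from `A # H` to `H`. -/
abbrev resH : ModuleCat.{u} (Smash k A H) ⥤ ModuleCat.{u} H :=
  ModuleCat.restrictScalars (Smash.inclH k A H).toRingHom

/-- The space `Hom_A(M, N)` of `A`-linear maps between two `A # H`-modules. -/
def HomA (M N : ModuleCat.{u} (Smash k A H)) : Type u :=
  (resA k A H).obj M →ₗ[A] (resA k A H).obj N

namespace HomA

variable {M N : ModuleCat.{u} (Smash k A H)}

instance : AddCommGroup (HomA M N) :=
  inferInstanceAs (AddCommGroup ((resA k A H).obj M →ₗ[A] (resA k A H).obj N))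

instance : FunLike (HomA M N) M N where
  coe f := fun x => (show (resA k A H).obj M →ₗ[A] (resA k A H).obj N from f) x
  coe_injective _ _ h := LinearMap.ext (congrFun h)

@[ext]
theorem ext {f g : HomA M N} (h : ∀ x, f x = g x) : f = g := DFunLike.ext f g h

instance : AddMonoidHomClass (HomA M N) M N where
  map_add f x y := LinearMap.map_add f x y
  map_zero f := LinearMap.map_zero f

@[simp]
theorem add_apply (f g : HomA M N) (x : M) : (f + g) x = f x + g x := rfl

theorem map_inclA_smul (f : HomA M N) (a : A) (x : M) :
    f (Smash.inclA k A H a • x) = Smash.inclA k A H a • f x :=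
  LinearMap.map_smul f a x

/-- An `A`-linear map between `A # H`-modules is `k`-linear. -/
def toLin : HomA M N →+ (M →ₗ[k] N) where
  toFun f :=
    { toFun := f
      map_add' := map_add f
      map_smul' := fun c x => by
        have := map_inclA_smul f (algebraMap k A c) x
        rw [AlgHom.commutes, algebraMap_smul, algebraMap_smul] at this
        exact this }
  map_zero' := rfl
  map_add' _ _ := rfl

@[simp]
theorem toLin_apply (f : HomA M N) (x : M) : toLin f x = f x := rfl

/-- An additive map commuting with the action of `A`, as an element of `Hom_A(M, N)`. -/
def mk' (f : M →ₗ[k] N)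
    (hf : ∀ (a : A) (x : M), f (Smash.inclA k A H a • x) = Smash.inclA k A H a • f x) :
    HomA M N :=
  show (resA k A H).obj M →ₗ[A] (resA k A H).obj N from
    { toFun := f
      map_add' := map_add f
      map_smul' := hf }

@[simp]
theorem mk'_apply (f : M →ₗ[k] N) (hf) (x : M) : mk' (A := A) (H := H) f hf x = f x := rfl

section Twist

variable [FiniteDimensional k H]

/-- `h ↦ S⁻¹(h) a`, with values in the opposite of `A # H`. -/
def twA (a : A) : H →ₗ[k] (Smash k A H)ᵐᵒᵖ :=
  (MulOpposite.opLinearEquiv k).toLinearMap ∘ₗ (Smash.inclA k A H).toLinearMap ∘ₗ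
    (LinearMap.toSpanSingleton H A a).restrictScalars k ∘ₗ antipodeInv k H

variable (k A H) in
/-- `h ↦ S⁻¹(h)`, with values in the opposite of `A # H`. -/
def twT : H →ₗ[k] (Smash k A H)ᵐᵒᵖ :=
  (MulOpposite.opLinearEquiv k).toLinearMap ∘ₗ (Smash.inclH k A H).toLinearMap ∘ₗ antipodeInv k H

variable (k A H) in
/-- `h ↦ h`, with values in the opposite of `A # H`. -/
def twJ : H →ₗ[k] (Smash k A H)ᵐᵒᵖ :=
  (MulOpposite.opLinearEquiv k).toLinearMap ∘ₗ (Smash.inclH k A H).toLinearMap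

theorem twT_cv_twJ : cv (twT k A H) (twJ k A H) = cu _ := by
  ext h
  have := congrArg (fun t => MulOpposite.op (Smash.inclH k A H t)) (sum_mul_antipodeInv (k := k) h)
  rw [cv_apply]
  simpa [cu, twT, twJ, ← MulOpposite.op_mul] using this

theorem twJ_cv_twT : cv (twJ k A H) (twT k A H) = cu _ := by
  ext h
  have := congrArg (fun t => MulOpposite.op (Smash.inclH k A H t)) (sum_antipodeInv_mul (k := k) h)
  rw [cv_apply]
  simpa [cu, twT, twJ, ← MulOpposite.op_mul] using this

theorem twA_cv_twJ (a : A) : cv (twA (k := k) (H := H) a) (twJ k A H) =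
    LinearMap.mulRight k (MulOpposite.op (Smash.inclA k A H a)) ∘ₗ twJ k A H := by
  let o : H →ₗ[k] Hᵐᵒᵖ := (MulOpposite.opLinearEquiv k).toLinearMap
  let iL : Hᵐᵒᵖ →ₐ[k] Hᵐᵒᵖ ⊗[k] H := Algebra.TensorProduct.includeLeft
  let iR : H →ₐ[k] Hᵐᵒᵖ ⊗[k] H := Algebra.TensorProduct.includeRight
  have e1 : cv (o ∘ₗ antipodeInv k H) o = cu _ := by
    ext h
    have := congrArg MulOpposite.op (sum_mul_antipodeInv (k := k) h)
    rw [cv_apply]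
    simpa [cu, o, ← MulOpposite.op_mul] using this
  have e2 : cv (iL.toLinearMap ∘ₗ o ∘ₗ antipodeInv k H) (iL.toLinearMap ∘ₗ o) = cu _ := by
    have := comp_cv (H := H) iL (o ∘ₗ antipodeInv k H) o
    rw [e1, comp_cu] at this
    exact this.symm
  have e3 : cv (iL.toLinearMap ∘ₗ o ∘ₗ antipodeInv k H)
      (cv (iL.toLinearMap ∘ₗ o) iR.toLinearMap) = iR.toLinearMap := by
    rw [← cv_assoc, e2, cu_cv]
  let G : Hᵐᵒᵖ ⊗[k] H →ₗ[k] (Smash k A H)ᵐᵒᵖ := TensorProduct.lift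
    ((LinearMap.mul k (Smash k A H)).compr₂ (MulOpposite.opLinearEquiv k).toLinearMap |>.compl₁₂
      ((Smash.inclA k A H).toLinearMap ∘ₗ
        (LinearMap.toSpanSingleton H A a).restrictScalars k ∘ₗ
        (MulOpposite.opLinearEquiv k).symm.toLinearMap)
      (Smash.inclH k A H).toLinearMap)
  have hG : ∀ u z, G (u ⊗ₜ[k] z) =
      MulOpposite.op (Smash.inclA k A H (u.unop • a) * Smash.inclH k A H z) := by
    intro u z; rfl
  ext h
  have e4 := congrArg G (LinearMap.congr_fun e3 h)
  rw [cv_apply, map_sum] at e4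
  rw [cv_apply]
  refine (Finset.sum_congr rfl fun i _ => ?_).trans (e4.trans ?_)
  · change MulOpposite.op (Smash.inclH k A H ((ℛ k h).right i) *
      Smash.inclA k A H (antipodeInv k H ((ℛ k h).left i) • a)) = _
    rw [Smash.inclH_mul_inclA, cv_apply, Finset.mul_sum, map_sum]
    rw [Finset.op_sum]
    refine Finset.sum_congr rfl fun j _ => ?_
    simp [iL, iR, o, hG, mul_smul]
  · simp [iR, hG, twJ, ← MulOpposite.op_mul]

theorem twT_cv_twA (a : A) : cv (twT k A H) (twA (k := k) (H := H) a) =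
    LinearMap.mulLeft k (MulOpposite.op (Smash.inclA k A H a)) ∘ₗ twT k A H := by
  have hr : ∀ (r : (Smash k A H)ᵐᵒᵖ) (f g : H →ₗ[k] (Smash k A H)ᵐᵒᵖ),
      cv f (LinearMap.mulRight k r ∘ₗ g) = LinearMap.mulRight k r ∘ₗ cv f g := by
    intro r f g; ext1 h; simp [cv_apply, mul_assoc]
  have e1 : cv (cv (twT k A H) (twA (k := k) (H := H) a)) (twJ k A H) =
      LinearMap.mulRight k (MulOpposite.op (Smash.inclA k A H a)) ∘ₗ cu _ := by
    rw [cv_assoc, twA_cv_twJ, hr, twT_cv_twJ]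
  have e2 := congrArg (fun t => cv t (twT k A H)) e1
  simp only [cv_assoc, twJ_cv_twT, cv_cu] at e2
  rw [e2]
  have e3 : LinearMap.mulRight k (MulOpposite.op (Smash.inclA k A H a)) ∘ₗ cu _ =
      LinearMap.mulLeft k (MulOpposite.op (Smash.inclA k A H a)) ∘ₗ
        (cu _ : H →ₗ[k] (Smash k A H)ᵐᵒᵖ) := by
    ext1 h
    exact Algebra.commutes (R := k) (counit (R := k) h) (MulOpposite.op (Smash.inclA k A H a))
  have hl : ∀ (r : (Smash k A H)ᵐᵒᵖ) (f g : H →ₗ[k] (Smash k A H)ᵐᵒᵖ),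
      cv (LinearMap.mulLeft k r ∘ₗ f) g = LinearMap.mulLeft k r ∘ₗ cv f g := by
    intro r f g; ext1 h; simp [cv_apply, mul_assoc]
  rw [e3, hl, cu_cv]

end Twist

section Action

variable [FiniteDimensional k H]

variable (M N) in
/-- The operator `f ↦ (x ↦ f(S⁻¹(h) x))`. -/
def preAct : H →ₐ[k] Module.End k (M →ₗ[k] N) :=
  AlgHom.ofLinearMap ((LinearMap.llcomp k M M N).flip ∘ₗ (Algebra.lsmul k k M).toLinearMap ∘ₗ
      (Smash.inclH k A H).toLinearMap ∘ₗ antipodeInv k H)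
    (by
      have h1 : antipodeInv k H 1 = 1 := MulOpposite.op_injective (map_one (antipodeInvOp k H))
      ext f x; simp [h1])
    (fun x y => by
      have h1 : antipodeInv k H (x * y) = antipodeInv k H y * antipodeInv k H x :=
        MulOpposite.op_injective (map_mul (antipodeInvOp k H) x y)
      ext f z; simp [h1])

variable (M N) in
/-- The operator `f ↦ (x ↦ h f(x))`. -/
def postAct : H →ₐ[k] Module.End k (M →ₗ[k] N) :=
  AlgHom.ofLinearMap (LinearMap.llcomp k M N N ∘ₗ (Algebra.lsmul k k N).toLinearMap ∘ₗ
      (Smash.inclH k A H).toLinearMap)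
    (by ext f x; simp)
    (fun x y => by ext f z; simp)

theorem preAct_commute (x y : H) : Commute (preAct M N x) (postAct M N y) := by
  change preAct M N x * postAct M N y = postAct M N y * preAct M N x
  ext f z
  rfl

variable (M N) in
/-- The action of `H` on `k`-linear maps between `A # H`-modules,
`(h • f)(x) = h₂ f(S⁻¹(h₁) x)`. -/
def linAct : H →ₐ[k] Module.End k (M →ₗ[k] N) :=
  (Algebra.TensorProduct.lift (preAct M N) (postAct M N) preAct_commute).comp
    (Bialgebra.comulAlgHom k H)

theorem linAct_apply (h : H) (f : M →ₗ[k] N) (x : M) :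
    linAct M N h f x = ∑ i ∈ (ℛ k h).index, Smash.inclH k A H ((ℛ k h).right i) •
      f (Smash.inclH k A H (antipodeInv k H ((ℛ k h).left i)) • x) := by
  rw [linAct, AlgHom.comp_apply, Bialgebra.comulAlgHom_apply, ← (ℛ k h).eq, map_sum,
    LinearMap.sum_apply, LinearMap.sum_apply]
  refine Finset.sum_congr rfl fun i _ => ?_
  rw [Algebra.TensorProduct.lift_tmul]
  rfl

theorem linAct_inclA (h : H) (f : HomA M N) (a : A) (x : M) :
    linAct M N h (toLin f) (Smash.inclA k A H a • x) =
      Smash.inclA k A H a • linAct M N h (toLin f) x := by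
  let iL : (Smash k A H)ᵐᵒᵖ →ₐ[k] (Smash k A H)ᵐᵒᵖ ⊗[k] (Smash k A H)ᵐᵒᵖ :=
    Algebra.TensorProduct.includeLeft
  let iR : (Smash k A H)ᵐᵒᵖ →ₐ[k] (Smash k A H)ᵐᵒᵖ ⊗[k] (Smash k A H)ᵐᵒᵖ :=
    Algebra.TensorProduct.includeRight
  let un : (Smash k A H)ᵐᵒᵖ →ₗ[k] Smash k A H := (MulOpposite.opLinearEquiv k).symm.toLinearMap
  let G : (Smash k A H)ᵐᵒᵖ ⊗[k] (Smash k A H)ᵐᵒᵖ →ₗ[k] N := TensorProduct.lift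
    (((Algebra.lsmul k k N).toLinearMap.flip).compl₁₂
      (toLin f ∘ₗ (Algebra.lsmul k k M).toLinearMap.flip x ∘ₗ un) un)
  have hG : ∀ u v, G (u ⊗ₜ[k] v) = v.unop • f (u.unop • x) := fun u v => rfl
  have e1 : cv (cv (iL.toLinearMap ∘ₗ twT k A H) (iR.toLinearMap ∘ₗ twA a))
      (iR.toLinearMap ∘ₗ twJ k A H) = cv (iL.toLinearMap ∘ₗ twT k A H)
      (iR.toLinearMap ∘ₗ
        LinearMap.mulRight k (MulOpposite.op (Smash.inclA k A H a)) ∘ₗ twJ k A H) := by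
    rw [cv_assoc, ← comp_cv, twA_cv_twJ]
  have e2 := congrArg G (LinearMap.congr_fun e1 h)
  rw [cv_apply, cv_apply, map_sum, map_sum] at e2
  rw [linAct_apply, linAct_apply, Finset.smul_sum]
  refine Eq.trans (Finset.sum_congr rfl fun i _ => ?_)
    (e2.trans (Finset.sum_congr rfl fun i _ => ?_))
  · have e3 := congrArg MulOpposite.unop
      (LinearMap.congr_fun (twT_cv_twA (k := k) (H := H) a) ((ℛ k h).left i))
    rw [cv_apply] at e3
    have e4 : Smash.inclH k A H (antipodeInv k H ((ℛ k h).left i)) * Smash.inclA k A H a =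
        ∑ j ∈ (ℛ k ((ℛ k h).left i)).index,
          Smash.inclA k A H (antipodeInv k H ((ℛ k ((ℛ k h).left i)).right j) • a) *
          Smash.inclH k A H (antipodeInv k H ((ℛ k ((ℛ k h).left i)).left j)) := by
      refine Eq.trans ?_ (e3.symm.trans ?_)
      · rfl
      · rw [Finset.unop_sum]; rfl
    rw [toLin_apply, smul_smul, e4, Finset.sum_smul, map_sum, Finset.smul_sum, cv_apply,
      Finset.sum_mul, map_sum]
    refine Finset.sum_congr rfl fun j _ => ?_
    rw [mul_smul, map_inclA_smul, smul_smul]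
    simp [iL, iR, hG, twT, twA, twJ]
  · simp [iL, iR, hG, twT, twJ, mul_smul]

instance : Module H (HomA M N) where
  smul h f := mk' (linAct M N h (toLin f)) (linAct_inclA h f)
  one_smul f := by
    ext x
    change linAct M N 1 (toLin f) x = f x
    rw [map_one]; rfl
  mul_smul h l f := by
    ext x
    change linAct M N (h * l) (toLin f) x = linAct M N h (linAct M N l (toLin f)) x
    rw [map_mul]; rfl
  smul_zero h := by
    ext x
    change linAct M N h (toLin 0) x = 0
    rw [map_zero, map_zero]; rfl
  smul_add h f g := by
    ext x
    change linAct M N h (toLin (f + g)) x = linAct M N h (toLin f) x + linAct M N h (toLin g) x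
    rw [map_add, map_add]; rfl
  add_smul h l f := by
    ext x
    change linAct M N (h + l) (toLin f) x = linAct M N h (toLin f) x + linAct M N l (toLin f) x
    rw [map_add]; rfl
  zero_smul f := by
    ext x
    change linAct M N 0 (toLin f) x = 0
    rw [map_zero]; rfl

/-- The action of `H` on `Hom_A(M, N)` is `(h • f)(x) = h₂ f(S⁻¹(h₁) x)`. -/
theorem smul_apply (h : H) (f : HomA M N) (x : M) :
    (h • f) x = ∑ i ∈ (ℛ k h).index, Smash.inclH k A H ((ℛ k h).right i) •
      f (Smash.inclH k A H (antipodeInv k H ((ℛ k h).left i)) • x) :=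
  linAct_apply h (toLin f) x

end Action

end HomA

/-- The map `Hom_A(P, M) → Hom_A(P, N)` induced by a map of `A # H`-modules `f : M → N`. -/
def HomA.postcomp {M N : ModuleCat.{u} (Smash k A H)} (P : ModuleCat.{u} (Smash k A H))
    (f : M ⟶ N) (g : HomA P M) : HomA P N :=
  ((resA k A H).map f).hom ∘ₗ g

@[simp]
theorem HomA.postcomp_apply {M N P : ModuleCat.{u} (Smash k A H)} (f : M ⟶ N) (g : HomA P M)
    (x : P) : HomA.postcomp P f g x = f (g x) := rfl

variable (k H) in
/-- The space of invariants `Z(V) = {v | h v = ε(h) v for all h}` of an `H`-module. -/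
def invariants (V : Type*) [AddCommGroup V] [Module H V] : Set V :=
  {v | ∀ h : H, h • v = algebraMap k H (counit h) • v}

variable (H) in
/-- Two maps of `H`-modules are identified in the stable category when their difference factors
through an injective module. -/
def stableRel : HomRel (ModuleCat.{u} H) := fun X Y f g =>
  ∃ (I : ModuleCat.{u} H) (_ : Injective I) (p : X ⟶ I) (q : I ⟶ Y), f - g = p ≫ q

variable (H) in
/-- The stable category of `H`-modules. -/
abbrev StableCat := CategoryTheory.Quotient (stableRel H)

variable (H) in
/-- The projection from `H`-modules to the stable category. -/
abbrev toStable : ModuleCat.{u} H ⥤ StableCat H := CategoryTheory.Quotient.functor (stableRel H)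

/-- A map of `A # H`-modules is a quasi-isomorphism if its restriction to `H` is an isomorphism in
the stable category of `H`-modules. -/
def IsQuasiIso {M N : ModuleCat.{u} (Smash k A H)} (f : M ⟶ N) : Prop :=
  IsIso ((toStable H).map ((resH k A H).map f))

/-- An `A # H`-module `M` is acyclic if `0 ⟶ M` is a quasi-isomorphism. -/
def IsAcyclic (M : ModuleCat.{u} (Smash k A H)) : Prop :=
  IsQuasiIso (0 : ModuleCat.of (Smash k A H) PUnit.{u + 1} ⟶ M)

/-- An `A # H`-module `P` is cofibrant if every surjective quasi-isomorphism `M → N` induces a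
surjection `Z(Hom_A(P, M)) → Z(Hom_A(P, N))`. -/
def IsCofibrant [FiniteDimensional k H] (P : ModuleCat.{u} (Smash k A H)) : Prop :=
  ∀ ⦃M N : ModuleCat.{u} (Smash k A H)⦄ (f : M ⟶ N), Function.Surjective f → IsQuasiIso f →
    Set.SurjOn (HomA.postcomp P f) (invariants k H (HomA P M)) (invariants k H (HomA P N))

variable (k A) in
/-- The `A # H`-module `A ⊗ V` attached to an `H`-module `V`: `A` acts by left multiplication on
the left factor, and `H` acts diagonally. -/
def tensorMod (V : ModuleCat.{u} H) : ModuleCat.{u} (Smash k A H) :=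
  letI : Module (Smash k A H) (A ⊗[k] V) := Module.compHom (A ⊗[k] V)
    (Smash.lift (leftAct k A V) (diagAct k H A V) (actsCompatibly_tensor k A H V)).toRingHom
  ModuleCat.of (Smash k A H) (A ⊗[k] V)

theorem tensorMod_smul (V : ModuleCat.{u} H) (a b : A) (h : H) (v : V) :
    Smash.tmul k a h • (show tensorMod k A V from (b ⊗ₜ[k] v : A ⊗[k] V)) =
      show tensorMod k A V from (∑ i ∈ (ℛ k h).index, (a * ((ℛ k h).left i • b)) ⊗ₜ[k] ((ℛ k h).right i • v) :
        A ⊗[k] V) := by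
  change pairAct (leftAct k A V) (diagAct k H A V) (a ⊗ₜ[k] h) (b ⊗ₜ[k] v) = _
  rw [pairAct_tmul, Module.End.mul_apply, diagAct_tmul, map_sum]
  rfl

/-- `Q` is isomorphic to a direct sum of `A # H`-modules `A ⊗ V` with `V` indecomposable. -/
def IsSumOfTensorMods (Q : ModuleCat.{u} (Smash k A H)) : Prop :=
  ∃ (I : Type u) (V : I → ModuleCat.{u} H), (∀ i, Indecomposable (V i)) ∧
    Nonempty (Q ≃ₗ[Smash k A H] DirectSum I fun i => tensorMod k A (V i))

/-- `P` admits an exhaustive filtration `F₀ ⊂ F₁ ⊂ ⋯` by `A # H`-submodules such that the inclusions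
`Fᵣ ⊂ Fᵣ₊₁` split over `A`, and `F₀` and the quotients `Fᵣ₊₁ / Fᵣ` are isomorphic to direct sums of
modules `A ⊗ V` with `V` indecomposable. -/
def IsPropertyPFiltered (P : ModuleCat.{u} (Smash k A H)) : Prop :=
  ∃ (F : ℕ → Submodule (Smash k A H) P) (hF : ∀ r, F r ≤ F (r + 1)),
    (∀ x : P, ∃ r, x ∈ F r) ∧
    (∀ r, ∃ s : HomA (ModuleCat.of (Smash k A H) (F (r + 1))) (ModuleCat.of (Smash k A H) (F r)),
      ∀ x : F r, s (Submodule.inclusion (hF r) x) = x) ∧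
    IsSumOfTensorMods (ModuleCat.of (Smash k A H) (F 0)) ∧
    ∀ r, IsSumOfTensorMods
      (ModuleCat.of (Smash k A H) (F (r + 1) ⧸ (F r).submoduleOf (F (r + 1))))

/-- Property (P): `M` is isomorphic to an `A # H`-module with a filtration as above. -/
def HasPropertyP (M : ModuleCat.{u} (Smash k A H)) : Prop :=
  ∃ P : ModuleCat.{u} (Smash k A H), Nonempty (M ≅ P) ∧ IsPropertyPFiltered P

end Modules

end Hopfological

end

/-!
Throughout, `H` is a finite dimensional Hopf algebra over a field, `A` an `H`-module algebra and
`A # H` the smash product.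

Everything rests on the fact that injective `H`-modules are projective
(`projective_of_injective`): an integral gives a linear form on `H` for which `(x, y) ↦ l(x y)` is
nondegenerate, and dual bases for it embed any `H`-module `H`-linearly into a free one. It follows
that a surjection of `A # H`-modules is a quasi-isomorphism exactly when its kernel is injective
over `H` (`isQuasiIso_iff_of_surjective`), and that `K` is acyclic exactly when it is injective over
`H` (`isAcyclic_iff`). The invariants of `Hom_A(P, M)` are the `A # H`-linear maps, so a module is
cofibrant if and only if it lifts against all surjections of `A # H`-modules with kernel injective
over `H` (`isCofibrant_iff`, `LiftsAgainstInjectiveKernels`).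

Modules with property (P) lift against such surjections
(`IsPropertyPFiltered.liftsAgainstInjectiveKernels`) and are projective over `A`
(`IsPropertyPFiltered.projective_resA`): `A # H`-linear maps from `A ⊗ V` are `H`-linear maps from
`V`, so surjections onto `A ⊗ V` with injective kernel split, and a section over one step of the
filtration extends to the next (`exists_extend_complement`). Both properties pass to summands.

Conversely, any `M` is the target of a surjection `N → M` with `N` of property (P) and with kernel
injective over `H` (`exists_propertyP_resolution`). The module `N` comes from the small object
argument for the inclusions `A ⊗ J → A ⊗ H`, where `J` is a maximal left ideal of `H`; their
cokernels `A ⊗ (H / J)` have `H / J` simple, hence indecomposable, and as `H` is artinian, extending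
maps from maximal left ideals is enough to extend maps from all left ideals, which is Baer's
criterion. If `M` is cofibrant, then `N → M` splits.

For the criterion by `Hom_A(M, K)`, the functor `M ↦ M ⊗ W` of an `H`-module `W` has the right
adjoint `K ↦ Hom_k(W, K)`, which preserves injectivity over `H`
(`isInjectiveOverH_internalHom`). If `M` is cofibrant and `K` acyclic, extending maps
`W → Hom_A(M, K)` to `W' ⊇ W` means lifting `M → Hom_k(W, K)` along `Hom_k(W', K) → Hom_k(W, K)`
(`LiftsAgainstInjectiveKernels.injective_homA`). In the other direction, an `A`-linear lift along
`X → Y` with kernel `K` is corrected to an `A # H`-linear one by an `H`-linear retraction of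
`Hom_A(M, X)` onto `Hom_A(M, K)` (`liftsAgainstInjectiveKernels_of_injective_homA`).
-/

namespace Hopfological

/-! ### Injective modules over a finite dimensional Hopf algebra are projective -/

section Frobenius

variable {k : Type*} [Field k] {H : Type*} [Ring H] [HopfAlgebra k H]

theorem hitR_comp_hitR (φ ψ : H →ₗ[k] k) : hitR φ ∘ₗ hitR ψ = hitR (cv φ ψ) := by
  rw [hitR, hitR, hitR, comp_cv_hat, hat_cv, ← cv_assoc]; rfl

theorem sum_hitR {κ : Type*} (s : Finset κ) (φ : κ → (H →ₗ[k] k)) :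
    ∑ i ∈ s, hitR (φ i) = hitR (∑ i ∈ s, φ i) := by
  ext z
  simp only [hitR, cv_hat_apply, LinearMap.sum_apply, Finset.sum_smul]
  exact Finset.sum_comm

theorem hitR_smul_counit (c : k) : hitR (c • (counit : H →ₗ[k] k)) = c • LinearMap.id := by
  have h5 : hitR (counit : H →ₗ[k] k) = LinearMap.id := cv_cu _
  rw [← h5]; ext z; simp [hitR_apply_comul]

/-- `S(x₁) x₂ ⊗ x₃ = 1 ⊗ x`. -/
theorem incL_antipode_cv_comul :
    cv ((incL k H).toLinearMap ∘ₗ HopfAlgebra.antipode k (A := H)) (comul : H →ₗ[k] H ⊗[k] H) =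
      (incR k H).toLinearMap := by
  have h0 : (comul : H →ₗ[k] H ⊗[k] H) = cv (incL k H).toLinearMap (incR k H).toLinearMap := by
    ext h
    rw [cv_apply, ← (ℛ k h).eq]
    simp
  have := comp_cv (H := H) (incL k H) (HopfAlgebra.antipode k (A := H)) LinearMap.id
  rw [antipode_cv_id, comp_cu] at this
  rw [h0, ← cv_assoc]
  erw [← this]
  rw [cu_cv]

variable (k H) in
/-- A finite dimensional Hopf algebra is a Frobenius algebra: the bilinear form `(x, y) ↦ l(x y)`
attached to a nonzero integral `l` of the dual is nondegenerate. -/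
theorem exists_form_nondegenerate [FiniteDimensional k H] :
    ∃ l : H →ₗ[k] k, ∀ h : H, (∀ x, l (x * h) = 0) → h = 0 := by
  have : Nontrivial H := by
    refine ⟨0, 1, fun h => ?_⟩
    have := congrArg (counit (R := k)) h
    simp at this
  obtain ⟨l, hl0, hl⟩ := exists_form_ne_zero (k := k) (H := H)
  refine ⟨l, fun h hh => ?_⟩
  have hhitR : ∀ x, hitR l x = l x • (1 : H) := by
    intro x
    refine (Module.forall_dual_apply_eq_zero_iff k _).1 ?_ |> sub_eq_zero.1
    intro φ
    have h1 : l (hitL φ x) = φ (hitR l x) := by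
      rw [hitL, hitR, hat_cv_apply, cv_hat_apply]; simp [mul_comm]
    rw [map_sub, ← h1, hl, map_smul, smul_eq_mul, mul_comm, sub_self]
  -- `h₁ l(x h₂) = S(x₁) x₂ h₁ l(x₃ h₂) = S(x₁) l(x₂ h) = 0`
  have hB : ∀ x, hitR (l ∘ₗ LinearMap.mulLeft k x) h = 0 := by
    intro x
    let q : H ⊗[k] H →ₗ[k] H := (TensorProduct.rid k H).toLinearMap ∘ₗ l.lTensor H
    have q1 : ∀ (t : H ⊗[k] H) (v : H), q ((v ⊗ₜ[k] (1 : H)) * t) = v * q t := by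
      intro t v
      induction t with
      | zero => simp
      | tmul a c => simp [q]
      | add a c ha hc => rw [mul_add, map_add, ha, hc, map_add, mul_add]
    have q2 : ∀ z, q (comul (R := k) z) = l z • (1 : H) := by
      intro z; rw [← hhitR, hitR_apply_comul]; rfl
    have q3 := congrArg (fun t => q (t * comul (R := k) h))
      (LinearMap.congr_fun (incL_antipode_cv_comul (k := k) (H := H)) x)
    simp only [cv_apply, Finset.sum_mul, map_sum] at q3
    have q4 : q ((incR k H).toLinearMap x * comul (R := k) h) =
        hitR (l ∘ₗ LinearMap.mulLeft k x) h := by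
      rw [hitR_apply_comul, ← (ℛ k h).eq]
      simp [q, Finset.mul_sum]
    rw [← q4, ← q3]
    refine Finset.sum_eq_zero fun i _ => ?_
    change q (((HopfAlgebra.antipode k (A := H) ((ℛ k x).left i)) ⊗ₜ[k] (1 : H)) *
      comul (R := k) ((ℛ k x).right i) * comul (R := k) h) = 0
    rw [mul_assoc, q1, ← Bialgebra.comul_mul, q2, hh]
    simp
  obtain ⟨x, hx⟩ : ∃ x, l x ≠ 0 := by
    by_contra! hc
    exact hl0 (LinearMap.ext hc)
  let b := Module.finBasis k H
  -- hence `l(x) h = h₁ l(x S(h₂) h₃) = 0`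
  have h7 : ∑ i, cv (b.coord i) (l ∘ₗ LinearMap.mulLeft k
      (x * HopfAlgebra.antipode k (A := H) (b i))) = l x • (counit : H →ₗ[k] k) := by
    ext z
    have : ∀ i, cv (b.coord i) (l ∘ₗ LinearMap.mulLeft k
        (x * HopfAlgebra.antipode k (A := H) (b i))) z =
        ∑ j ∈ (ℛ k z).index, b.coord i ((ℛ k z).left j) •
          (l ∘ₗ LinearMap.mulLeft k x ∘ₗ LinearMap.mulRight k ((ℛ k z).right j) ∘ₗ
            HopfAlgebra.antipode k (A := H)) (b i) := by
      intro i
      rw [cv_apply]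
      simp
    rw [LinearMap.sum_apply, Finset.sum_congr rfl fun i _ => this i, Finset.sum_comm,
      Finset.sum_congr rfl fun j _ => sum_coord_smul' b _ _]
    have h3 := congrArg (fun t => l (x * t)) (LinearMap.congr_fun (antipode_cv_id k H) z)
    rw [cv_apply] at h3
    simpa [cu, Algebra.algebraMap_eq_smul_one, Finset.mul_sum, mul_comm] using h3
  have h9 : l x • h = 0 := by
    have h8 := congrArg (fun t => hitR t h) h7
    simp only [hitR_smul_counit, ← sum_hitR, ← hitR_comp_hitR, LinearMap.sum_apply,
      LinearMap.comp_apply, hB, map_zero, Finset.sum_const_zero] at h8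
    exact h8.symm
  exact (smul_eq_zero.1 h9).resolve_left hx

variable (k H) in
/-- Dual bases for a Frobenius form. -/
theorem exists_dual_basis [FiniteDimensional k H] :
    ∃ (l : H →ₗ[k] k) (n : ℕ) (b e : Module.Basis (Fin n) k H),
      ∀ x i, l (x * e i) = b.coord i x := by
  obtain ⟨l, hl⟩ := exists_form_nondegenerate k H
  let b := Module.finBasis k H
  let T : H →ₗ[k] Module.Dual k H := (LinearMap.mul k H).flip.compr₂ l
  have hT : ∀ h x, T h x = l (x * h) := fun h x => rfl
  have hinj : Function.Injective T := by
    rw [injective_iff_map_eq_zero]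
    intro h hh
    exact hl h fun x => by rw [← hT, hh]; rfl
  let e := LinearEquiv.ofInjectiveOfFinrankEq T hinj Subspace.dual_finrank_eq.symm
  refine ⟨l, _, b, b.dualBasis.map e.symm, fun x i => ?_⟩
  rw [← hT, Module.Basis.map_apply]
  have : T (e.symm (b.dualBasis i)) = b.dualBasis i := e.apply_symm_apply _
  rw [this, Module.Basis.coe_dualBasis]

/-- An injective module over a finite dimensional Hopf algebra is projective: with dual bases
`(bᵢ)`, `(eᵢ)` of a Frobenius form, `v ↦ ∑ eᵢ ⊗ bᵢ v` is an `H`-linear embedding of `V` into the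
free module `H ⊗ V`. -/
theorem projective_of_injective (k : Type u) [Field k] {H V : Type u} [Ring H] [HopfAlgebra k H]
    [FiniteDimensional k H] [AddCommGroup V] [Module H V] [Module.Injective H V] :
    Module.Projective H V := by
  let : Module k V := Module.compHom V (algebraMap k H)
  have : IsScalarTower k H V := ⟨fun c h v => by
    rw [Algebra.smul_def, mul_smul]; rfl⟩
  obtain ⟨l, n, b, e, hbe⟩ := exists_dual_basis k H
  let D : H → H ⊗[k] V →ₗ[k] V := fun x =>
    (TensorProduct.lid k V).toLinearMap ∘ₗ (l ∘ₗ LinearMap.mulLeft k x).rTensor V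
  have hD : ∀ x h v, D x (h ⊗ₜ[k] v) = l (x * h) • v := fun x h v => rfl
  have hD0 : ∀ t, (∀ x, D x t = 0) → t = 0 := by
    intro t ht
    obtain ⟨c, rfl⟩ := (TensorProduct.equivFinsuppOfBasisLeft e).symm.surjective t
    have : c = 0 := by
      ext i
      have h1 := ht (b i)
      rw [TensorProduct.equivFinsuppOfBasisLeft_symm_apply, Finsupp.sum, map_sum] at h1
      simp only [hD, hbe, Module.Basis.coord_apply, Module.Basis.repr_self] at h1
      rw [Finset.sum_eq_single i] at h1
      · simpa using h1
      · intro j _ hj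
        rw [Finsupp.single_eq_of_ne hj, zero_smul]
      · intro hi
        rw [Finsupp.notMem_support_iff.1 hi, smul_zero]
    rw [this, map_zero]
  have hsum : ∀ (x : H), ∑ i, b.coord i x • b i = x := fun x => b.sum_repr x
  let J : V →ₗ[H] H ⊗[k] V :=
    { toFun := fun v => ∑ i, e i ⊗ₜ[k] (b i • v)
      map_add' := fun v w => by
        simp only [smul_add, TensorProduct.tmul_add, Finset.sum_add_distrib]
      map_smul' := fun h v => by
        rw [RingHom.id_apply, ← sub_eq_zero]
        refine hD0 _ fun x => ?_
        rw [map_sub, sub_eq_zero, Finset.smul_sum, map_sum, map_sum]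
        simp only [TensorProduct.smul_tmul', smul_eq_mul, hD, ← mul_assoc, hbe]
        simp only [← smul_assoc, ← Finset.sum_smul, hsum]
        rw [smul_eq_mul, mul_smul] }
  have hJ : Function.Injective J := by
    rw [injective_iff_map_eq_zero]
    intro v hv
    have h1 := congrArg (D 1) hv
    change D 1 (∑ i, e i ⊗ₜ[k] (b i • v)) = D 1 0 at h1
    rw [map_sum, map_zero] at h1
    simp only [hD, hbe, ← smul_assoc, ← Finset.sum_smul, hsum, one_smul] at h1
    exact h1
  obtain ⟨r, hr⟩ := Module.Injective.out J hJ LinearMap.id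
  exact Module.Projective.of_split J r (LinearMap.ext hr)

end Frobenius

end Hopfological

noncomputable section

namespace Hopfological

/-! ### Split surjections and injective modules -/

section Generalities

variable {R : Type*} [Ring R]

/-- A linear map that vanishes on the kernel of a surjection descends along it. -/
theorem exists_comp_eq_of_ker_le {X Y Z : Type*} [AddCommGroup X] [Module R X] [AddCommGroup Y]
    [Module R Y] [AddCommGroup Z] [Module R Z] (f : X →ₗ[R] Y) (hf : Function.Surjective f)
    (g : X →ₗ[R] Z) (h : LinearMap.ker f ≤ LinearMap.ker g) : ∃ g' : Y →ₗ[R] Z, g' ∘ₗ f = g := by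
  refine ⟨(LinearMap.ker f).liftQ g h ∘ₗ (f.quotKerEquivOfSurjective hf).symm.toLinearMap, ?_⟩
  ext x
  have : (f.quotKerEquivOfSurjective hf).symm (f x) = (LinearMap.ker f).mkQ x :=
    (LinearEquiv.symm_apply_eq _).2 rfl
  simp [this]

theorem injective_of_retract {I Q : Type u} [AddCommGroup I] [Module R I] [AddCommGroup Q]
    [Module R Q] [Module.Injective R I] (i : Q →ₗ[R] I) (r : I →ₗ[R] Q)
    (h : ∀ x, r (i x) = x) : Module.Injective R Q where
  out X Y _ _ _ _ f hf g := by
    obtain ⟨g', hg'⟩ := Module.Injective.out f hf (i ∘ₗ g)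
    exact ⟨r ∘ₗ g', fun x => by simp [hg', h]⟩

/-- A surjection whose kernel is injective splits. -/
theorem exists_section_of_injective_ker {X Y : Type u} [AddCommGroup X] [Module R X]
    [AddCommGroup Y] [Module R Y] (f : X →ₗ[R] Y) (hf : Function.Surjective f)
    [Module.Injective R (LinearMap.ker f)] :
    ∃ (s : Y →ₗ[R] X) (r : X →ₗ[R] LinearMap.ker f),
      (∀ y, f (s y) = y) ∧ ∀ x, x - s (f x) = r x := by
  obtain ⟨r, hr⟩ := Module.Injective.out (LinearMap.ker f).subtype
    (Submodule.injective_subtype _) LinearMap.id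
  obtain ⟨s, hs⟩ := exists_comp_eq_of_ker_le f hf
    (LinearMap.id - (LinearMap.ker f).subtype ∘ₗ r) (fun x hx => by
      have := hr ⟨x, hx⟩
      simp only [Submodule.subtype_apply, LinearMap.id_apply] at this
      simp [this])
  have hs' : ∀ x, s (f x) = x - r x := fun x => LinearMap.congr_fun hs x
  refine ⟨s, r, fun y => ?_, fun x => by rw [hs']; abel⟩
  obtain ⟨x, rfl⟩ := hf y
  rw [hs', map_sub, (r x).2, sub_zero]

theorem injective_ker_of_section {X Y : Type u} [AddCommGroup X] [Module R X]
    [AddCommGroup Y] [Module R Y] (f : X →ₗ[R] Y) (s : Y →ₗ[R] X) (hs : ∀ y, f (s y) = y)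
    [Module.Injective R X] : Module.Injective R (LinearMap.ker f) :=
  injective_of_retract (LinearMap.ker f).subtype
    ((LinearMap.id - s ∘ₗ f).codRestrict _ fun x => by simp [hs])
    fun x => Subtype.ext (by simp)

end Generalities

/-! ### Isomorphisms in the stable category -/

section Stable

variable {H : Type u} [Ring H]

instance : Congruence (stableRel H) where
  equivalence :=
    { refl := fun f => ⟨ModuleCat.of H PUnit.{u + 1},
        (Module.injective_iff_injective_object H PUnit.{u + 1}).1
          ⟨fun _ _ _ _ _ _ _ _ _ => ⟨0, fun _ => rfl⟩⟩, 0, 0, by simp⟩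
      symm := by
        rintro f g ⟨I, hI, p, q, h⟩
        exact ⟨I, hI, p, -q, by rw [Preadditive.comp_neg, ← h, neg_sub]⟩
      trans := by
        rintro f g l ⟨I, _, p, q, h⟩ ⟨I', _, p', q', h'⟩
        exact ⟨I ⊞ I', inferInstance, Limits.biprod.lift p p', Limits.biprod.desc q q', by
          rw [Limits.biprod.lift_desc, ← h, ← h', sub_add_sub_cancel]⟩ }
  comp_left := by
    rintro _ _ _ f g g' ⟨I, hI, p, q, h⟩
    exact ⟨I, hI, f ≫ p, q, by rw [← Preadditive.comp_sub, h, Category.assoc]⟩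
  comp_right := by
    rintro _ _ _ f f' g ⟨I, hI, p, q, h⟩
    exact ⟨I, hI, p, q ≫ g, by rw [← Preadditive.sub_comp, h, Category.assoc]⟩

theorem isIso_toStable_map_iff {X Y : ModuleCat.{u} H} (f : X ⟶ Y) :
    IsIso ((toStable H).map f) ↔
      ∃ g : Y ⟶ X, stableRel H (f ≫ g) (𝟙 X) ∧ stableRel H (g ≫ f) (𝟙 Y) := by
  simp only [← Quotient.functor_map_eq_iff, Functor.map_comp]
  constructor
  · rintro ⟨g, h1, h2⟩
    obtain ⟨g, rfl⟩ := (toStable H).map_surjective g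
    exact ⟨g, h1, h2⟩
  · rintro ⟨g, h1, h2⟩
    exact ⟨_, h1, h2⟩

theorem isIso_toStable_map_of_injective_ker {X Y : ModuleCat.{u} H} (f : X ⟶ Y)
    (hf : Function.Surjective f) [Module.Injective H (LinearMap.ker f.hom)] :
    IsIso ((toStable H).map f) := by
  obtain ⟨s, r, hs, hr⟩ := exists_section_of_injective_ker f.hom hf
  refine (isIso_toStable_map_iff f).2 ⟨ModuleCat.ofHom s, ?_, ?_⟩
  · refine ⟨ModuleCat.of H (LinearMap.ker f.hom),
      Module.injective_object_of_injective_module H _, ModuleCat.ofHom r,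
      ModuleCat.ofHom (-(LinearMap.ker f.hom).subtype), ?_⟩
    ext x
    change s (f.hom x) - x = -(r x : X)
    rw [← hr, neg_sub]
  · have : ModuleCat.ofHom s ≫ f = 𝟙 Y := by
      ext y
      exact hs y
    rw [this]
    exact (Congruence.equivalence (r := stableRel H)).refl _

/-- The kernel of a surjection that becomes an isomorphism in the stable category is injective.
An inverse `g` in the stable category can be corrected to a section `s`, because injective
modules are projective; then `1 - s f` is a retraction onto the kernel, and it factors through an
injective module there. -/
theorem injective_ker_of_isIso_toStable_map (k : Type u) [Field k] [HopfAlgebra k H]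
    [FiniteDimensional k H] {X Y : ModuleCat.{u} H} (f : X ⟶ Y) (hf : Function.Surjective f)
    (h : IsIso ((toStable H).map f)) : Module.Injective H (LinearMap.ker f.hom) := by
  obtain ⟨g, ⟨I, hI, p, q, h1⟩, ⟨I', hI', p', q', h2⟩⟩ := (isIso_toStable_map_iff f).1 h
  have : Module.Injective H I := Module.injective_module_of_injective_object H I
  have : Module.Injective H I' := Module.injective_module_of_injective_object H I'
  have : Module.Projective H I' := projective_of_injective k
  obtain ⟨l, hl⟩ := Module.projective_lifting_property f.hom q'.hom hf
  have hl' : ∀ x, f.hom (l x) = q'.hom x := LinearMap.congr_fun hl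
  have h1' : ∀ x, g.hom (f.hom x) - x = q.hom (p.hom x) := fun x =>
    LinearMap.congr_fun (congrArg ModuleCat.Hom.hom h1) x
  have h2' : ∀ y, f.hom (g.hom y) - y = q'.hom (p'.hom y) := fun x =>
    LinearMap.congr_fun (congrArg ModuleCat.Hom.hom h2) x
  let s : Y →ₗ[H] X := g.hom - l ∘ₗ p'.hom
  have hs : ∀ y, f.hom (s y) = y := fun y => by simp [s, hl', ← h2']
  let r : X →ₗ[H] LinearMap.ker f.hom :=
    (LinearMap.id - s ∘ₗ f.hom).codRestrict _ fun x => by simp [hs]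
  refine injective_of_retract (p.hom ∘ₗ (LinearMap.ker f.hom).subtype) (-(r ∘ₗ q.hom)) fun x => ?_
  have hx : f.hom x = 0 := x.2
  apply Subtype.ext
  have h3 := h1' x
  rw [hx, map_zero, zero_sub] at h3
  simp [r, ← h3, hx]

end Stable

/-! ### Cofibrant modules as modules with a lifting property -/

section Cofibrant

variable {k A H : Type u} [Field k] [Ring H] [HopfAlgebra k H] [Ring A] [Algebra k A]
  [Module H A] [IsModuleAlgebra k H A]

attribute [local instance] ModuleCat.moduleOfAlgebraModule
  ModuleCat.isScalarTower_of_algebra_moduleCat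

/-- An `A # H`-module whose restriction to `H` is injective. -/
abbrev IsInjectiveOverH (X : ModuleCat.{u} (Smash k A H)) : Prop :=
  Module.Injective H ((resH k A H).obj X)

/-- A module with the left lifting property against the surjections of `A # H`-modules whose
kernel is injective over `H`. -/
def LiftsAgainstInjectiveKernels (M : ModuleCat.{u} (Smash k A H)) : Prop :=
  ∀ ⦃X Y : ModuleCat.{u} (Smash k A H)⦄ (f : X ⟶ Y), Function.Surjective f →
    IsInjectiveOverH (ModuleCat.of (Smash k A H) (LinearMap.ker f.hom)) →
    ∀ g : M ⟶ Y, ∃ g' : M ⟶ X, g' ≫ f = g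

/-- The kernel of a map of `A # H`-modules, formed before or after restriction to `H`. -/
def kerResEquiv {X Y : ModuleCat.{u} (Smash k A H)} (f : X ⟶ Y) :
    LinearMap.ker ((resH k A H).map f).hom ≃ₗ[H]
      (resH k A H).obj (ModuleCat.of (Smash k A H) (LinearMap.ker f.hom)) where
  toFun x := (⟨x.1, x.2⟩ : LinearMap.ker f.hom)
  invFun x := ⟨Subtype.val (show LinearMap.ker f.hom from x),
    Subtype.prop (show LinearMap.ker f.hom from x)⟩
  left_inv _ := rfl
  right_inv _ := rfl
  map_add' _ _ := rfl
  map_smul' _ _ := rfl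

theorem injective_ker_res_iff {X Y : ModuleCat.{u} (Smash k A H)} (f : X ⟶ Y) :
    Module.Injective H (LinearMap.ker ((resH k A H).map f).hom) ↔
      IsInjectiveOverH (ModuleCat.of (Smash k A H) (LinearMap.ker f.hom)) :=
  ⟨fun _ => injective_of_retract (kerResEquiv f).symm.toLinearMap (kerResEquiv f).toLinearMap
    fun x => (kerResEquiv f).apply_symm_apply x,
   fun _ => injective_of_retract (kerResEquiv f).toLinearMap (kerResEquiv f).symm.toLinearMap
    fun x => (kerResEquiv f).symm_apply_apply x⟩

theorem isQuasiIso_iff_of_surjective [FiniteDimensional k H] {X Y : ModuleCat.{u} (Smash k A H)}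
    (f : X ⟶ Y) (hf : Function.Surjective f) :
    IsQuasiIso f ↔ IsInjectiveOverH (ModuleCat.of (Smash k A H) (LinearMap.ker f.hom)) := by
  rw [← injective_ker_res_iff]
  exact ⟨fun h => injective_ker_of_isIso_toStable_map k _ hf h,
    fun _ => isIso_toStable_map_of_injective_ker _ hf⟩

theorem isAcyclic_iff (K : ModuleCat.{u} (Smash k A H)) : IsAcyclic K ↔ IsInjectiveOverH K := by
  rw [IsAcyclic, IsQuasiIso, isIso_toStable_map_iff]
  constructor
  · rintro ⟨g, -, I, hI, p, q, h⟩
    have : Module.Injective H I := Module.injective_module_of_injective_object H I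
    refine injective_of_retract (Q := (resH k A H).obj K) p.hom (-q.hom) fun x => ?_
    have h2 := LinearMap.congr_fun (congrArg ModuleCat.Hom.hom h) x
    have h3 : -x = q.hom (p.hom x) := (zero_sub x).symm.trans h2
    rw [LinearMap.neg_apply, ← h3, neg_neg]
  · intro h
    have hI : Injective ((resH k A H).obj K) :=
      Module.injective_object_of_injective_module H ((resH k A H).obj K)
    refine ⟨0, ⟨_, hI, 0, 0, ?_⟩, ⟨_, hI, -𝟙 _, 𝟙 _, ?_⟩⟩
    · ext x
      exact Subsingleton.elim (α := PUnit) _ _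
    · simp

theorem Smash.inclA_mul_inclH (a : A) (h : H) :
    Smash.inclA k A H a * Smash.inclH k A H h = Smash.tmul k a h := by
  apply (Smash.equiv k A H).injective
  rw [Smash.equiv_mul, Smash.inclA_apply, Smash.inclH_apply]
  simp [leftAct_tmul]

/-- An additive map commuting with the actions of `A` and of `H` is `A # H`-linear. -/
def linearMapOfCommute {X Y : Type*} [AddCommGroup X] [Module (Smash k A H) X] [AddCommGroup Y]
    [Module (Smash k A H) Y] (f : X →+ Y)
    (hA : ∀ (a : A) x, f (Smash.inclA k A H a • x) = Smash.inclA k A H a • f x)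
    (hH : ∀ (h : H) x, f (Smash.inclH k A H h • x) = Smash.inclH k A H h • f x) :
    X →ₗ[Smash k A H] Y :=
  { f with
    map_smul' := fun b x => by
      change f (b • x) = b • f x
      induction b using Smash.induction_on with
      | zero => rw [zero_smul, zero_smul, map_zero]
      | tmul a h => rw [← Smash.inclA_mul_inclH, mul_smul, mul_smul, hA, hH]
      | add x y hx hy => rw [add_smul, add_smul, map_add, hx, hy] }

section Twist

variable {T : Type*} [AddCommGroup T] [Module k T]

/-- Precomposition with endomorphisms, as a homomorphism to the opposite algebra. -/
def precompOp (M N : Type*) [AddCommGroup M] [Module k M] [AddCommGroup N] [Module k N] :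
    Module.End k M →ₐ[k] (Module.End k (M →ₗ[k] N))ᵐᵒᵖ :=
  AlgHom.ofLinearMap ((MulOpposite.opLinearEquiv k).toLinearMap ∘ₗ (LinearMap.llcomp k M M N).flip)
    rfl (fun _ _ => rfl)

theorem cv_apply_congr {F G L : H →ₗ[k] Module.End k T} {β : T} (h : ∀ x, F x β = G x β) (x : H) :
    cv L F x β = cv L G x β := by
  simp only [cv_apply, LinearMap.sum_apply, Module.End.mul_apply, h]

theorem cv_unop_apply_congr {F G L : H →ₗ[k] (Module.End k T)ᵐᵒᵖ} {β : T}
    (h : ∀ x, (F x).unop β = (G x).unop β) (x : H) :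
    (cv F L x).unop β = (cv G L x).unop β := by
  simp only [cv_apply, Finset.unop_sum, MulOpposite.unop_mul, LinearMap.sum_apply,
    Module.End.mul_apply, h]

/-- For an antihomomorphism `P`, the identities `F(h) β = P(S⁻¹(h₁)) G(h₂) β` and
`G(h) β = P(h₁) F(h₂) β` are equivalent. -/
theorem apply_eq_cv_antipodeInv_iff [FiniteDimensional k H]
    (P : H →ₐ[k] (Module.End k T)ᵐᵒᵖ) (F G : H →ₗ[k] Module.End k T) (β : T) :
    (∀ h, F h β = cv ((MulOpposite.opLinearEquiv k).symm.toLinearMap ∘ₗ P.toLinearMap ∘ₗ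
        antipodeInv k H) G h β) ↔
      ∀ h, G h β = cv ((MulOpposite.opLinearEquiv k).symm.toLinearMap ∘ₗ P.toLinearMap) F h β := by
  have e1 : cv ((MulOpposite.opLinearEquiv k).symm.toLinearMap ∘ₗ P.toLinearMap ∘ₗ
      antipodeInv k H) ((MulOpposite.opLinearEquiv k).symm.toLinearMap ∘ₗ P.toLinearMap) =
      cu (Module.End k T) := by
    ext1 h
    have := congrArg (fun t => (P t).unop) (sum_mul_antipodeInv (k := k) h)
    rw [cv_apply]
    simpa [cu] using this
  have e2 : cv ((MulOpposite.opLinearEquiv k).symm.toLinearMap ∘ₗ P.toLinearMap)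
      ((MulOpposite.opLinearEquiv k).symm.toLinearMap ∘ₗ P.toLinearMap ∘ₗ antipodeInv k H) =
      cu (Module.End k T) := by
    ext1 h
    have := congrArg (fun t => (P t).unop) (sum_antipodeInv_mul (k := k) h)
    rw [cv_apply]
    simpa [cu] using this
  constructor
  · intro hF h
    rw [cv_apply_congr hF, ← cv_assoc, e2, cu_cv]
  · intro hG h
    rw [cv_apply_congr hG, ← cv_assoc, e1, cu_cv]

/-- For an antihomomorphism `P`, the identities `G(h) β = P(h₂) F(h₁) β` and
`F(h) β = P(S(h₂)) G(h₁) β` are equivalent. -/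
theorem apply_eq_cv_antipode_iff (P : H →ₐ[k] (Module.End k T)ᵐᵒᵖ)
    (F G : H →ₗ[k] (Module.End k T)ᵐᵒᵖ) (β : T) :
    (∀ h, (G h).unop β = (cv F P.toLinearMap h).unop β) ↔
      ∀ h, (F h).unop β =
        (cv G (P.toLinearMap ∘ₗ HopfAlgebra.antipode k (A := H)) h).unop β := by
  have e1 := comp_cv (H := H) P LinearMap.id (HopfAlgebra.antipode k (A := H))
  have e2 := comp_cv (H := H) P (HopfAlgebra.antipode k (A := H)) LinearMap.id
  rw [id_cv_antipode, comp_cu, LinearMap.comp_id] at e1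
  rw [antipode_cv_id, comp_cu, LinearMap.comp_id] at e2
  constructor
  · intro hG h
    rw [cv_unop_apply_congr hG, cv_assoc, ← e1, cv_cu]
  · intro hF h
    rw [cv_unop_apply_congr hF, cv_assoc, ← e2, cv_cu]

end Twist

variable [FiniteDimensional k H] {M N : ModuleCat.{u} (Smash k A H)}

theorem HomA.linAct_eq_cv (h : H) :
    HomA.linAct M N h = cv (HomA.preAct M N).toLinearMap (HomA.postAct M N).toLinearMap h := by
  rw [HomA.linAct, cv_apply, AlgHom.comp_apply, Bialgebra.comulAlgHom_apply, ← (ℛ k h).eq, map_sum]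
  rfl

theorem HomA.algebraMap_smul_apply (c : k) (f : HomA M N) (x : M) :
    (algebraMap k H c • f) x = c • f x := by
  change HomA.linAct M N (algebraMap k H c) (HomA.toLin f) x = c • f x
  rw [AlgHom.commutes]
  rfl

/-- The invariants of `Hom_A(M, N)` are the `A # H`-linear maps. -/
theorem mem_invariants_homA_iff (f : HomA M N) : f ∈ invariants k H (HomA M N) ↔
    ∀ (h : H) (x : M), f (Smash.inclH k A H h • x) = Smash.inclH k A H h • f x := by
  have key := apply_eq_cv_antipodeInv_iff
    ((precompOp (k := k) M N).comp ((Algebra.lsmul k k M).comp (Smash.inclH k A H)))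
    (cu _) (HomA.postAct M N).toLinearMap (HomA.toLin f)
  have e1 : ((MulOpposite.opLinearEquiv k).symm.toLinearMap ∘ₗ
      ((precompOp (k := k) M N).comp ((Algebra.lsmul k k M).comp
        (Smash.inclH k A H))).toLinearMap ∘ₗ antipodeInv k H) = (HomA.preAct M N).toLinearMap := rfl
  rw [e1, cv_cu] at key
  simp only [← HomA.linAct_eq_cv] at key
  have e2 : f ∈ invariants k H (HomA M N) ↔
      ∀ h, (cu (Module.End k (M →ₗ[k] N)) : H →ₗ[k] _) h (HomA.toLin f) =
        HomA.linAct M N h (HomA.toLin f) := by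
    refine forall_congr' fun h => ?_
    constructor
    · intro h1
      ext x
      have h2 := congrArg (fun g : HomA M N => g x) h1
      simp only [HomA.algebraMap_smul_apply] at h2
      exact h2.symm
    · intro h1
      ext x
      rw [HomA.algebraMap_smul_apply]
      exact (LinearMap.congr_fun h1 x).symm
  rw [e2, key]
  refine forall_congr' fun h => ?_
  rw [LinearMap.ext_iff]
  exact forall_congr' fun x => eq_comm

/-- A map of `A # H`-modules as an element of `Hom_A(M, N)`. -/
def HomA.ofHom (f : M ⟶ N) : HomA M N := ((resA k A H).map f).hom

theorem HomA.ofHom_mem_invariants (f : M ⟶ N) : HomA.ofHom f ∈ invariants k H (HomA M N) :=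
  (mem_invariants_homA_iff _).2 fun _ x => f.hom.map_smul _ x

theorem HomA.exists_ofHom_eq {f : HomA M N} (hf : f ∈ invariants k H (HomA M N)) :
    ∃ g : M ⟶ N, HomA.ofHom g = f :=
  ⟨ModuleCat.ofHom (linearMapOfCommute (f : M →+ N) (HomA.map_inclA_smul f)
    ((mem_invariants_homA_iff f).1 hf)), rfl⟩

theorem isCofibrant_iff (M : ModuleCat.{u} (Smash k A H)) :
    IsCofibrant M ↔ LiftsAgainstInjectiveKernels M := by
  constructor
  · intro hM X Y f hf hK g
    obtain ⟨g', hg', h⟩ := hM f hf ((isQuasiIso_iff_of_surjective f hf).2 hK)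
      (HomA.ofHom_mem_invariants g)
    obtain ⟨g', rfl⟩ := HomA.exists_ofHom_eq hg'
    refine ⟨g', ?_⟩
    ext x
    exact congrArg (fun t : HomA M Y => t x) h
  · intro hM X Y f hf hq g hg
    obtain ⟨g, rfl⟩ := HomA.exists_ofHom_eq hg
    obtain ⟨g', rfl⟩ := hM f hf ((isQuasiIso_iff_of_surjective f hf).1 hq) g
    exact ⟨HomA.ofHom g', HomA.ofHom_mem_invariants g', rfl⟩

end Cofibrant

end Hopfological

end

noncomputable section

namespace Hopfological

/-! ### The modules `A ⊗ V` -/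

section TensorMod

variable {k A H : Type u} [Field k] [Ring H] [HopfAlgebra k H] [Ring A] [Algebra k A]
  [Module H A] [IsModuleAlgebra k H A]

attribute [local instance] ModuleCat.moduleOfAlgebraModule
  ModuleCat.isScalarTower_of_algebra_moduleCat

/-- An `H`-linear map into an `A # H`-module is `k`-linear. -/
def toLinH {V : ModuleCat.{u} H} {X : ModuleCat.{u} (Smash k A H)}
    (g : V →ₗ[H] (resH k A H).obj X) : V →ₗ[k] X where
  toFun v := (show X from g v)
  map_add' v w := g.map_add v w
  map_smul' c v := by
    have h1 : g (algebraMap k H c • v) = _ := g.map_smul (algebraMap k H c) v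
    rw [algebraMap_smul] at h1
    refine h1.trans ?_
    change Smash.inclH k A H (algebraMap k H c) • (show X from g v) = _
    rw [AlgHom.commutes, algebraMap_smul]
    rfl

/-- The pure tensors of `A ⊗ V`. -/
def tensorMod.tmul {V : ModuleCat.{u} H} (a : A) (v : V) : tensorMod k A V :=
  (a ⊗ₜ[k] v : A ⊗[k] V)

theorem tensorMod.inclA_smul_tmul {V : ModuleCat.{u} H} (a b : A) (v : V) :
    Smash.inclA k A H a • tensorMod.tmul (k := k) b v = tensorMod.tmul (a * b) v := by
  change pairAct (leftAct k A V) (diagAct k H A V) (a ⊗ₜ[k] 1) (b ⊗ₜ[k] v) = _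
  rw [pairAct_tmul, map_one, mul_one]
  rfl

theorem tensorMod.inclA_smul {V : ModuleCat.{u} H} (a : A) (t : tensorMod k A V) :
    Smash.inclA k A H a • t = (show tensorMod k A V from a • (show A ⊗[k] V from t)) := by
  change pairAct (leftAct k A V) (diagAct k H A V) (a ⊗ₜ[k] 1) _ = _
  rw [pairAct_tmul, map_one, mul_one]
  rfl

theorem tensorMod.inclH_smul_tmul {V : ModuleCat.{u} H} (h : H) (b : A) (v : V) :
    Smash.inclH k A H h • tensorMod.tmul (k := k) b v =
      ∑ i ∈ (ℛ k h).index, tensorMod.tmul ((ℛ k h).left i • b) ((ℛ k h).right i • v) := by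
  change pairAct (leftAct k A V) (diagAct k H A V) (1 ⊗ₜ[k] h) (b ⊗ₜ[k] v) = _
  rw [pairAct_tmul, map_one, one_mul, diagAct_tmul]
  rfl

@[elab_as_elim]
theorem tensorMod.induction_on {V : ModuleCat.{u} H} {p : tensorMod k A V → Prop}
    (t : tensorMod k A V) (zero : p 0) (tmul : ∀ a v, p (tensorMod.tmul a v))
    (add : ∀ x y, p x → p y → p (x + y)) : p t :=
  TensorProduct.induction_on (motive := p) t zero tmul add

/-- The inclusion `v ↦ 1 ⊗ v` of `V` into `A ⊗ V`. -/
def tensorMod.unit (V : ModuleCat.{u} H) : V →ₗ[H] (resH k A H).obj (tensorMod k A V) where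
  toFun v := tensorMod.tmul 1 v
  map_add' v w := TensorProduct.tmul_add _ _ _
  map_smul' h v := by
    refine Eq.trans ?_ (tensorMod.inclH_smul_tmul h 1 v).symm
    have h1 : ∀ i, (tensorMod.tmul ((ℛ k h).left i • (1 : A)) ((ℛ k h).right i • v) :
        tensorMod k A V) =
        ((1 : A) ⊗ₜ[k] ((counit (R := k) ((ℛ k h).left i) • (ℛ k h).right i) • v) : A ⊗[k] V) := by
      intro i
      rw [smul_assoc, tensorMod.tmul, IsModuleAlgebra.smul_one (k := k),
        Algebra.algebraMap_eq_smul_one, TensorProduct.smul_tmul]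
    rw [Finset.sum_congr rfl fun i _ => h1 i]
    refine Eq.trans ?_ (TensorProduct.tmul_sum (R := k) (1 : A) _ _)
    rw [← Finset.sum_smul, Coalgebra.sum_counit_smul]
    rfl

/-- An `H`-linear map `g : V → X` into an `A # H`-module induces the map `a ⊗ v ↦ a g(v)` of
`A # H`-modules. -/
def tensorMod.lift {V : ModuleCat.{u} H} {X : ModuleCat.{u} (Smash k A H)}
    (g : V →ₗ[H] (resH k A H).obj X) : tensorMod k A V →ₗ[Smash k A H] X :=
  let G₀ : A ⊗[k] V →ₗ[k] X := TensorProduct.lift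
    ((Algebra.lsmul k k X).toLinearMap.compl₁₂ (Smash.inclA k A H).toLinearMap (toLinH g))
  let G : tensorMod k A V →+ X :=
    { toFun := G₀
      map_zero' := map_zero G₀
      map_add' := map_add G₀ }
  have hG : ∀ a v, G (tensorMod.tmul a v) = Smash.inclA k A H a • toLinH g v := fun _ _ => rfl
  linearMapOfCommute G
    (fun a t => by
      induction t using tensorMod.induction_on with
      | zero => rw [smul_zero, map_zero, smul_zero]
      | tmul b v => rw [tensorMod.inclA_smul_tmul, hG, hG, map_mul, mul_smul]
      | add x y hx hy => rw [smul_add, map_add, map_add, hx, hy, smul_add])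
    (fun h t => by
      induction t using tensorMod.induction_on with
      | zero => rw [smul_zero, map_zero, smul_zero]
      | tmul b v =>
        rw [tensorMod.inclH_smul_tmul, map_sum, hG, ← mul_smul, Smash.inclH_mul_inclA,
          Finset.sum_smul]
        refine Finset.sum_congr rfl fun i _ => ?_
        rw [hG, mul_smul]
        exact congrArg _ (g.map_smul ((ℛ k h).right i) v)
      | add x y hx hy => rw [smul_add, map_add, map_add, hx, hy, smul_add])

theorem tensorMod.lift_tmul {V : ModuleCat.{u} H} {X : ModuleCat.{u} (Smash k A H)}
    (g : V →ₗ[H] (resH k A H).obj X) (a : A) (v : V) :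
    tensorMod.lift g (tensorMod.tmul a v) = Smash.inclA k A H a • (show X from g v) := rfl

theorem tensorMod.lift_unit {V : ModuleCat.{u} H} {X : ModuleCat.{u} (Smash k A H)}
    (g : V →ₗ[H] (resH k A H).obj X) (v : V) :
    tensorMod.lift g (tensorMod.tmul 1 v) = (show X from g v) := by
  rw [tensorMod.lift_tmul, map_one, one_smul]

theorem tensorMod.hom_ext {V : ModuleCat.{u} H} {X : Type*} [AddCommGroup X]
    [Module (Smash k A H) X] {f g : tensorMod k A V →ₗ[Smash k A H] X}
    (h : ∀ v, f (tensorMod.tmul 1 v) = g (tensorMod.tmul 1 v)) : f = g := by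
  ext t
  induction t using tensorMod.induction_on with
  | zero => rw [map_zero, map_zero]
  | tmul a v =>
    have : (tensorMod.tmul a v : tensorMod k A V) =
        Smash.inclA k A H a • tensorMod.tmul (k := k) 1 v := by
      rw [tensorMod.inclA_smul_tmul, mul_one]
    rw [this, map_smul, map_smul, h]
  | add x y hx hy => rw [map_add, map_add, hx, hy]

/-- The map `A ⊗ V → A ⊗ W` induced by an `H`-linear map `V → W`. -/
def tensorMod.map {V W : ModuleCat.{u} H} (f : V →ₗ[H] W) :
    tensorMod k A V →ₗ[Smash k A H] tensorMod k A W :=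
  tensorMod.lift (tensorMod.unit W ∘ₗ f)

theorem tensorMod.map_apply {V W : ModuleCat.{u} H} (f : V →ₗ[H] W) (t : tensorMod k A V) :
    tensorMod.map f t =
      (show tensorMod k A W from (f.restrictScalars k).lTensor A (show A ⊗[k] V from t)) := by
  induction t using tensorMod.induction_on with
  | zero => exact (map_zero _).trans (map_zero ((f.restrictScalars k).lTensor A)).symm
  | tmul a v =>
    refine (tensorMod.lift_tmul _ a v).trans ?_
    refine (tensorMod.inclA_smul_tmul a 1 (f v)).trans ?_
    rw [mul_one]
    rfl
  | add x y hx hy =>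
    rw [map_add, hx, hy]
    exact (map_add ((f.restrictScalars k).lTensor A) _ _).symm

theorem tensorMod.map_injective {V W : ModuleCat.{u} H} (f : V →ₗ[H] W)
    (hf : Function.Injective f) : Function.Injective (tensorMod.map (k := k) (A := A) f) := by
  have h := Module.Flat.lTensor_preserves_injective_linearMap (M := A) (f.restrictScalars k) hf
  intro x y hxy
  rw [tensorMod.map_apply, tensorMod.map_apply] at hxy
  exact h hxy

theorem tensorMod.map_surjective {V W : ModuleCat.{u} H} (f : V →ₗ[H] W)
    (hf : Function.Surjective f) : Function.Surjective (tensorMod.map (k := k) (A := A) f) := by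
  have h := LinearMap.lTensor_surjective A (g := f.restrictScalars k) hf
  intro y
  obtain ⟨x, hx⟩ := h y
  exact ⟨x, (tensorMod.map_apply f x).trans hx⟩

theorem tensorMod.map_exact {V W U : ModuleCat.{u} H} (f : V →ₗ[H] W) (g : W →ₗ[H] U)
    (hg : Function.Surjective g) (h : Function.Exact f g) :
    Function.Exact (tensorMod.map (k := k) (A := A) f) (tensorMod.map (k := k) (A := A) g) := by
  have := lTensor_exact A (f := f.restrictScalars k) (g := g.restrictScalars k) h hg
  intro y
  rw [tensorMod.map_apply]
  exact (this y).trans ⟨fun ⟨x, hx⟩ => ⟨x, (tensorMod.map_apply f x).trans hx⟩,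
    fun ⟨x, hx⟩ => ⟨x, (tensorMod.map_apply f x).symm.trans hx⟩⟩

variable (k) in
/-- `A ⊗ V` is projective over `A`, being the base change of a vector space. -/
theorem projective_resA_tensorMod (V : ModuleCat.{u} H) :
    Module.Projective A ((resA k A H).obj (tensorMod k A V)) := by
  let e : A ⊗[k] V ≃ₗ[A] (resA k A H).obj (tensorMod k A V) :=
    { AddEquiv.refl (A ⊗[k] V) with
      map_smul' := fun a t => (tensorMod.inclA_smul a t).symm }
  exact Module.Projective.of_equiv e

theorem projective_resA_directSum {I : Type u} (V : I → ModuleCat.{u} H) :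
    Module.Projective A ((resA k A H).obj
      (ModuleCat.of (Smash k A H) (DirectSum I fun i => tensorMod k A (V i)))) := by
  have := fun i => projective_resA_tensorMod (A := A) k (V i)
  let e : (DirectSum I fun i => (resA k A H).obj (tensorMod k A (V i))) ≃ₗ[A]
      (resA k A H).obj (ModuleCat.of (Smash k A H) (DirectSum I fun i => tensorMod k A (V i))) :=
    { AddEquiv.refl (DirectSum I fun i => tensorMod k A (V i)) with
      map_smul' := fun a t => by
        refine DFinsupp.ext fun i => ?_
        rfl }
  exact Module.Projective.of_equiv e

/-- A surjection onto a direct sum of modules `A ⊗ V` splits if its kernel is injective over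
`H`. -/
theorem exists_section_directSum {I : Type u} (V : I → ModuleCat.{u} H)
    {X : ModuleCat.{u} (Smash k A H)}
    (f : X ⟶ ModuleCat.of (Smash k A H) (DirectSum I fun i => tensorMod k A (V i)))
    (hf : Function.Surjective f)
    (hK : IsInjectiveOverH (ModuleCat.of (Smash k A H) (LinearMap.ker f.hom))) :
    ∃ s : (DirectSum I fun i => tensorMod k A (V i)) →ₗ[Smash k A H] X, ∀ z, f.hom (s z) = z := by
  classical
  have := (injective_ker_res_iff f).2 hK
  obtain ⟨s, -, hs, -⟩ := exists_section_of_injective_ker ((resH k A H).map f).hom hf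
  let g : ∀ i, V i →ₗ[H] (resH k A H).obj X := fun i =>
    s ∘ₗ ((resH k A H).map (ModuleCat.ofHom (DirectSum.lof (Smash k A H) I
      (fun i => (tensorMod k A (V i) : Type u)) i))).hom ∘ₗ tensorMod.unit (V i)
  refine ⟨DirectSum.toModule _ _ _ fun i => tensorMod.lift (g i), fun z => ?_⟩
  have : f.hom ∘ₗ DirectSum.toModule _ _ _ (fun i => tensorMod.lift (g i)) = LinearMap.id := by
    refine DirectSum.linearMap_ext _ fun i => tensorMod.hom_ext fun v => ?_
    simp only [LinearMap.comp_apply, DirectSum.toModule_lof, LinearMap.id_apply,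
      tensorMod.lift_unit]
    exact hs _
  exact LinearMap.congr_fun this z

end TensorMod

end Hopfological

end

noncomputable section

namespace Hopfological

/-! ### Sections over filtered modules -/

section Filtration

variable {R : Type*} [Ring R] {X P : Type u} [AddCommGroup X] [Module R X] [AddCommGroup P]
  [Module R P] (f : X →ₗ[R] P)

/-- Let `f : X → P` be a surjection and let `C` be the image of a section of `f` over `F`. If
surjections onto `F' / F ≅ Z` whose kernel is isomorphic to that of `f` split, then the section
extends to `F'`: the kernel of `f⁻¹(F') / C → F' / F` is isomorphic to that of `f`. -/
theorem exists_extend_complement (hf : Function.Surjective f) {F F' : Submodule R P} (hF : F ≤ F')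
    {C : Submodule R X} (hC : C ⊓ LinearMap.ker f = ⊥) (hCF : C.map f = F)
    {Z : Type*} [AddCommGroup Z] [Module R Z] (π : F' →ₗ[R] Z) (hπ : Function.Surjective π)
    (hker : ∀ x : F', π x = 0 ↔ (x : P) ∈ F)
    (hZ : ∀ (Y : Type u) [AddCommGroup Y] [Module R Y] (g : Y →ₗ[R] Z), Function.Surjective g →
      Nonempty (LinearMap.ker f ≃ₗ[R] LinearMap.ker g) → ∃ s : Z →ₗ[R] Y, ∀ z, g (s z) = z) :
    ∃ C' : Submodule R X, C ≤ C' ∧ C' ⊓ LinearMap.ker f = ⊥ ∧ C'.map f = F' := by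
  have hC0 : ∀ x ∈ C, f x = 0 → x = 0 := fun x h1 h2 =>
    (Submodule.mem_bot R).1 (hC ▸ Submodule.mem_inf.2 ⟨h1, h2⟩)
  let X' := F'.comap f
  have hCX : C ≤ X' := fun x hx => hF (hCF ▸ Submodule.mem_map_of_mem hx)
  let f' : X' →ₗ[R] F' := f.restrict fun x hx => hx
  have hf' : ∀ x : X', ((f' x : F') : P) = f x := fun x => rfl
  let g : (X' ⧸ C.submoduleOf X') →ₗ[R] Z := (C.submoduleOf X').liftQ (π ∘ₗ f') fun x hx =>
    (hker _).2 (hCF ▸ Submodule.mem_map_of_mem (Submodule.mem_comap.1 hx))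
  have hg : ∀ x : X', g ((C.submoduleOf X').mkQ x) = π (f' x) := fun x => rfl
  have hgs : Function.Surjective g := fun z => by
    obtain ⟨y, rfl⟩ := hπ z
    obtain ⟨x, hx⟩ := hf y
    refine ⟨(C.submoduleOf X').mkQ ⟨x, show f x ∈ F' from hx ▸ y.2⟩, ?_⟩
    rw [hg]
    exact congrArg π (Subtype.ext hx)
  let j : LinearMap.ker f →ₗ[R] LinearMap.ker g :=
    ((C.submoduleOf X').mkQ ∘ₗ Submodule.inclusion (fun x (hx : f x = 0) =>
      show f x ∈ F' from hx ▸ F'.zero_mem)).codRestrict _ fun x => by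
        rw [LinearMap.mem_ker, LinearMap.comp_apply, hg, hker, hf']
        have hx : f x = 0 := x.2
        exact (congrArg (· ∈ F) hx).mpr F.zero_mem
  have hj : Function.Bijective j := by
    constructor
    · rw [injective_iff_map_eq_zero]
      intro x hx
      have h1 : (C.submoduleOf X').mkQ ⟨x.1, _⟩ = 0 := congrArg Subtype.val hx
      rw [Submodule.mkQ_apply, Submodule.Quotient.mk_eq_zero] at h1
      exact Subtype.ext (hC0 x h1 x.2)
    · rintro ⟨y, hy⟩
      obtain ⟨x, rfl⟩ := (C.submoduleOf X').mkQ_surjective y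
      rw [LinearMap.mem_ker, hg, hker, hf', ← hCF] at hy
      obtain ⟨c, hc, hcx⟩ := hy
      refine ⟨⟨x - c, by rw [LinearMap.mem_ker, map_sub, hcx, sub_self]⟩, Subtype.ext ?_⟩
      change (C.submoduleOf X').mkQ ⟨x - c, _⟩ = _
      rw [← sub_eq_zero, ← map_sub, Submodule.mkQ_apply, Submodule.Quotient.mk_eq_zero]
      change (x : X) - c - x ∈ C
      rw [sub_right_comm, sub_self, zero_sub]
      exact C.neg_mem hc
  obtain ⟨s, hs⟩ := hZ _ g hgs ⟨LinearEquiv.ofBijective j hj⟩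
  have hmem : ∀ x : X',
      (x : X) ∈ ((LinearMap.range s).comap (C.submoduleOf X').mkQ).map X'.subtype ↔
      (C.submoduleOf X').mkQ x ∈ LinearMap.range s := fun x =>
    ⟨fun ⟨y, hy, hyx⟩ => by rwa [← show y = x from Subtype.ext hyx], fun hx => ⟨x, hx, rfl⟩⟩
  refine ⟨((LinearMap.range s).comap (C.submoduleOf X').mkQ).map X'.subtype, fun x hx => ?_, ?_, ?_⟩
  · rw [hmem ⟨x, hCX hx⟩, Submodule.mkQ_apply,
      (Submodule.Quotient.mk_eq_zero (C.submoduleOf X')).2 (show x ∈ C from hx)]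
    exact Submodule.zero_mem _
  · rw [eq_bot_iff]
    rintro _ ⟨⟨x, ⟨z, hz⟩, rfl⟩, hx⟩
    change f x = 0 at hx
    have h1 := hg x
    rw [← hz, hs, (hker _).2 (show f x ∈ F from hx ▸ F.zero_mem)] at h1
    rw [h1, map_zero, eq_comm, Submodule.mkQ_apply, Submodule.Quotient.mk_eq_zero] at hz
    exact hC0 x hz hx
  · ext y
    constructor
    · rintro ⟨_, ⟨x, -, rfl⟩, rfl⟩
      exact x.2
    · intro hy
      obtain ⟨x, hx⟩ := (C.submoduleOf X').mkQ_surjective (s (π ⟨y, hy⟩))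
      have h1 : π (f' x) = π ⟨y, hy⟩ := by rw [← hg, hx, hs]
      have h2 : y - f x ∈ F := (hker (⟨y, hy⟩ - f' x)).1 (by rw [map_sub, h1, sub_self])
      rw [← hCF] at h2
      obtain ⟨c, hc, hcy⟩ := h2
      refine ⟨x + c, (hmem (x + ⟨c, hCX hc⟩)).2 ?_, by rw [map_add, hcy, add_sub_cancel]⟩
      rw [map_add, hx, Submodule.mkQ_apply (C.submoduleOf X') ⟨c, hCX hc⟩,
        (Submodule.Quotient.mk_eq_zero (C.submoduleOf X')).2 (show c ∈ C from hc), add_zero]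
      exact LinearMap.mem_range_self _ _

/-- A section over the union of an increasing sequence of submodules, built step by step. -/
theorem exists_section_of_complements (F : ℕ → Submodule R P) (hF : ∀ x, ∃ r, x ∈ F r)
    (h0 : ∃ C : Submodule R X, C ⊓ LinearMap.ker f = ⊥ ∧ C.map f = F 0)
    (h1 : ∀ (r : ℕ) (C : Submodule R X), C ⊓ LinearMap.ker f = ⊥ → C.map f = F r →
      ∃ C' : Submodule R X, C ≤ C' ∧ C' ⊓ LinearMap.ker f = ⊥ ∧ C'.map f = F (r + 1)) :
    ∃ s : P →ₗ[R] X, ∀ x, f (s x) = x := by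
  choose T hT1 hT2 hT3 using h1
  obtain ⟨C₀, hC₀, hC₀'⟩ := h0
  let D : ∀ r : ℕ, {C : Submodule R X // C ⊓ LinearMap.ker f = ⊥ ∧ C.map f = F r} :=
    fun r => Nat.rec ⟨C₀, hC₀, hC₀'⟩
      (fun r C => ⟨T r C.1 C.2.1 C.2.2, hT2 r C.1 C.2.1 C.2.2, hT3 r C.1 C.2.1 C.2.2⟩) r
  have hmono : Monotone fun r => (D r).1 := monotone_nat_of_le_succ fun r => hT1 r _ _ _
  let C := ⨆ r, (D r).1
  have hmem : ∀ x, x ∈ C ↔ ∃ r, x ∈ (D r).1 := fun x =>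
    Submodule.mem_iSup_of_directed _ hmono.directed_le
  have hbij : Function.Bijective (f.domRestrict C) := by
    constructor
    · rw [injective_iff_map_eq_zero]
      rintro ⟨x, hx⟩ hx0
      obtain ⟨r, hr⟩ := (hmem x).1 hx
      exact Subtype.ext ((Submodule.mem_bot R).1 ((D r).2.1 ▸ Submodule.mem_inf.2 ⟨hr, hx0⟩))
    · intro y
      obtain ⟨r, hr⟩ := hF y
      rw [← (D r).2.2] at hr
      obtain ⟨x, hx, rfl⟩ := hr
      exact ⟨⟨x, (hmem x).2 ⟨r, hx⟩⟩, rfl⟩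
  exact ⟨C.subtype ∘ₗ (LinearEquiv.ofBijective _ hbij).symm.toLinearMap,
    fun x => (LinearEquiv.ofBijective _ hbij).apply_symm_apply x⟩

end Filtration

/-! ### Modules with property (P) -/

section PropertyP

variable {k A H : Type u} [Field k] [Ring H] [HopfAlgebra k H] [Ring A] [Algebra k A]
  [Module H A] [IsModuleAlgebra k H A]

attribute [local instance] ModuleCat.moduleOfAlgebraModule
  ModuleCat.isScalarTower_of_algebra_moduleCat

theorem IsInjectiveOverH.of_equiv {X Y : ModuleCat.{u} (Smash k A H)} (hX : IsInjectiveOverH X)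
    (e : X ≃ₗ[Smash k A H] Y) : IsInjectiveOverH Y :=
  injective_of_retract ((resH k A H).map (ModuleCat.ofHom e.symm.toLinearMap)).hom
    ((resH k A H).map (ModuleCat.ofHom e.toLinearMap)).hom fun x => e.apply_symm_apply x

/-- If the surjections onto `M` whose kernel is injective over `H` split, then pulling back yields
the lifting property of `M`. -/
theorem liftsAgainstInjectiveKernels_of_section {M : ModuleCat.{u} (Smash k A H)}
    (hM : ∀ (X : ModuleCat.{u} (Smash k A H)) (f : X ⟶ M), Function.Surjective f →
      IsInjectiveOverH (ModuleCat.of (Smash k A H) (LinearMap.ker f.hom)) →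
      ∃ s : M →ₗ[Smash k A H] X, ∀ x, f.hom (s x) = x) :
    LiftsAgainstInjectiveKernels M := by
  intro X Y f hf hK g
  let E := LinearMap.eqLocus (f.hom ∘ₗ LinearMap.fst _ X M) (g.hom ∘ₗ LinearMap.snd _ X M)
  have hE : ∀ x : E, f.hom x.1.1 = g.hom x.1.2 := fun x => x.2
  let p : E →ₗ[Smash k A H] M := LinearMap.snd _ X M ∘ₗ E.subtype
  have hp : Function.Surjective p := fun y => by
    obtain ⟨x, hx⟩ := hf (g.hom y)
    exact ⟨⟨(x, y), hx⟩, rfl⟩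
  let e : LinearMap.ker f.hom ≃ₗ[Smash k A H] LinearMap.ker p :=
    { toFun := fun x => ⟨⟨(x.1, 0), show f.hom x.1 = g.hom 0 by rw [x.2, map_zero]⟩, rfl⟩
      invFun := fun x => ⟨x.1.1.1, show f.hom x.1.1.1 = 0 by
        rw [hE, show x.1.1.2 = 0 from x.2, map_zero]⟩
      left_inv := fun x => rfl
      right_inv := fun x => Subtype.ext (Subtype.ext (Prod.ext rfl
        (show (0 : M) = x.1.1.2 from (show x.1.1.2 = 0 from x.2).symm)))
      map_add' := fun x y => Subtype.ext (Subtype.ext (Prod.ext rfl (add_zero (0 : M)).symm))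
      map_smul' := fun b x => Subtype.ext (Subtype.ext (Prod.ext rfl
        (smul_zero (A := M) b).symm)) }
  obtain ⟨s, hs⟩ := hM (ModuleCat.of _ E) (ModuleCat.ofHom p) hp
    (IsInjectiveOverH.of_equiv hK e)
  refine ⟨ModuleCat.ofHom (LinearMap.fst _ X M ∘ₗ E.subtype ∘ₗ s), ?_⟩
  ext x
  refine (hE (s x)).trans ?_
  exact congrArg g.hom (hs x)

/-- A filtered module has the lifting property: surjections onto the direct sums of modules `A ⊗ V`
with kernel injective over `H` split, so a section extends from each step to the next. -/
theorem IsPropertyPFiltered.liftsAgainstInjectiveKernels {P : ModuleCat.{u} (Smash k A H)}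
    (hP : IsPropertyPFiltered P) : LiftsAgainstInjectiveKernels P := by
  obtain ⟨F, hF, hex, -, ⟨I, V, -, ⟨e⟩⟩, hq⟩ := hP
  refine liftsAgainstInjectiveKernels_of_section fun X f hf hK => ?_
  have hZ : ∀ {I : Type u} (V : I → ModuleCat.{u} H) (Y : Type u) [AddCommGroup Y]
      [Module (Smash k A H) Y] (g : Y →ₗ[Smash k A H] DirectSum I fun i => tensorMod k A (V i)),
      Function.Surjective g →
      Nonempty (LinearMap.ker f.hom ≃ₗ[Smash k A H] LinearMap.ker g) →
      ∃ s : (DirectSum I fun i => tensorMod k A (V i)) →ₗ[Smash k A H] Y, ∀ z, g (s z) = z :=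
    fun V Y _ _ g hg ⟨e⟩ => exists_section_directSum V (X := ModuleCat.of _ Y)
      (ModuleCat.ofHom g) hg (hK.of_equiv e)
  refine exists_section_of_complements f.hom F hex ?_ fun r C hC hCF => ?_
  · obtain ⟨C, -, h⟩ := exists_extend_complement f.hom hf (bot_le (a := F 0)) (bot_inf_eq _)
      (Submodule.map_bot _) e.toLinearMap e.surjective (fun x => by
        rw [Submodule.mem_bot, ZeroMemClass.coe_eq_zero]
        exact e.map_eq_zero_iff) (hZ V)
    exact ⟨C, h⟩
  · obtain ⟨I, V, -, ⟨e⟩⟩ := hq r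
    exact exists_extend_complement f.hom hf (hF r) hC hCF
      (e.toLinearMap ∘ₗ ((F r).submoduleOf (F (r + 1))).mkQ)
      (e.surjective.comp (Submodule.mkQ_surjective _)) (fun x =>
        e.map_eq_zero_iff.trans (Submodule.Quotient.mk_eq_zero _)) (hZ V)

/-- A submodule of an `A # H`-module, as a submodule of its restriction to `A`. -/
def submoduleResA {P : ModuleCat.{u} (Smash k A H)} (F : Submodule (Smash k A H) P) :
    Submodule A ((resA k A H).obj P) where
  carrier := {x | (show P from x) ∈ F}
  add_mem' := F.add_mem
  zero_mem' := F.zero_mem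
  smul_mem' a _ hx := F.smul_mem (Smash.inclA k A H a) hx

/-- A map of `A # H`-modules defined on a submodule, as an `A`-linear map. -/
def mapResA {P Z : ModuleCat.{u} (Smash k A H)} {F : Submodule (Smash k A H) P}
    (π : F →ₗ[Smash k A H] Z) : submoduleResA F →ₗ[A] (resA k A H).obj Z where
  toFun x := π (show F from ⟨x.1, x.2⟩)
  map_add' _ _ := π.map_add _ _
  map_smul' a x := π.map_smul (Smash.inclA k A H a) (show F from ⟨x.1, x.2⟩)

/-- A filtered module is projective over `A`, because the subquotients of the filtration are. -/
theorem IsPropertyPFiltered.projective_resA {P : ModuleCat.{u} (Smash k A H)}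
    (hP : IsPropertyPFiltered P) : Module.Projective A ((resA k A H).obj P) := by
  obtain ⟨F, hF, hex, -, ⟨I, V, -, ⟨e⟩⟩, hq⟩ := hP
  refine Module.Projective.of_lifting_property'' fun f hf => ?_
  have hZ : ∀ {I : Type u} (V : I → ModuleCat.{u} H) (Y : Type u) [AddCommGroup Y]
      [Module A Y] (g : Y →ₗ[A] (resA k A H).obj
        (ModuleCat.of (Smash k A H) (DirectSum I fun i => tensorMod k A (V i)))),
      Function.Surjective g → Nonempty (LinearMap.ker f ≃ₗ[A] LinearMap.ker g) →
      ∃ s : (resA k A H).obj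
        (ModuleCat.of (Smash k A H) (DirectSum I fun i => tensorMod k A (V i))) →ₗ[A] Y,
        ∀ z, g (s z) = z := fun V Y _ _ g hg _ => by
    have := projective_resA_directSum (k := k) (A := A) V
    obtain ⟨s, hs⟩ := Module.projective_lifting_property g LinearMap.id hg
    exact ⟨s, LinearMap.congr_fun hs⟩
  suffices h : ∃ s : (resA k A H).obj P →ₗ[A] (((resA k A H).obj P) →₀ A), ∀ x, f (s x) = x by
    obtain ⟨s, hs⟩ := h
    exact ⟨s, LinearMap.ext hs⟩
  refine exists_section_of_complements f (fun r => submoduleResA (F r)) hex ?_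
    fun r C hC hCF => ?_
  · obtain ⟨C, -, h⟩ := exists_extend_complement f hf (bot_le (a := submoduleResA (F 0)))
      (bot_inf_eq _) (Submodule.map_bot _)
      (mapResA (Z := ModuleCat.of _ (DirectSum I fun i => tensorMod k A (V i))) e.toLinearMap)
      (fun z => by
        obtain ⟨x, hx⟩ := e.surjective z
        exact ⟨⟨x.1, x.2⟩, hx⟩) (fun x => by
        rw [Submodule.mem_bot, ZeroMemClass.coe_eq_zero]
        refine (e.map_eq_zero_iff (x := ⟨x.1, x.2⟩)).trans ?_
        exact ⟨fun h => Subtype.ext (congrArg Subtype.val h),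
          fun h => Subtype.ext (congrArg Subtype.val h)⟩) (hZ V)
    exact ⟨C, h⟩
  · obtain ⟨I, V, -, ⟨e⟩⟩ := hq r
    exact exists_extend_complement f hf (F' := submoduleResA (F (r + 1))) (hF r) hC hCF
      (mapResA (Z := ModuleCat.of _ (DirectSum I fun i => tensorMod k A (V i)))
        (e.toLinearMap ∘ₗ ((F r).submoduleOf (F (r + 1))).mkQ))
      (fun z => by
        obtain ⟨x, hx⟩ := (e.surjective.comp (Submodule.mkQ_surjective _)) z
        exact ⟨⟨x.1, x.2⟩, hx⟩) (fun x =>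
        e.map_eq_zero_iff.trans
          (Submodule.Quotient.mk_eq_zero (x := (⟨x.1, x.2⟩ : F (r + 1))) _)) (hZ V)

end PropertyP

end Hopfological

end

noncomputable section

namespace Hopfological

/-! ### Attaching cells -/

section Pushout

variable {R : Type*} [Ring R]

/-- The pushout of an injection `i : S → T` with cokernel `p : T → Z` along `φ : S → X`, together
with a map to `M`. -/
theorem exists_pushout {S T Z X M : Type u} [AddCommGroup S] [Module R S] [AddCommGroup T]
    [Module R T] [AddCommGroup Z] [Module R Z] [AddCommGroup X] [Module R X] [AddCommGroup M]
    [Module R M] (i : S →ₗ[R] T) (hi : Function.Injective i) (p : T →ₗ[R] Z)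
    (hp : Function.Surjective p) (hip : Function.Exact i p) (φ : S →ₗ[R] X) (f : X →ₗ[R] M)
    (g : T →ₗ[R] M) (hfg : f ∘ₗ φ = g ∘ₗ i) :
    ∃ (Q : ModuleCat.{u} R) (j : X →ₗ[R] Q) (q : T →ₗ[R] Q) (f' : Q →ₗ[R] M) (π : Q →ₗ[R] Z),
      (∀ s, j (φ s) = q (i s)) ∧ (∀ x, f' (j x) = f x) ∧ (∀ t, f' (q t) = g t) ∧
      Function.Injective j ∧ Function.Surjective π ∧ ∀ y, π y = 0 ↔ y ∈ LinearMap.range j := by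
  let N := LinearMap.range (φ.prod (-i))
  have hN : ∀ x t, N.mkQ (x, t) = 0 ↔ ∃ s, φ s = x ∧ -i s = t := fun x t => by
    rw [Submodule.mkQ_apply, Submodule.Quotient.mk_eq_zero]
    exact exists_congr fun s => Prod.mk_inj
  have hpi : ∀ s, p (i s) = 0 := fun s => (hip _).2 ⟨s, rfl⟩
  have hjq : ∀ s, N.mkQ (φ s, 0) = N.mkQ (0, i s) := fun s => by
    rw [← sub_eq_zero, ← map_sub, Prod.mk_sub_mk, hN]
    exact ⟨s, by simp, by simp⟩
  refine ⟨ModuleCat.of R ((X × T) ⧸ N), N.mkQ ∘ₗ LinearMap.inl R X T, N.mkQ ∘ₗ LinearMap.inr R X T,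
    N.liftQ (f.coprod g) ?_, N.liftQ (p ∘ₗ LinearMap.snd R X T) ?_, hjq, fun x => ?_, fun t => ?_,
    ?_, fun z => ?_, fun y => ?_⟩
  · rintro _ ⟨s, rfl⟩
    have := LinearMap.congr_fun hfg s
    simp only [LinearMap.comp_apply] at this
    simp [this]
  · rintro _ ⟨s, rfl⟩
    simp [hpi]
  · exact (Submodule.liftQ_apply _ _ _).trans (by simp)
  · exact (Submodule.liftQ_apply _ _ _).trans (by simp)
  · rw [injective_iff_map_eq_zero]
    intro x hx
    obtain ⟨s, rfl, hs⟩ := (hN x 0).1 hx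
    rw [neg_eq_zero] at hs
    rw [hi (hs.trans (map_zero i).symm), map_zero]
  · obtain ⟨t, rfl⟩ := hp z
    exact ⟨N.mkQ (0, t), rfl⟩
  · obtain ⟨⟨x, t⟩, rfl⟩ := N.mkQ_surjective y
    constructor
    · intro h
      obtain ⟨s, rfl⟩ := (hip t).1 h
      refine ⟨x + φ s, ?_⟩
      change N.mkQ (x + φ s, 0) = _
      have h1 : ((x + φ s, 0) : X × T) = (x, 0) + (φ s, 0) := by simp
      rw [h1, map_add, hjq, ← map_add]
      simp
    · rintro ⟨x', hx'⟩
      rw [← hx']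
      exact map_zero p

end Pushout

section Cells

variable {k A H : Type u} [Field k] [Ring H] [HopfAlgebra k H] [Ring A] [Algebra k A]
  [Module H A] [IsModuleAlgebra k H A]

attribute [local instance] ModuleCat.moduleOfAlgebraModule
  ModuleCat.isScalarTower_of_algebra_moduleCat

/-- For a map `f : X → M` of `A # H`-modules, all the lifting problems
```
  J → X
  ↓   ↓
  H → M
```
of `H`-modules with `J` a maximal left ideal are solved in an extension `X'` of `X` over `M`, where
`X' / X` is a direct sum of modules `A ⊗ (H / J)`: the pushout along `⨁ A ⊗ J → ⨁ A ⊗ H`. -/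
theorem exists_attach_cells {X M : ModuleCat.{u} (Smash k A H)} (f : X ⟶ M) :
    ∃ (X' : ModuleCat.{u} (Smash k A H)) (j : X ⟶ X') (f' : X' ⟶ M) (I : Type u)
      (V : I → ModuleCat.{u} H)
      (π : X' →ₗ[Smash k A H] DirectSum I fun i => tensorMod k A (V i)),
      j ≫ f' = f ∧ Function.Injective j.hom ∧ (∀ i, Indecomposable (V i)) ∧
      Function.Surjective π ∧ (∀ y, π y = 0 ↔ y ∈ LinearMap.range j.hom) ∧
      ∀ (J : Ideal H), IsCoatom J → ∀ (φ : J →ₗ[H] (resH k A H).obj X) (c : M),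
        (∀ a : J, f.hom (φ a) = Smash.inclH k A H a.1 • c) →
        ∃ c' : X', f'.hom c' = c ∧ ∀ a : J, j.hom (φ a) = Smash.inclH k A H a.1 • c' := by
  classical
  let I := {t : Σ J : Ideal H, (J →ₗ[H] (resH k A H).obj X) × M //
    IsCoatom t.1 ∧ ∀ a : t.1, f.hom (t.2.1 a) = Smash.inclH k A H a.1 • t.2.2}
  let VS : I → ModuleCat.{u} H := fun t => ModuleCat.of H t.1.1
  let VT : I → ModuleCat.{u} H := fun _ => ModuleCat.of H H
  let VZ : I → ModuleCat.{u} H := fun t => ModuleCat.of H (H ⧸ t.1.1)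
  let i₀ : ∀ t : I, VS t →ₗ[H] VT t := fun t => t.1.1.subtype
  let p₀ : ∀ t : I, VT t →ₗ[H] VZ t := fun t => t.1.1.mkQ
  have h₀ : ∀ t : I, Function.Exact (i₀ t) (p₀ t) := fun t =>
    LinearMap.exact_subtype_mkQ t.1.1
  let i := DirectSum.lmap fun t => tensorMod.map (k := k) (A := A) (i₀ t)
  let p := DirectSum.lmap fun t => tensorMod.map (k := k) (A := A) (p₀ t)
  have hi : Function.Injective i := (DirectSum.lmap_injective _).2 fun t =>
    tensorMod.map_injective _ (Submodule.injective_subtype _)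
  have hp : Function.Surjective p := (DirectSum.lmap_surjective _).2 fun t =>
    tensorMod.map_surjective _ (Submodule.mkQ_surjective _)
  have hip : Function.Exact i p := by
    rw [LinearMap.exact_iff, DirectSum.ker_lmap, DirectSum.range_lmap]
    exact congrArg (fun N => (Submodule.pi Set.univ N).comap _) (funext fun t =>
      LinearMap.exact_iff.1 (tensorMod.map_exact _ _ (Submodule.mkQ_surjective _) (h₀ t)))
  let φ : (DirectSum I fun t => tensorMod k A (VS t)) →ₗ[Smash k A H] X :=
    DirectSum.toModule _ _ _ fun t => tensorMod.lift t.1.2.1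
  let g₀ : ∀ t : I, VT t →ₗ[H] (resH k A H).obj M := fun t =>
    LinearMap.toSpanSingleton H ((resH k A H).obj M) t.1.2.2
  let g : (DirectSum I fun t => tensorMod k A (VT t)) →ₗ[Smash k A H] M :=
    DirectSum.toModule _ _ _ fun t => tensorMod.lift (g₀ t)
  have hmap : ∀ (t : I) (a : t.1.1), tensorMod.map (k := k) (A := A) (i₀ t) (tensorMod.tmul 1 a) =
      tensorMod.tmul 1 (a : H) := fun t a => tensorMod.lift_unit _ _
  have hfg : f.hom ∘ₗ φ = g ∘ₗ i := by
    refine DirectSum.linearMap_ext _ fun t => tensorMod.hom_ext fun a => ?_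
    simp only [LinearMap.comp_apply, φ, g, i, DirectSum.lmap_lof, DirectSum.toModule_lof, hmap,
      tensorMod.lift_unit]
    exact t.2.2 a
  obtain ⟨Q, j, q, f', π, h1, h2, h3, h4, h5, h6⟩ := exists_pushout i hi p hp hip φ f.hom g hfg
  refine ⟨Q, ModuleCat.ofHom j, ModuleCat.ofHom f', I, VZ, π, ?_, h4, fun t => ?_, h5, h6,
    fun J hJ φ' c hc => ?_⟩
  · ext x
    exact h2 x
  · have : IsSimpleModule H (H ⧸ t.1.1) := isSimpleModule_iff_isCoatom.2 t.2.1
    have : Simple (VZ t) := simple_of_isSimpleModule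
    exact indecomposable_of_simple _
  · let t : I := ⟨⟨J, φ', c⟩, hJ, hc⟩
    refine ⟨q (DirectSum.lof (Smash k A H) I (fun t => (tensorMod k A (VT t) : Type u)) t
      (tensorMod.tmul 1 (1 : H))), ?_, fun a => ?_⟩
    · refine (h3 _).trans ?_
      simp only [g, DirectSum.toModule_lof]
      rw [tensorMod.lift_unit]
      exact one_smul H (show (resH k A H).obj M from c)
    · have e1 := h1 (DirectSum.lof (Smash k A H) I (fun t => (tensorMod k A (VS t) : Type u)) t
        (tensorMod.tmul 1 a))
      simp only [φ, i, DirectSum.toModule_lof, DirectSum.lmap_lof] at e1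
      rw [tensorMod.lift_unit, hmap t a] at e1
      refine e1.trans ?_
      rw [← map_smul, ← map_smul]
      refine congrArg (fun y => q (DirectSum.lof (Smash k A H) I
        (fun t => (tensorMod k A (VT t) : Type u)) t y)) ?_
      have e2 := (tensorMod.unit (k := k) (A := A) (VT t)).map_smul (a : H) (1 : H)
      rw [smul_eq_mul, mul_one] at e2
      exact e2

end Cells

end Hopfological

end

noncomputable section

namespace Hopfological

/-! ### Lifting problems over an artinian ring -/

section Devissage

variable {R : Type*} [Ring R]

/-- If `J' / J` is simple and `x ∈ J'` is not in `J`, then the annihilator of `x` modulo `J` is a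
maximal left ideal. -/
theorem isCoatom_comap_toSpanSingleton {J J' : Ideal R}
    (hmin : ∀ K, J < K → ¬ K < J') {x : R} (hx : x ∈ J') (hxJ : x ∉ J) (hJ : J ≤ J') :
    IsCoatom (Submodule.comap (LinearMap.toSpanSingleton R R x) J) := by
  have hmem : ∀ r, r ∈ Submodule.comap (LinearMap.toSpanSingleton R R x) J ↔ r * x ∈ J :=
    fun r => Iff.rfl
  constructor
  · intro h
    have h1 := (hmem 1).1 (h ▸ Submodule.mem_top)
    rw [one_mul] at h1
    exact hxJ h1
  · intro L hL
    obtain ⟨n, hn, hnx⟩ := SetLike.exists_of_lt hL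
    have h1 : J < J ⊔ Submodule.span R {n * x} := by
      refine lt_of_le_of_ne le_sup_left fun h => hnx ((hmem n).2 ?_)
      rw [h]
      exact Submodule.mem_sup_right (Submodule.mem_span_singleton_self _)
    have h2 : J ⊔ Submodule.span R {n * x} ≤ J' := sup_le hJ
      ((Submodule.span_singleton_le_iff_mem _ _).2 (J'.smul_mem n hx))
    have h3 : x ∈ J ⊔ Submodule.span R {n * x} := by
      rw [h2.eq_of_not_lt (hmin _ h1)]
      exact hx
    obtain ⟨a, ha, b, hb, hab⟩ := Submodule.mem_sup.1 h3
    obtain ⟨r, rfl⟩ := Submodule.mem_span_singleton.1 hb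
    have h4 : 1 - r * n ∈ L := hL.le ((hmem _).2 (by
      rw [sub_mul, one_mul, mul_assoc, ← smul_eq_mul r]
      nth_rewrite 1 [← hab]
      rwa [add_sub_cancel_right]))
    rw [Ideal.eq_top_iff_one, ← sub_add_cancel 1 (r * n)]
    exact L.add_mem h4 (L.smul_mem r hn)

/-- If a linear map `f` has the right lifting property against the inclusions `J → R` of maximal
left ideals, it has it against the inclusions of all left ideals, by induction along the simple
subquotients of `R`. -/
theorem exists_lift_of_isCoatom [IsNoetherianRing R] [IsArtinianRing R] {P M : Type*}
    [AddCommGroup P] [Module R P] [AddCommGroup M] [Module R M] (f : P →ₗ[R] M)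
    (h : ∀ (J : Ideal R), IsCoatom J → ∀ (φ : J →ₗ[R] P) (c : M), (∀ a : J, f (φ a) = a.1 • c) →
      ∃ p, f p = c ∧ ∀ a : J, φ a = a.1 • p)
    (J : Ideal R) (φ : J →ₗ[R] P) (c : M) (hc : ∀ a : J, f (φ a) = a.1 • c) :
    ∃ p, f p = c ∧ ∀ a : J, φ a = a.1 • p := by
  induction J using IsNoetherian.induction with
  | hgt J ih =>
  by_cases hJ : J = ⊤
  · subst hJ
    refine ⟨φ ⟨1, trivial⟩, by rw [hc, one_smul], fun a => ?_⟩
    rw [← map_smul]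
    exact congrArg φ (Subtype.ext (mul_one _).symm)
  -- for `x` generating a simple submodule of `R / J`, the map extends to `J + R x`: its value `q`
  -- at `x` solves a lifting problem for the maximal left ideal of the `r` with `r x ∈ J`
  obtain ⟨J', hJJ', hmin⟩ :=
    wellFounded_lt.has_min {K : Ideal R | J < K} ⟨⊤, lt_top_iff_ne_top.2 hJ⟩
  obtain ⟨x, hx, hxJ⟩ := SetLike.exists_of_lt (show J < J' from hJJ')
  have hcoatom := isCoatom_comap_toSpanSingleton hmin hx hxJ (le_of_lt hJJ')
  obtain ⟨q, hq1, hq2⟩ := h _ hcoatom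
    (φ ∘ₗ (LinearMap.toSpanSingleton R R x).restrict fun r hr => hr) (x • c) fun a => by
      rw [LinearMap.comp_apply, hc, ← mul_smul]
      rfl
  have hq3 : ∀ (r : R) (hr : r * x ∈ J), φ ⟨r * x, hr⟩ = r • q := fun r hr => hq2 ⟨r, hr⟩
  let u₀ : J × R →ₗ[R] R := J.subtype.coprod (LinearMap.toSpanSingleton R R x)
  have hu₀ : ∀ j r, u₀ (j, r) = j + r * x := fun j r => by simp [u₀]
  obtain ⟨φ', hφ'⟩ := exists_comp_eq_of_ker_le u₀.rangeRestrict u₀.surjective_rangeRestrict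
    (φ.coprod (LinearMap.toSpanSingleton R P q)) (by
      rintro ⟨j, r⟩ hjr
      rw [LinearMap.ker_rangeRestrict, LinearMap.mem_ker, hu₀] at hjr
      have h1 : r * x = -(j : R) := eq_neg_of_add_eq_zero_right hjr
      have h2 : r * x ∈ J := h1 ▸ J.neg_mem j.2
      rw [LinearMap.mem_ker, LinearMap.coprod_apply, LinearMap.toSpanSingleton_apply, ← hq3 r h2,
        ← map_add]
      exact (congrArg φ (Subtype.ext hjr)).trans (map_zero φ))
  have hφ'' : ∀ j r, φ' (u₀.rangeRestrict (j, r)) = φ j + r • q := fun j r => by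
    rw [← LinearMap.comp_apply, hφ']
    simp
  obtain ⟨p, hp1, hp2⟩ := ih (LinearMap.range u₀) (by
    refine lt_of_le_of_ne (fun j hj => ⟨(⟨j, hj⟩, 0), by simp [hu₀]⟩) fun h => hxJ ?_
    rw [h]
    exact ⟨(0, 1), by simp [hu₀]⟩) φ' (by
    rintro ⟨_, ⟨j, r⟩, rfl⟩
    refine (congrArg f (hφ'' j r)).trans ?_
    rw [map_add, hc, map_smul, hq1]
    change _ = u₀ (j, r) • c
    rw [hu₀, add_smul, mul_smul])
  refine ⟨p, hp1, fun j => ?_⟩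
  have h1 := hφ'' j 0
  rw [zero_smul, add_zero, hp2] at h1
  rw [← h1]
  change u₀ (j, 0) • p = _
  rw [hu₀, zero_mul, add_zero]

theorem surjective_of_lift_isCoatom [IsNoetherianRing R] [IsArtinianRing R] {P M : Type*}
    [AddCommGroup P] [Module R P] [AddCommGroup M] [Module R M] (f : P →ₗ[R] M)
    (h : ∀ (J : Ideal R), IsCoatom J → ∀ (φ : J →ₗ[R] P) (c : M), (∀ a : J, f (φ a) = a.1 • c) →
      ∃ p, f p = c ∧ ∀ a : J, φ a = a.1 • p) : Function.Surjective f := fun c => by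
  obtain ⟨p, hp, -⟩ := exists_lift_of_isCoatom f h ⊥ 0 c (by
    rintro ⟨a, ha⟩
    simp [(Submodule.mem_bot R).1 ha])
  exact ⟨p, hp⟩

theorem injective_ker_of_lift_isCoatom [IsNoetherianRing R] [IsArtinianRing R] {P M : Type*}
    [AddCommGroup P] [Module R P] [AddCommGroup M] [Module R M] (f : P →ₗ[R] M)
    (h : ∀ (J : Ideal R), IsCoatom J → ∀ (φ : J →ₗ[R] P) (c : M), (∀ a : J, f (φ a) = a.1 • c) →
      ∃ p, f p = c ∧ ∀ a : J, φ a = a.1 • p) : Module.Injective R (LinearMap.ker f) :=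
  Module.Baer.injective fun J g => by
    obtain ⟨p, hp, hg⟩ := exists_lift_of_isCoatom f h J ((LinearMap.ker f).subtype ∘ₗ g) 0
      (fun a => by rw [smul_zero]; exact (g a).2)
    exact ⟨LinearMap.toSpanSingleton R _ ⟨p, hp⟩, fun x hx => Subtype.ext (hg ⟨x, hx⟩).symm⟩

end Devissage

/-! ### Unions of sequences of modules -/

section Union

variable {R : Type u} [Ring R]

/-- The union `N` of a sequence of injections over `M`, as a filtered colimit. -/
theorem exists_union {X : ℕ → ModuleCat.{u} R} (j : ∀ n, X n ⟶ X (n + 1))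
    (hj : ∀ n, Function.Injective (j n)) {M : ModuleCat.{u} R} (f : ∀ n, X n ⟶ M)
    (hf : ∀ n, j n ≫ f (n + 1) = f n) :
    ∃ (N : ModuleCat.{u} R) (ι : ∀ n, X n ⟶ N) (g : N ⟶ M), (∀ n, j n ≫ ι (n + 1) = ι n) ∧
      (∀ n, Function.Injective (ι n)) ∧ (∀ x : N, ∃ n, ∃ y : X n, ι n y = x) ∧
      ∀ n, ι n ≫ g = f n := by
  have : Limits.PreservesFilteredColimitsOfSize.{0, 0} (forget (ModuleCat.{u} R)) :=
    Limits.preservesSmallestFilteredColimits_of_preservesFilteredColimits.{u, u} _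
  let F := Functor.ofSequence j
  have hF : ∀ d n, Function.Injective (F.map (homOfLE (Nat.le_add_right n d))) := by
    intro d n
    induction d with
    | zero =>
      have : homOfLE (Nat.le_add_right n 0) = 𝟙 n := Subsingleton.elim _ _
      rw [this, CategoryTheory.Functor.map_id]
      exact Function.injective_id
    | succ d ih =>
      have : homOfLE (Nat.le_add_right n (d + 1)) =
        homOfLE (Nat.le_add_right n d) ≫ homOfLE (Nat.le_add_right (n + d) 1) :=
        Subsingleton.elim _ _
      rw [this, Functor.map_comp, Functor.ofSequence_map_homOfLE_succ]
      exact (hj _).comp ih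
  let t : F ⟶ (Functor.const ℕ).obj M := NatTrans.ofSequence f fun n => by
    rw [Functor.ofSequence_map_homOfLE_succ]
    exact (hf n).trans (Category.comp_id _).symm
  refine ⟨Limits.colimit F, fun n => Limits.colimit.ι F n, Limits.colimit.desc F ⟨M, t⟩,
    fun n => ?_, fun n x y hxy => ?_, fun x => Limits.Concrete.colimit_exists_rep F x,
    fun n => Limits.colimit.ι_desc _ _⟩
  · rw [← Functor.ofSequence_map_homOfLE_succ j n]
    exact Limits.colimit.w F _
  · obtain ⟨m, a, b, hab⟩ := (Limits.Concrete.colimit_rep_eq_iff_exists F x y).1 hxy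
    obtain ⟨d, rfl⟩ := Nat.exists_eq_add_of_le (leOfHom a)
    rw [Subsingleton.elim a (homOfLE (Nat.le_add_right n d)),
      Subsingleton.elim b (homOfLE (Nat.le_add_right n d))] at hab
    exact hF d n hab

end Union

/-! ### Resolutions by modules with property (P) -/

section Resolution

variable {k A H : Type u} [Field k] [Ring H] [HopfAlgebra k H] [Ring A] [Algebra k A]
  [Module H A] [IsModuleAlgebra k H A]

attribute [local instance] ModuleCat.moduleOfAlgebraModule
  ModuleCat.isScalarTower_of_algebra_moduleCat

/-- The union of a sequence of injections has a filtration as in property (P) if the sequence begins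
with `0` and the cokernels are direct sums of modules `A ⊗ V` with `V` indecomposable. -/
theorem isPropertyPFiltered_of_union {X : ℕ → ModuleCat.{u} (Smash k A H)}
    (j : ∀ n, X n ⟶ X (n + 1)) {I : ℕ → Type u} (V : ∀ n, I n → ModuleCat.{u} H)
    (hV : ∀ n i, Indecomposable (V n i))
    (π : ∀ n, X (n + 1) →ₗ[Smash k A H] DirectSum (I n) fun i => tensorMod k A (V n i))
    (hπ : ∀ n, Function.Surjective (π n))
    (hker : ∀ n y, π n y = 0 ↔ y ∈ LinearMap.range (j n).hom) (h0 : Subsingleton (X 0))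
    {N : ModuleCat.{u} (Smash k A H)} (ι : ∀ n, X n ⟶ N) (hι : ∀ n, j n ≫ ι (n + 1) = ι n)
    (hinj : ∀ n, Function.Injective (ι n)) (hex : ∀ x : N, ∃ n, ∃ y : X n, ι n y = x) :
    IsPropertyPFiltered N := by
  have hι' : ∀ n x, (ι (n + 1)).hom ((j n).hom x) = (ι n).hom x := fun n x =>
    LinearMap.congr_fun (congrArg ModuleCat.Hom.hom (hι n)) x
  let F : ℕ → Submodule (Smash k A H) N := fun n => LinearMap.range (ι n).hom
  have hF : ∀ n, F n ≤ F (n + 1) := by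
    rintro n _ ⟨y, rfl⟩
    exact ⟨(j n).hom y, hι' n y⟩
  let e : ∀ n, X n ≃ₗ[Smash k A H] F n := fun n => LinearEquiv.ofInjective (ι n).hom (hinj n)
  let p : ∀ n, F (n + 1) →ₗ[Smash k A H] DirectSum (I n) fun i => tensorMod k A (V n i) :=
    fun n => π n ∘ₗ (e (n + 1)).symm.toLinearMap
  have hp : ∀ n, Function.Surjective (p n) := fun n => (hπ n).comp (e (n + 1)).symm.surjective
  have hpker : ∀ n (x : F (n + 1)), p n x = 0 ↔ (x : N) ∈ F n := fun n x => by
    obtain ⟨y, rfl⟩ := (e (n + 1)).surjective x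
    have h1 : p n (e (n + 1) y) = π n y := congrArg (π n) ((e (n + 1)).symm_apply_apply y)
    rw [h1, hker]
    constructor
    · rintro ⟨z, rfl⟩
      exact ⟨z, (hι' n z).symm⟩
    · rintro ⟨z, hz⟩
      exact ⟨z, hinj (n + 1) ((hι' n z).trans hz)⟩
  refine ⟨F, hF, hex, fun r => ?_, ⟨PEmpty, fun i => i.elim, fun i => i.elim, ⟨?_⟩⟩,
    fun r => ⟨I r, V r, hV r, ⟨?_⟩⟩⟩
  -- the quotient of `F (r + 1)` by `F r` is projective over `A`, and `D` projects onto `F r`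
  · have := projective_resA_directSum (k := k) (A := A) (V r)
    let P := (resA k A H).map (ModuleCat.ofHom (p r))
    obtain ⟨σ, hσ⟩ := Module.projective_lifting_property P.hom LinearMap.id (hp r)
    have hσ' : ∀ z, p r (show F (r + 1) from σ z) = z := LinearMap.congr_fun hσ
    let D : (resA k A H).obj (ModuleCat.of (Smash k A H) (F (r + 1))) →ₗ[A]
        (resA k A H).obj (ModuleCat.of (Smash k A H) (F (r + 1))) := LinearMap.id - σ ∘ₗ P.hom
    have hD : ∀ x : F (r + 1), p r (show F (r + 1) from D x) = 0 := fun x => by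
      refine (map_sub (p r) x (show F (r + 1) from σ (p r x))).trans ?_
      exact (congrArg (p r x - ·) (hσ' (p r x))).trans (sub_self _)
    let s : HomA (ModuleCat.of (Smash k A H) (F (r + 1))) (ModuleCat.of (Smash k A H) (F r)) :=
      show (resA k A H).obj (ModuleCat.of (Smash k A H) (F (r + 1))) →ₗ[A]
        (resA k A H).obj (ModuleCat.of (Smash k A H) (F r)) from
      { toFun := fun x => (⟨(show F (r + 1) from D x).1, (hpker r _).1 (hD x)⟩ : F r)
        map_add' := fun x y => Subtype.ext (congrArg (fun t : F (r + 1) => (t : N)) (D.map_add x y))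
        map_smul' := fun a x => Subtype.ext
          (congrArg (fun t : F (r + 1) => (t : N)) (D.map_smul a x)) }
    refine ⟨s, fun x => Subtype.ext ?_⟩
    have h1 : p r (Submodule.inclusion (hF r) x) = 0 := (hpker r _).2 x.2
    change (x : N) - (show F (r + 1) from σ (p r (Submodule.inclusion (hF r) x))).1 = x
    rw [h1]
    have h2 : σ 0 = 0 := map_zero σ
    exact (congrArg (fun t : F (r + 1) => (x : N) - t.1) h2).trans (sub_zero _)
  · have h1 : Subsingleton (F 0) := (e 0).symm.injective.subsingleton
    exact 0
  · exact (Submodule.quotEquivOfEq _ _ (Submodule.ext fun x => (hpker r x).symm)).trans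
      ((p r).quotKerEquivOfSurjective (hp r))

variable [FiniteDimensional k H]

/-- Every `A # H`-module is the quotient of a module with property (P) by a submodule that is
injective over `H`. The small object argument solves the lifting problems against the maximal left
ideals of `H`; countably many steps suffice because the left ideals are finitely generated. -/
theorem exists_propertyP_resolution (M : ModuleCat.{u} (Smash k A H)) :
    ∃ (N : ModuleCat.{u} (Smash k A H)) (g : N ⟶ M), IsPropertyPFiltered N ∧
      Function.Surjective g ∧
      IsInjectiveOverH (ModuleCat.of (Smash k A H) (LinearMap.ker g.hom)) := by
  have : IsNoetherianRing H := isNoetherian_of_tower k inferInstance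
  have : IsArtinianRing H := isArtinian_of_tower k inferInstance
  choose T jT fT I V π h1 h2 h3 h4 h5 h6 using
    fun (X : ModuleCat.{u} (Smash k A H)) (f : X ⟶ M) => exists_attach_cells f
  let D : ℕ → Σ X : ModuleCat.{u} (Smash k A H), X ⟶ M := fun n =>
    Nat.rec ⟨ModuleCat.of (Smash k A H) PUnit.{u + 1}, 0⟩ (fun _ D => ⟨T D.1 D.2, fT D.1 D.2⟩) n
  obtain ⟨N, ι, g, hι, hinj, hex, hg⟩ := exists_union (X := fun n => (D n).1)
    (fun n => jT (D n).1 (D n).2) (fun n => h2 _ _) (fun n => (D n).2) (fun n => h1 _ _)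
  have hι' : ∀ n x, (ι (n + 1)).hom ((jT (D n).1 (D n).2).hom x) = (ι n).hom x := fun n x =>
    LinearMap.congr_fun (congrArg ModuleCat.Hom.hom (hι n)) x
  have hg' : ∀ n x, g.hom ((ι n).hom x) = (D n).2.hom x := fun n x =>
    LinearMap.congr_fun (congrArg ModuleCat.Hom.hom (hg n)) x
  have hlift : ∀ (J : Ideal H), IsCoatom J → ∀ (φ : J →ₗ[H] (resH k A H).obj N)
      (c : (resH k A H).obj M), (∀ a : J, ((resH k A H).map g).hom (φ a) = a.1 • c) →
      ∃ p, ((resH k A H).map g).hom p = c ∧ ∀ a : J, φ a = a.1 • p := by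
    intro J hJ φ c hc
    have hmono : ∀ m n (hmn : m ≤ n), LinearMap.range (ι m).hom ≤ LinearMap.range (ι n).hom :=
      fun m n hmn => monotone_nat_of_le_succ (f := fun n => LinearMap.range (ι n).hom) (by
        rintro n _ ⟨y, rfl⟩
        exact ⟨_, hι' n y⟩) hmn
    -- `J` is finitely generated, so `φ` takes values in a finite stage
    obtain ⟨n, hn⟩ : ∃ n, ∀ a : J, (show N from φ a) ∈ LinearMap.range (ι n).hom := by
      obtain ⟨S, hS⟩ := IsNoetherian.noetherian (⊤ : Submodule H J)
      choose d hd using fun a : J => hex (φ a)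
      refine ⟨S.sup d, fun a => ?_⟩
      have ha : a ∈ Submodule.span H (S : Set J) := hS ▸ Submodule.mem_top
      induction ha using Submodule.span_induction with
      | mem a ha =>
        obtain ⟨y, hy⟩ := hd a
        exact hmono _ _ (Finset.le_sup ha) ⟨y, hy⟩
      | zero => rw [map_zero]; exact Submodule.zero_mem _
      | add a b _ _ ha hb => rw [map_add]; exact Submodule.add_mem _ ha hb
      | smul h a _ ha =>
        rw [map_smul]
        exact Submodule.smul_mem _ (Smash.inclH k A H h) ha
    let ι' := ((resH k A H).map (ι n)).hom
    have hι'' : Function.Injective ι' := hinj n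
    let φ' : J →ₗ[H] (resH k A H).obj (D n).1 :=
      (LinearEquiv.ofInjective ι' hι'').symm.toLinearMap ∘ₗ φ.codRestrict _ hn
    have hφ' : ∀ a, (ι n).hom (show (D n).1 from φ' a) = φ a := fun a =>
      congrArg Subtype.val
        ((LinearEquiv.ofInjective ι' hι'').apply_symm_apply (φ.codRestrict _ hn a))
    obtain ⟨c', hc', hφc⟩ := h6 (D n).1 (D n).2 J hJ φ' c fun a => by
      refine (hg' n _).symm.trans ?_
      rw [hφ']
      exact hc a
    refine ⟨(ι (n + 1)).hom c', (hg' (n + 1) c').trans hc', fun a => ?_⟩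
    refine (hφ' a).symm.trans ((hι' n _).symm.trans ?_)
    rw [hφc]
    exact map_smul (ι (n + 1)).hom _ _
  refine ⟨N, g, isPropertyPFiltered_of_union _ (fun n => V (D n).1 (D n).2) (fun n => h3 _ _)
    (fun n => π (D n).1 (D n).2) (fun n => h4 _ _) (fun n => h5 _ _)
    (inferInstanceAs (Subsingleton PUnit)) ι hι hinj hex,
    surjective_of_lift_isCoatom ((resH k A H).map g).hom hlift, (injective_ker_res_iff g).1 ?_⟩
  exact injective_ker_of_lift_isCoatom _ hlift

end Resolution

end Hopfological

end

noncomputable section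

namespace Hopfological

/-! ### Balanced bilinear maps -/

section Balanced

variable {k H : Type u} {M W K : Type*} [Field k] [Ring H] [HopfAlgebra k H]
  [AddCommGroup M] [Module k M] [AddCommGroup W] [Module k W] [AddCommGroup K] [Module k K]

variable (k) in
/-- Postcomposition with endomorphisms, as an algebra homomorphism. -/
def postcompHom (M N : Type*) [AddCommGroup M] [Module k M] [AddCommGroup N] [Module k N] :
    Module.End k N →ₐ[k] Module.End k (M →ₗ[k] N) :=
  AlgHom.ofLinearMap (LinearMap.llcomp k M N N) rfl (fun _ _ => rfl)

variable (ρM : H →ₐ[k] Module.End k M) (ρW : H →ₐ[k] Module.End k W) (ρK : H →ₐ[k] Module.End k K)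
  (β : M →ₗ[k] W →ₗ[k] K)

/-- `h β(m, w) = β(h₁ m, h₂ w)` if and only if `β(h m, w) = h₁ β(m, S(h₂) w)`. -/
theorem balanced_iff_left :
    (∀ h m w, ρK h (β m w) =
      ∑ i ∈ (ℛ k h).index, β (ρM ((ℛ k h).left i) m) (ρW ((ℛ k h).right i) w)) ↔
    ∀ h m w, β (ρM h m) w = ∑ i ∈ (ℛ k h).index, ρK ((ℛ k h).left i)
      (β m (ρW (HopfAlgebra.antipode k ((ℛ k h).right i)) w)) := by
  have key := apply_eq_cv_antipode_iff
    ((AlgHom.op (postcompHom k M (W →ₗ[k] K))).comp ((precompOp W K).comp ρW))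
    ((precompOp M (W →ₗ[k] K)).comp ρM).toLinearMap
    ((MulOpposite.opLinearEquiv k).toLinearMap ∘ₗ
      ((postcompHom k M (W →ₗ[k] K)).comp ((postcompHom k W K).comp ρK)).toLinearMap) β
  simp only [cv_apply, Finset.unop_sum, LinearMap.ext_iff, LinearMap.sum_apply] at key
  exact key

/-- `h β(m, w) = β(h₁ m, h₂ w)` if and only if `β(m, h w) = h₂ β(S⁻¹(h₁) m, w)`. -/
theorem balanced_iff_right [FiniteDimensional k H] :
    (∀ h m w, ρK h (β m w) =
      ∑ i ∈ (ℛ k h).index, β (ρM ((ℛ k h).left i) m) (ρW ((ℛ k h).right i) w)) ↔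
    ∀ h m w, β m (ρW h w) = ∑ i ∈ (ℛ k h).index, ρK ((ℛ k h).right i)
      (β (ρM (antipodeInv k H ((ℛ k h).left i)) m) w) := by
  have key := apply_eq_cv_antipodeInv_iff ((precompOp M (W →ₗ[k] K)).comp ρM)
    ((MulOpposite.opLinearEquiv k).symm.toLinearMap ∘ₗ
      ((AlgHom.op (postcompHom k M (W →ₗ[k] K))).comp ((precompOp W K).comp ρW)).toLinearMap)
    ((postcompHom k M (W →ₗ[k] K)).comp ((postcompHom k W K).comp ρK)).toLinearMap β
  simp only [cv_apply, LinearMap.ext_iff, LinearMap.sum_apply] at key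
  exact key.symm

end Balanced

section Modules

variable {k A H : Type u} [Field k] [Ring H] [HopfAlgebra k H] [Ring A] [Algebra k A]
  [Module H A] [IsModuleAlgebra k H A]

attribute [local instance] ModuleCat.moduleOfAlgebraModule
  ModuleCat.isScalarTower_of_algebra_moduleCat

/-! ### Internal Hom modules -/

section InternalHom

variable (W : ModuleCat.{u} H) (K : ModuleCat.{u} (Smash k A H))

/-- The action of `A` on `Hom_k(W, K)` through `K`. -/
def internalActA : A →ₐ[k] Module.End k (W →ₗ[k] K) :=
  (postcompHom k W K).comp ((Algebra.lsmul k k K).comp (Smash.inclA k A H))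

/-- The operators `g ↦ (w ↦ h g(w))`. -/
def internalPost : H →ₐ[k] Module.End k (W →ₗ[k] K) :=
  (postcompHom k W K).comp ((Algebra.lsmul k k K).comp (Smash.inclH k A H))

/-- The operators `g ↦ (w ↦ g(S(h) w))`. -/
def internalPre : H →ₐ[k] Module.End k (W →ₗ[k] K) :=
  AlgHom.ofLinearMap ((MulOpposite.opLinearEquiv k).symm.toLinearMap ∘ₗ
      ((precompOp W K).comp (Algebra.lsmul k k W)).toLinearMap ∘ₗ HopfAlgebra.antipode k (A := H))
    (by simp)
    (fun x y => by simp [HopfAlgebra.antipode_mul_antidistrib])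

theorem internalPost_commute (x y : H) : Commute (internalPost W K x) (internalPre W K y) := by
  change internalPost W K x * internalPre W K y = internalPre W K y * internalPost W K x
  ext f z
  rfl

/-- The action `(h g)(w) = h₁ g(S(h₂) w)` of `H` on `Hom_k(W, K)`. -/
def internalActH : H →ₐ[k] Module.End k (W →ₗ[k] K) :=
  (Algebra.TensorProduct.lift (internalPost W K) (internalPre W K) (internalPost_commute W K)).comp
    (Bialgebra.comulAlgHom k H)

theorem internalActH_eq_cv (h : H) : internalActH W K h =
    cv (internalPost W K).toLinearMap (internalPre W K).toLinearMap h := by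
  rw [internalActH, cv_apply, AlgHom.comp_apply, Bialgebra.comulAlgHom_apply, ← (ℛ k h).eq,
    map_sum]
  rfl

theorem actsCompatibly_internal : ActsCompatibly (internalActA W K) (internalActH W K) := by
  intro h a
  have key := cv_mul_of_comm (R := Module.End k (W →ₗ[k] K))
    (X := (internalActA W K).toLinearMap ∘ₗ (LinearMap.toSpanSingleton H A a).restrictScalars k)
    (Y := (internalPost W K).toLinearMap) (Z := (internalPre W K).toLinearMap)
    (r := internalActA W K a) (fun h => by
      ext g w
      have e := congrArg (· • g w) (Smash.inclH_mul_inclA (k := k) h a)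
      simp only [mul_smul, Finset.sum_smul] at e
      simp only [cv_apply, LinearMap.sum_apply]
      exact e) (fun h => by
      ext g w
      rfl) h
  rw [← internalActH_eq_cv, cv_apply] at key
  simp only [← internalActH_eq_cv] at key
  exact key

/-- The `A # H`-module `Hom_k(W, K)`, with `(a g)(w) = a g(w)` and `(h g)(w) = h₁ g(S(h₂) w)`. The
functor `K ↦ Hom_k(W, K)` is right adjoint to `M ↦ M ⊗ W`. -/
def internalHom : ModuleCat.{u} (Smash k A H) :=
  letI : Module (Smash k A H) (W →ₗ[k] K) := Module.compHom (W →ₗ[k] K)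
    (Smash.lift (internalActA W K) (internalActH W K) (actsCompatibly_internal W K)).toRingHom
  ModuleCat.of (Smash k A H) (W →ₗ[k] K)

variable {W K}

/-- An element of `Hom_k(W, K)`, as a linear map. -/
def internalHom.toLin : internalHom W K ≃+ (W →ₗ[k] K) := AddEquiv.refl (W →ₗ[k] K)

theorem internalHom.inclA_smul_apply (a : A) (g : internalHom W K) (w : W) :
    toLin (Smash.inclA k A H a • g) w = Smash.inclA k A H a • toLin g w := by
  change pairAct (internalActA W K) (internalActH W K) (a ⊗ₜ[k] 1) (toLin g) w = _
  rw [pairAct_tmul, map_one, mul_one]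
  rfl

theorem internalHom.inclH_smul_apply (h : H) (g : internalHom W K) (w : W) :
    toLin (Smash.inclH k A H h • g) w = ∑ i ∈ (ℛ k h).index, Smash.inclH k A H ((ℛ k h).left i) •
      toLin g (HopfAlgebra.antipode k ((ℛ k h).right i) • w) := by
  change pairAct (internalActA W K) (internalActH W K) (1 ⊗ₜ[k] h) (toLin g) w = _
  rw [pairAct_tmul, map_one, one_mul, internalActH_eq_cv, cv_apply, LinearMap.sum_apply,
    LinearMap.sum_apply]
  rfl

theorem internalHom.toLin_smul (c : k) (g : internalHom W K) : toLin (c • g) = c • toLin g := by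
  ext w
  have h1 : c • g = Smash.inclA k A H (algebraMap k A c) • g := by
    rw [AlgHom.commutes, algebraMap_smul]
  rw [h1, internalHom.inclA_smul_apply, AlgHom.commutes, algebraMap_smul]
  rfl

/-- Restriction of linear maps along an `H`-linear map `W → W'`. -/
def internalHom.restrict {W' : ModuleCat.{u} H} (f : W →ₗ[H] W') :
    internalHom W' K →ₗ[Smash k A H] internalHom W K :=
  linearMapOfCommute
    { toFun := fun g : internalHom W' K => (toLin.symm (toLin g ∘ₗ f.restrictScalars k) :
        internalHom W K)
      map_zero' := rfl
      map_add' := fun _ _ => rfl }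
    (fun a g => toLin.injective (LinearMap.ext fun w => by
      rw [internalHom.inclA_smul_apply]
      exact internalHom.inclA_smul_apply a g (f w)))
    (fun h g => toLin.injective (LinearMap.ext fun w => by
      rw [internalHom.inclH_smul_apply]
      refine (internalHom.inclH_smul_apply h g (f w)).trans (Finset.sum_congr rfl fun i _ => ?_)
      rw [← f.map_smul]
      rfl))

theorem internalHom.restrict_apply {W' : ModuleCat.{u} H} (f : W →ₗ[H] W')
    (g : internalHom W' K) (w : W) : toLin (restrict f g) w = toLin g (f w) := rfl

theorem internalHom.restrict_surjective {W' : ModuleCat.{u} H} (f : W →ₗ[H] W')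
    (hf : Function.Injective f) :
    Function.Surjective (internalHom.restrict (K := K) f) := fun g => by
  obtain ⟨g', hg'⟩ := LinearMap.exists_leftInverse_of_injective (f.restrictScalars k)
    (LinearMap.ker_eq_bot.2 hf)
  refine ⟨toLin.symm (toLin g ∘ₗ g'), toLin.injective (LinearMap.ext fun w => ?_)⟩
  rw [internalHom.restrict_apply]
  exact congrArg (toLin g) (LinearMap.congr_fun hg' w)

end InternalHom

/-- The tensor product `X ⊗ W` of `H`-modules, with the diagonal action. -/
def diagMod (k : Type u) [Field k] {H : Type u} [Ring H] [HopfAlgebra k H]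
    (X W : ModuleCat.{u} H) : ModuleCat.{u} H :=
  letI : Module H (X ⊗[k] W) := Module.compHom (X ⊗[k] W) (diagAct k H X W).toRingHom
  ModuleCat.of H (X ⊗[k] W)

/-- The pure tensors of `X ⊗ W`. -/
def diagMod.tmul {X W : ModuleCat.{u} H} (x : X) (w : W) : diagMod k X W :=
  (x ⊗ₜ[k] w : X ⊗[k] W)

theorem diagMod.smul_tmul_eq {X W : ModuleCat.{u} H} (h : H) (x : X) (w : W) :
    h • diagMod.tmul (k := k) x w = ∑ i ∈ (ℛ k h).index,
      diagMod.tmul ((ℛ k h).left i • x) ((ℛ k h).right i • w) :=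
  diagAct_tmul k H X W h x w

theorem diagMod.algebraMap_smul {X W : ModuleCat.{u} H} (c : k) (t : diagMod k X W) :
    c • t = (show diagMod k X W from c • (show X ⊗[k] W from t)) := by
  change diagAct k H X W (algebraMap k H c) t = _
  rw [AlgHom.commutes]
  rfl

/-- A bilinear map with `h β(x, w) = β(h₁ x, h₂ w)`, as an `H`-linear map on `X ⊗ W`. -/
def diagMod.lift {X W : ModuleCat.{u} H} {K : ModuleCat.{u} (Smash k A H)} (β : X →ₗ[k] W →ₗ[k] K)
    (hβ : ∀ (h : H) x w, Smash.inclH k A H h • β x w =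
      ∑ i ∈ (ℛ k h).index, β ((ℛ k h).left i • x) ((ℛ k h).right i • w)) :
    diagMod k X W →ₗ[H] (resH k A H).obj K where
  toFun := TensorProduct.lift β
  map_add' := (TensorProduct.lift β).map_add
  map_smul' h t := by
    change TensorProduct.lift β (diagAct k H X W h t) =
      Smash.inclH k A H h • TensorProduct.lift β t
    induction t using TensorProduct.induction_on with
    | zero => simp
    | tmul x w => simp [diagAct_tmul, hβ]
    | add x y hx hy => rw [map_add, map_add, hx, hy, map_add, smul_add]

section Injectivity

variable {W : ModuleCat.{u} H} {K : ModuleCat.{u} (Smash k A H)}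

/-- `Hom_k(W, K)` is injective over `H` if `K` is: `H`-linear maps `X → Hom_k(W, K)` are
`H`-linear maps `X ⊗ W → K`. -/
theorem isInjectiveOverH_internalHom (hK : IsInjectiveOverH K) :
    IsInjectiveOverH (internalHom W K) := by
  suffices h : ∀ (X Y : ModuleCat.{u} H) (f : X →ₗ[H] Y), Function.Injective f →
      ∀ φ : X →ₗ[H] (resH k A H).obj (internalHom W K),
        ∃ ψ : Y →ₗ[H] (resH k A H).obj (internalHom W K), ∀ x, ψ (f x) = φ x from
    ⟨fun X Y _ _ _ _ f hf φ => h (ModuleCat.of H X) (ModuleCat.of H Y) f hf φ⟩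
  intro X Y f hf φ
  let ρK : H →ₐ[k] Module.End k K := (Algebra.lsmul k k K).comp (Smash.inclH k A H)
  let β : X →ₗ[k] W →ₗ[k] K :=
    { toFun := fun x => internalHom.toLin (toLinH φ x)
      map_add' := fun x y => by rw [map_add, map_add]
      map_smul' := fun c x => by rw [map_smul, internalHom.toLin_smul]; rfl }
  have hβ := (balanced_iff_left (Algebra.lsmul k k X) (Algebra.lsmul k k W) ρK β).2 fun h x w => by
    have h1 : φ (h • x) = Smash.inclH k A H h • (show internalHom W K from φ x) :=
      φ.map_smul h x
    exact (congrArg (fun t : internalHom W K => internalHom.toLin t w) h1).trans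
      (internalHom.inclH_smul_apply h _ w)
  let F₀ := (f.restrictScalars k).rTensor W
  let F : diagMod k X W →ₗ[H] diagMod k Y W :=
    { toFun := F₀
      map_add' := map_add F₀
      map_smul' := fun h t => by
        change F₀ (diagAct k H X W h t) = diagAct k H Y W h (F₀ t)
        induction t using TensorProduct.induction_on with
        | zero => simp
        | tmul x w => simp [diagAct_tmul, F₀]
        | add x y hx hy => rw [map_add, map_add, hx, hy, map_add, map_add] }
  have hF : Function.Injective F :=
    Module.Flat.rTensor_preserves_injective_linearMap (M := W) (f.restrictScalars k) hf
  obtain ⟨G, hG⟩ := Module.Injective.out F hF (diagMod.lift β hβ)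
  let β' : Y →ₗ[k] W →ₗ[k] K := LinearMap.mk₂ k
    (fun y w => toLinH G (diagMod.tmul y w))
    (fun y y' w => by rw [← map_add]; exact congrArg (toLinH G) (TensorProduct.add_tmul y y' w))
    (fun c y w => by rw [← map_smul, diagMod.algebraMap_smul]; rfl)
    (fun y w w' => by rw [← map_add]; exact congrArg (toLinH G) (TensorProduct.tmul_add y w w'))
    (fun c y w => by
      rw [← map_smul, diagMod.algebraMap_smul]
      exact congrArg (toLinH G) (TensorProduct.tmul_smul c y w))
  have hβ' := (balanced_iff_left (Algebra.lsmul k k Y) (Algebra.lsmul k k W) ρK β').1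
      fun h y w => by
    have h1 : G (h • diagMod.tmul y w) = Smash.inclH k A H h • toLinH G (diagMod.tmul y w) :=
      G.map_smul h _
    rw [diagMod.smul_tmul_eq] at h1
    refine h1.symm.trans ?_
    rw [map_sum]
    rfl
  let ψ : Y →ₗ[H] (resH k A H).obj (internalHom W K) :=
    { toFun := fun y => (internalHom.toLin.symm (β' y) : internalHom W K)
      map_add' := fun y y' => congrArg internalHom.toLin.symm (β'.map_add y y')
      map_smul' := fun h y => internalHom.toLin.injective (LinearMap.ext fun w =>
        (hβ' h y w).trans (internalHom.inclH_smul_apply h _ w).symm) }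
  exact ⟨ψ, fun x => internalHom.toLin.injective (LinearMap.ext fun w => hG (diagMod.tmul x w))⟩

end Injectivity

end Modules

end Hopfological

end

noncomputable section

namespace Hopfological

section Modules

variable {k A H : Type u} [Field k] [Ring H] [HopfAlgebra k H] [Ring A] [Algebra k A]
  [Module H A] [IsModuleAlgebra k H A]

attribute [local instance] ModuleCat.moduleOfAlgebraModule
  ModuleCat.isScalarTower_of_algebra_moduleCat

variable [FiniteDimensional k H]

/-! ### `Hom_A(M, K)` for cofibrant `M` and acyclic `K` -/

section HomA

variable {M K : ModuleCat.{u} (Smash k A H)} {W : ModuleCat.{u} H}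

/-- An `H`-linear map `W → Hom_A(M, K)` as a map `M → Hom_k(W, K)` of `A # H`-modules. -/
theorem exists_linearMap_internalHom (φ : W →ₗ[H] HomA M K) :
    ∃ ψ : M →ₗ[Smash k A H] internalHom W K, ∀ m w, internalHom.toLin (ψ m) w = φ w m := by
  have hφ : ∀ (c : k) w m, φ (c • w) m = c • φ w m := fun c w m => by
    rw [← algebraMap_smul H c w, map_smul, HomA.algebraMap_smul_apply]
  let β : M →ₗ[k] W →ₗ[k] K := LinearMap.mk₂ k (fun m w => φ w m)
    (fun m m' w => map_add (φ w) m m') (fun c m w => (HomA.toLin (φ w)).map_smul c m)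
    (fun m w w' => by rw [map_add, HomA.add_apply]) (fun c m w => hφ c w m)
  have hβ := (balanced_iff_left ((Algebra.lsmul k k M).comp (Smash.inclH k A H))
    (Algebra.lsmul k k W) ((Algebra.lsmul k k K).comp (Smash.inclH k A H)) β).1
    ((balanced_iff_right _ _ _ β).2 fun h m w =>
      (congrArg (fun t : HomA M K => t m) (φ.map_smul h w)).trans (HomA.smul_apply h (φ w) m))
  refine ⟨linearMapOfCommute
    { toFun := fun m => (internalHom.toLin.symm (β m) : internalHom W K)
      map_zero' := map_zero β
      map_add' := map_add β }
    (fun a m => internalHom.toLin.injective (LinearMap.ext fun w => ?_))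
    (fun h m => internalHom.toLin.injective (LinearMap.ext fun w => ?_)), fun m w => rfl⟩
  · rw [internalHom.inclA_smul_apply]
    exact HomA.map_inclA_smul (φ w) a m
  · rw [internalHom.inclH_smul_apply]
    exact hβ h m w

/-- A map `M → Hom_k(W, K)` of `A # H`-modules as an `H`-linear map `W → Hom_A(M, K)`. -/
theorem exists_linearMap_homA (ψ : M →ₗ[Smash k A H] internalHom W K) :
    ∃ φ : W →ₗ[H] HomA M K, ∀ m w, φ w m = internalHom.toLin (ψ m) w := by
  have hψ : ∀ (c : k) m, ψ (c • m) = c • ψ m := fun c m => by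
    rw [← algebraMap_smul (Smash k A H) c m, map_smul, algebraMap_smul]
  let β : M →ₗ[k] W →ₗ[k] K :=
    { toFun := fun m => internalHom.toLin (ψ m)
      map_add' := fun m m' => by rw [map_add, map_add]
      map_smul' := fun c m => by rw [hψ, internalHom.toLin_smul]; rfl }
  have hβ := (balanced_iff_right ((Algebra.lsmul k k M).comp (Smash.inclH k A H))
    (Algebra.lsmul k k W) ((Algebra.lsmul k k K).comp (Smash.inclH k A H)) β).1
    ((balanced_iff_left _ _ _ β).2 fun h m w =>
      (congrArg (fun t : internalHom W K => internalHom.toLin t w)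
        (ψ.map_smul (Smash.inclH k A H h) m)).trans (internalHom.inclH_smul_apply h _ w))
  let φ₀ : W → HomA M K := fun w => HomA.mk' (β.flip w) fun a m =>
    (congrArg (fun t : internalHom W K => internalHom.toLin t w)
      (ψ.map_smul (Smash.inclA k A H a) m)).trans (internalHom.inclA_smul_apply a _ w)
  have hφ₀ : ∀ w m, φ₀ w m = β m w := fun w m => rfl
  exact ⟨{ toFun := φ₀
           map_add' := fun w w' => HomA.ext fun m => map_add (β m) w w'
           map_smul' := fun h w => HomA.ext fun m =>
             (hβ h m w).trans (HomA.smul_apply h (φ₀ w) m).symm }, fun m w => rfl⟩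

/-- If `M` is cofibrant and `K` is injective over `H`, then so is `Hom_A(M, K)`. Extending an
`H`-linear map `W → Hom_A(M, K)` to `W' ⊇ W` amounts to lifting a map `M → Hom_k(W, K)` along the
surjection `Hom_k(W', K) → Hom_k(W, K)`, whose kernel is injective over `H`. -/
theorem LiftsAgainstInjectiveKernels.injective_homA (hM : LiftsAgainstInjectiveKernels M)
    (hK : IsInjectiveOverH K) : Module.Injective H (HomA M K) := by
  suffices h : ∀ (W W' : ModuleCat.{u} H) (f : W →ₗ[H] W'), Function.Injective f →
      ∀ φ : W →ₗ[H] HomA M K, ∃ φ' : W' →ₗ[H] HomA M K, ∀ w, φ' (f w) = φ w from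
    ⟨fun X Y _ _ _ _ f hf φ => h (ModuleCat.of H X) (ModuleCat.of H Y) f hf φ⟩
  intro W W' f hf φ
  obtain ⟨ψ, hψ⟩ := exists_linearMap_internalHom φ
  let ρ : internalHom W' K ⟶ internalHom W K :=
    ModuleCat.homEquiv.symm (internalHom.restrict f)
  have hρ : Function.Surjective ρ := internalHom.restrict_surjective f hf
  have hker : IsInjectiveOverH (ModuleCat.of (Smash k A H) (LinearMap.ker ρ.hom)) := by
    have h1 : IsInjectiveOverH (internalHom W K) := isInjectiveOverH_internalHom hK
    have h2 : IsInjectiveOverH (internalHom W' K) := isInjectiveOverH_internalHom hK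
    have h3 : Module.Projective H ((resH k A H).obj (internalHom W K)) :=
      projective_of_injective k
    obtain ⟨s, hs⟩ := Module.projective_lifting_property ((resH k A H).map ρ).hom LinearMap.id hρ
    exact (injective_ker_res_iff ρ).1
      (injective_ker_of_section ((resH k A H).map ρ).hom s (LinearMap.congr_fun hs))
  obtain ⟨ψ', hψ'⟩ := hM ρ hρ hker (ModuleCat.homEquiv.symm ψ)
  obtain ⟨φ', hφ'⟩ := exists_linearMap_homA ψ'.hom
  refine ⟨φ', fun w => HomA.ext fun m => ?_⟩
  rw [hφ', ← hψ]
  exact congrArg (fun t : internalHom W K => internalHom.toLin t w)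
    (LinearMap.congr_fun (congrArg ModuleCat.Hom.hom hψ') m)

/-- The `H`-linear map `Hom_A(P, M) → Hom_A(P, N)` induced by a map of `A # H`-modules. -/
def HomA.postcompLinear {M N : ModuleCat.{u} (Smash k A H)} (P : ModuleCat.{u} (Smash k A H))
    (f : M ⟶ N) : HomA P M →ₗ[H] HomA P N where
  toFun := HomA.postcomp P f
  map_add' g g' := HomA.ext fun x => map_add f.hom (g x) (g' x)
  map_smul' h g := HomA.ext fun x => by
    refine (congrArg f.hom (HomA.smul_apply h g x)).trans ?_
    rw [map_sum]
    refine Eq.trans ?_ (HomA.smul_apply h (HomA.postcomp P f g) x).symm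
    exact Finset.sum_congr rfl fun i _ => map_smul f.hom _ _

/-- If `M` is projective over `A` and `Hom_A(M, K)` is injective for the acyclic modules `K`, then
`M` has the lifting property of cofibrant modules. For `f : X → Y` with kernel `K`, a map
`M → Y` has an `A`-linear lift; an `H`-linear retraction of `Hom_A(M, X)` onto `Hom_A(M, K)`
corrects it to an `A # H`-linear one. -/
theorem liftsAgainstInjectiveKernels_of_injective_homA
    (hA : Module.Projective A ((resA k A H).obj M))
    (hM : ∀ K : ModuleCat.{u} (Smash k A H), IsInjectiveOverH K → Module.Injective H (HomA M K)) :
    LiftsAgainstInjectiveKernels M := by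
  intro X Y f hf hK g
  let i : ModuleCat.of (Smash k A H) (LinearMap.ker f.hom) ⟶ X :=
    ModuleCat.ofHom (LinearMap.ker f.hom).subtype
  let ι := HomA.postcompLinear M i
  have hfι : ∀ c x, f.hom (ι c x) = 0 := fun c x => (show LinearMap.ker f.hom from c x).2
  have hι : Function.Injective ι := fun c c' h => HomA.ext fun x => Subtype.ext
    (congrArg (fun t : HomA M X => t x) h)
  have hι' : ∀ d : HomA M X, (∀ x, f.hom (d x) = 0) → ∃ c, ι c = d := fun d hd =>
    ⟨show (resA k A H).obj M →ₗ[A] (resA k A H).obj _ from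
      { toFun := fun x => (⟨d x, hd x⟩ : LinearMap.ker f.hom)
        map_add' := fun x y => Subtype.ext (map_add d x y)
        map_smul' := fun a x => Subtype.ext (HomA.map_inclA_smul d a x) }, rfl⟩
  have := hM _ hK
  obtain ⟨r, hr⟩ := Module.Injective.out ι hι LinearMap.id
  obtain ⟨g₀, hg₀⟩ := Module.projective_lifting_property ((resA k A H).map f).hom
    ((resA k A H).map g).hom hf
  let g₁ : HomA M X := g₀
  have hg₁ : HomA.postcompLinear M f g₁ = HomA.ofHom g := hg₀
  -- `Φ` vanishes on the maps with values in the kernel, and `h g₁ - ε(h) g₁` is one of these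
  let Φ : HomA M X →ₗ[H] HomA M X := LinearMap.id - ι ∘ₗ r
  have hΦι : ∀ c, Φ (ι c) = 0 := fun c => by
    have h1 : r (ι c) = c := hr c
    simp [Φ, h1]
  have hΦ : Φ g₁ ∈ invariants k H (HomA M X) := fun h => by
    obtain ⟨c, hc⟩ := hι' (h • g₁ - algebraMap k H (counit h) • g₁) fun x => by
      have h1 : HomA.postcompLinear M f (h • g₁ - algebraMap k H (counit h) • g₁) = 0 := by
        rw [map_sub, map_smul, map_smul, hg₁, HomA.ofHom_mem_invariants g h, sub_self]
      exact congrArg (fun t : HomA M Y => t x) h1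
    rw [← sub_eq_zero, ← map_smul, ← map_smul, ← map_sub, ← hc, hΦι]
  obtain ⟨g', hg'⟩ := HomA.exists_ofHom_eq hΦ
  refine ⟨g', ?_⟩
  ext x
  have h1 : g'.hom x = g₁ x - ι (r g₁) x := congrArg (fun t : HomA M X => t x) hg'
  change f.hom (g'.hom x) = g.hom x
  rw [h1, map_sub, hfι, sub_zero]
  exact congrArg (fun t : HomA M Y => t x) hg₁

end HomA

/-! ### Direct summands of modules with property (P) -/

section Summand

variable {M N M' : ModuleCat.{u} (Smash k A H)}

omit [FiniteDimensional k H] in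
theorem LiftsAgainstInjectiveKernels.of_retract (hN : LiftsAgainstInjectiveKernels N)
    (i : M ⟶ N) (r : N ⟶ M) (h : i ≫ r = 𝟙 M) : LiftsAgainstInjectiveKernels M := by
  intro X Y f hf hK g
  obtain ⟨g', hg'⟩ := hN f hf hK (r ≫ g)
  exact ⟨i ≫ g', by rw [Category.assoc, hg', ← Category.assoc, h, Category.id_comp]⟩

omit [FiniteDimensional k H] in
theorem projective_resA_of_retract [Module.Projective A ((resA k A H).obj N)]
    (i : M ⟶ N) (r : N ⟶ M) (h : i ≫ r = 𝟙 M) : Module.Projective A ((resA k A H).obj M) :=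
  Module.Projective.of_split ((resA k A H).map i).hom ((resA k A H).map r).hom (by
    rw [← ModuleCat.hom_comp, ← Functor.map_comp, h, CategoryTheory.Functor.map_id]
    rfl)

omit [FiniteDimensional k H] in
/-- A direct summand of a module with property (P) is a retract of a filtered module. -/
theorem exists_retract_of_hasPropertyP (hN : HasPropertyP N)
    (e : N ≃ₗ[Smash k A H] M × M') :
    ∃ (P : ModuleCat.{u} (Smash k A H)) (i : M ⟶ P) (r : P ⟶ M),
      IsPropertyPFiltered P ∧ i ≫ r = 𝟙 M := by
  obtain ⟨P, ⟨e'⟩, hP⟩ := hN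
  refine ⟨P, ModuleCat.ofHom (e.symm.toLinearMap ∘ₗ LinearMap.inl _ M M') ≫ e'.hom,
    e'.inv ≫ ModuleCat.ofHom (LinearMap.fst _ M M' ∘ₗ e.toLinearMap), hP, ?_⟩
  rw [Category.assoc, Iso.hom_inv_id_assoc]
  ext x
  simp

/-- A cofibrant module is a direct summand of a module with property (P): its resolution
splits. -/
theorem LiftsAgainstInjectiveKernels.exists_summand (hM : LiftsAgainstInjectiveKernels M) :
    ∃ N M' : ModuleCat.{u} (Smash k A H), IsPropertyPFiltered N ∧
      Nonempty (N ≃ₗ[Smash k A H] M × M') := by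
  obtain ⟨N, g, hN, hg, hK⟩ := exists_propertyP_resolution M
  obtain ⟨s, hs⟩ := hM g hg hK (𝟙 M)
  have hs' : ∀ x, g.hom (s.hom x) = x := fun x =>
    LinearMap.congr_fun (congrArg ModuleCat.Hom.hom hs) x
  refine ⟨N, ModuleCat.of _ (LinearMap.ker g.hom), hN, ⟨LinearEquiv.ofLinearMap
    (g.hom.prod ((LinearMap.id - s.hom ∘ₗ g.hom).codRestrict _ fun x => by simp [hs']))
    (s.hom.coprod (LinearMap.ker g.hom).subtype) ?_ ?_⟩⟩
  · refine LinearMap.ext fun ⟨m, x, hx⟩ => Prod.ext ?_ (Subtype.ext ?_)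
    · change g.hom (s.hom m + x) = m
      rw [map_add, hs', hx, add_zero]
    · change s.hom m + x - s.hom (g.hom (s.hom m + x)) = x
      rw [map_add, hs', hx, add_zero, add_sub_cancel_left]
  · refine LinearMap.ext fun x => ?_
    change s.hom (g.hom x) + (x - s.hom (g.hom x)) = x
    rw [add_sub_cancel]

end Summand

end Modules

end Hopfological

end

theorem mainTheorem3 {k A H : Type u} [Field k] [Ring H] [HopfAlgebra k H] [FiniteDimensional k H]
    [Ring A] [Algebra k A] [Module H A] [Hopfological.IsModuleAlgebra k H A]
    (M : ModuleCat.{u} (Hopfological.Smash k A H)) :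
    (Hopfological.IsCofibrant M ↔
      Module.Projective A ((Hopfological.resA k A H).obj M) ∧
      ∀ K : ModuleCat.{u} (Hopfological.Smash k A H), Hopfological.IsAcyclic K →
        Module.Projective H (Hopfological.HomA M K) ∧
        Module.Injective H (Hopfological.HomA M K)) ∧
    (Hopfological.IsCofibrant M ↔
      ∃ N M' : ModuleCat.{u} (Hopfological.Smash k A H), Hopfological.HasPropertyP N ∧
        Nonempty (N ≃ₗ[Hopfological.Smash k A H] M × M')) := by
  simp only [Hopfological.isCofibrant_iff, Hopfological.isAcyclic_iff]
  refine ⟨⟨fun hM => ⟨?_, fun K hK => ?_⟩, fun ⟨hA, hM⟩ => ?_⟩, fun hM => ?_,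
    fun ⟨N, M', hN, ⟨e⟩⟩ => ?_⟩
  · obtain ⟨N, M', hN, ⟨e⟩⟩ := hM.exists_summand
    obtain ⟨P, i, r, hP, hir⟩ :=
      Hopfological.exists_retract_of_hasPropertyP ⟨N, ⟨Iso.refl N⟩, hN⟩ e
    have := hP.projective_resA
    exact Hopfological.projective_resA_of_retract i r hir
  · have := hM.injective_homA hK
    exact ⟨Hopfological.projective_of_injective k, this⟩
  · exact Hopfological.liftsAgainstInjectiveKernels_of_injective_homA hA fun K hK => (hM K hK).2
  · obtain ⟨N, M', hN, he⟩ := hM.exists_summand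
    exact ⟨N, M', ⟨N, ⟨Iso.refl N⟩, hN⟩, he⟩
  · obtain ⟨P, i, r, hP, hir⟩ := Hopfological.exists_retract_of_hasPropertyP hN e
    exact hP.liftsAgainstInjectiveKernels.of_retract i r hir
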